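/- Let $N\ge 2$, $\gamma\in(0,1)$, let $0=\mu_0\le\mu_1\le\mu_2\le\dots$ be the eigenvalues of $-\Delta_{\mathbb S^{N-1}}$ repeated according to multiplicity, fix $m\ge 0$, put $$A_m=\tfrac12+\tfrac\gamma2+\tfrac12\sqrt{(\tfrac N2-1)^2+\mu_m},\qquad B_m=\tfrac12-\tfrac\gamma2+\tfrac12\sqrt{(\tfrac N2-1)^2+\mu_m},$$ $$\Theta_m(z)=2^{2\gamma}\frac{\Gamma(A_m+\frac z2 i)\Gamma(A_m-\frac z2 i)}{\Gamma(B_m+\frac z2 i)\Gamma(B_m-\frac z2 i)}\quad(z\in\mathbb C),\qquad \Lambda_{N,\gamma}=2^{2\gamma}\frac{\Gamma(\frac{N+2\gamma}4)^2}{\Gamma(\frac{N-2\gamma}4)^2},$$ and let $0\le\kappa<\Lambda_{N,\gamma}$. Write $\hat v(\xi)=\frac1{\sqrt{2\pi}}\int_{\mathbb R}e^{-i\xi t}v(t)\,dt$, and let $P_\gamma^m$ be the Fourier multiplier with symbol $\Theta_m$. We say that $w$ solves $$P_\gamma^m w-\kappa w=h \qquad(1)$$ on the line $\mathbb R+i\vartheta$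 if $e^{\vartheta t}w$ and $e^{\vartheta t}(\kappa w+h)$ are tempered (absolutely integrable against every Schwartz function) and $\Theta_m(\xi+i\vartheta)\,\widehat{e^{\vartheta\cdot}w}(\xi)=\widehat{e^{\vartheta\cdot}(\kappa w+h)}(\xi)$ in the sense of tempered distributions, that is, $\int e^{\vartheta t}w\,\hat\chi\,dt=\int e^{\vartheta t}(\kappa w+h)\,\hat\varphi\,dt$ for all Schwartz functions $\varphi,\chi$ with $\chi(\xi)=\Theta_m(\xi+i\vartheta)\varphi(\xi)$ for a.e. $\xi$; for $\vartheta=0$ this is the usual Fourier form of (1). Then there are real sequences $(\tau_j),(\sigma_j),(d_j),(d_j')$, $j\ge0$, depending only on $N,\gamma,m,\kappa$, with the following properties. **i.** The function $\frac1{\Theta_m(z)-\kappa}$ is meromorphic in $\mathbb C$. Its poles are exactly the points $\tau_j\pm i\sigma_j$ and $-\tau_j\pm i\sigma_j$, $j\ge0$, where the pairs $(\tau_j,\sigma_j)$ are distinct and listed so that $\sigma_0\le\sigma_1\le\dots$. Here $\sigma_j>\sigma_0>0$ for $j\ge1$, $\tau_j\ge0$ for all $j$, $\tau_0=0$, and $\tau_j=0$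 for $j$ large enough; for such $j$ the sequence $\sigma_j$ is strictly increasing, and $\sigma_j\to\infty$ (no accumulation points). The constants are given by the residue $\rho_j$ of $\frac1{\Theta_m-\kappa}$ at $\tau_j+i\sigma_j$: $d_j-i d_j'=i\rho_j$ if $\tau_j=0$, and $d_j-id_j'=2i\rho_j$ if $\tau_j\ne0$. Put $M_j(t)=e^{-\sigma_jt}[d_j\cos(\tau_jt)+d_j'\sin(\tau_jt)]$. **ii.** The series $$\mathcal G_m(t)=d_0e^{-\sigma_0|t|}+\sum_{j=1}^\infty e^{-\sigma_j|t|}[d_j\cos(\tau_j|t|)+d_j'\sin(\tau_j|t|)]$$ converges for $t\ne0$; $\mathcal G_m$ is even, $\mathcal C^\infty$ on $\mathbb R\setminus\{0\}$, integrable, and $\int_{\mathbb R}e^{-i\xi t}\mathcal G_m(t)\,dt=\frac1{\Theta_m(\xi)-\kappa}$ for all $\xi\in\mathbb R$. If $h:\mathbb R\to\mathbb R$ is locally integrable, $h(t)=O(e^{-\delta t})$ as $t\to+\infty$ and $h(t)=O(e^{\delta_0t})$ as $t\to-\infty$ with $\delta>0$, $\delta_0\ge0$, then $w(t)=\int_{\mathbb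 R}h(t')\mathcal G_m(t-t')\,dt'$ (absolutely convergent for a.e. $t$) is a solution of (1) (on the line $\vartheta=0$). **iii.** Let $J\ge0$ and put $$\widetilde{\mathcal G}_m(t)=\sum_{j=J+1}^\infty M_j(t)\ \ (t>0),\qquad \widetilde{\mathcal G}_m(t)=\mathcal G_m(t)-\sum_{j=0}^J M_j(t)\ \ (t<0).$$ The series converges, $\widetilde{\mathcal G}_m$ is $\mathcal C^\infty$ on $\mathbb R\setminus\{0\}$, and for $\sigma_J<\vartheta<\sigma_{J+1}$ the function $e^{\vartheta t}\widetilde{\mathcal G}_m(t)$ is integrable with $\int_{\mathbb R}e^{-i(\xi+i\vartheta)t}\widetilde{\mathcal G}_m(t)\,dt=\frac1{\Theta_m(\xi+i\vartheta)-\kappa}$ for a.e. $\xi\in\mathbb R$. Let $h:\mathbb R\to\mathbb R$ be locally integrable with $h(t)=O(e^{-\delta t})$ as $t\to+\infty$, $h(t)=O(e^{\delta_0t})$ as $t\to-\infty$, where $\delta,\delta_0\in\mathbb R$, $\delta+\delta_0\ge0$ and $\sigma_J<\delta<\sigma_{J+1}$ (thus $\delta_0>-\sigma_{J+1}$). Then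 $w(t)=\int_{\mathbb R}h(t')\widetilde{\mathcal G}_m(t-t')\,dt'$ (absolutely convergent for a.e. $t$) is a solution of (1) on every line $\mathbb R+i\vartheta$ with $\sigma_J<\vartheta<\sigma_{J+1}$, $-\delta_0\le\vartheta\le\delta$, and $$w(t)=O(e^{-\delta t})\ \text{ as }t\to+\infty,\qquad w(t)=\sum_{j=0}^JD_j(t)e^{-\sigma_jt}+R(t),$$ where, as $t\to-\infty$, $R(t)=O(e^{\delta_0t})$ if $\delta_0<\sigma_0$, $R(t)=O(|t|e^{\sigma_0t})$ if $\delta_0=\sigma_0$, $R(t)=O(e^{\sigma_0t})$ if $\delta_0>\sigma_0$, and $$\begin{aligned}D_j(t)=&-d_j\Big[\cos(\tau_jt)\int_t^{\infty}e^{\sigma_jt'}\cos(\tau_jt')h(t')\,dt'+\sin(\tau_jt)\int_t^{\infty}e^{\sigma_jt'}\sin(\tau_jt')h(t')\,dt'\Big]\\&-d_j'\Big[\sin(\tau_jt)\int_t^{\infty}e^{\sigma_jt'}\cos(\tau_jt')h(t')\,dt'-\cos(\tau_jt)\int_t^{\infty}e^{\sigma_jt'}\sin(\tau_jt')h(t')\,dt'\Big]\end{aligned}$$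 (the integrals converge absolutely). If $j\le J$, $\tau_j=0$ and $e^{\sigma_jt'}h(t')$ is integrable on $\mathbb R$, which is the case for every $j\le J$ with $\delta_0>-\sigma_j$, then $D_j(t)\to-d_j\int_{\mathbb R}e^{\sigma_jt'}h(t')\,dt'$ as $t\to-\infty$. -/

import Mathlib

open MeasureTheory Filter Topology Asymptotics
open scoped SchwartzMap

noncomputable section

namespace HardyCylinder

/-- Dimension of the space of spherical harmonics of degree `l` on the unit sphere of
`ℝ ^ N` (for `2 ≤ N`). -/
def harmonicDim (N : ℕ) : ℕ → ℕ
  | 0 => 1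
  | 1 => N
  | l + 2 => (N + l + 1).choose (l + 2) - (N + l - 1).choose l

/-- Degree of the `m`-th spherical harmonic (`m = 0, 1, 2, …`), when the spherical harmonics are
listed by increasing degree, each degree `l` being repeated `harmonicDim N l` times. -/
def harmonicDegree (N m : ℕ) : ℕ :=
  sInf {l : ℕ | m < ∑ i ∈ Finset.range (l + 1), harmonicDim N i}

/-- `μ_m`: the `m`-th eigenvalue of `-Δ` on the unit sphere of `ℝ ^ N`, repeated according to
multiplicity; a spherical harmonic of degree `l` has eigenvalue `l (l + N - 2)`. -/
def sphereEigenvalue (N m : ℕ) : ℝ :=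
  (harmonicDegree N m : ℝ) * ((harmonicDegree N m : ℝ) + (N : ℝ) - 2)

/-- The constant `A_m`. -/
def constA (N : ℕ) (γ : ℝ) (m : ℕ) : ℝ :=
  1 / 2 + γ / 2 + 1 / 2 * √(((N : ℝ) / 2 - 1) ^ 2 + sphereEigenvalue N m)

/-- The constant `B_m`. -/
def constB (N : ℕ) (γ : ℝ) (m : ℕ) : ℝ :=
  1 / 2 - γ / 2 + 1 / 2 * √(((N : ℝ) / 2 - 1) ^ 2 + sphereEigenvalue N m)

/-- The symbol `Θ_m`, extended to the complex plane. (At the poles of the numerator the value is a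
convention without importance: the theorem only uses notions that ignore a discrete set.) -/
def symbol (N : ℕ) (γ : ℝ) (m : ℕ) (z : ℂ) : ℂ :=
  (((2 : ℝ) ^ (2 * γ) : ℝ) : ℂ) *
    (Complex.Gamma (constA N γ m + z / 2 * Complex.I) *
      Complex.Gamma (constA N γ m - z / 2 * Complex.I)) /
    (Complex.Gamma (constB N γ m + z / 2 * Complex.I) *
      Complex.Gamma (constB N γ m - z / 2 * Complex.I))

/-- The sharp constant `Λ_{N,γ}` of the fractional Hardy inequality in `ℝ ^ N`. -/
def hardyConst (N : ℕ) (γ : ℝ) : ℝ :=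
  (2 : ℝ) ^ (2 * γ) * Real.Gamma (((N : ℝ) + 2 * γ) / 4) ^ 2 /
    Real.Gamma (((N : ℝ) - 2 * γ) / 4) ^ 2

/-- The inverted symbol `1 / (Θ_m - κ)`. -/
def resolventSymbol (N : ℕ) (γ : ℝ) (m : ℕ) (κ : ℝ) (z : ℂ) : ℂ :=
  1 / (symbol N γ m z - κ)

/-- `ρ` is the residue of `f` at `c`: the integral of `f` over every small positively oriented
circle around `c` is `2 π i ρ`. -/
def HasResidue (f : ℂ → ℂ) (c ρ : ℂ) : Prop :=
  ∀ᶠ r : ℝ in 𝓝[>] 0, (∮ z in C(c, r), f z) = 2 * Real.pi * Complex.I * ρ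

/-- The one-dimensional Fourier transform, in the unitary normalization. -/
def fourierHat (φ : ℝ → ℂ) (ξ : ℝ) : ℂ :=
  ((1 / √(2 * Real.pi) : ℝ) : ℂ) * ∫ t : ℝ, Complex.exp (-(Complex.I * ξ * t)) * φ t

/-- `f` pairs absolutely with every Schwartz function (and so defines a tempered distribution). -/
def IsTemperedFun (f : ℝ → ℝ) : Prop :=
  ∀ φ : 𝓢(ℝ, ℂ), Integrable (fun t : ℝ => (f t : ℂ) * φ t)

/-- `P_γ^m w = g`, where `P_γ^m` is the Fourier multiplier with symbol `Θ_m`, read on the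
horizontal line `ℝ + iϑ`. The Fourier transform of `w` on that line is that of `e^{ϑ t} w(t)`,
so the relation is `Θ_m(ξ + iϑ) (e^{ϑ ·} w)^(ξ) = (e^{ϑ ·} g)^(ξ)`, as tempered distributions in
`ξ`: a test function `φ` on the right is paired with `χ = Θ_m(· + iϑ) φ` on the left, and
`⟨v^, χ⟩ = ⟨v, χ^⟩`. For `ϑ = 0` this is the usual Fourier multiplier. -/
def IsFracOp (N : ℕ) (γ : ℝ) (m : ℕ) (ϑ : ℝ) (w g : ℝ → ℝ) : Prop :=
  IsTemperedFun (fun t => Real.exp (ϑ * t) * w t) ∧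
  IsTemperedFun (fun t => Real.exp (ϑ * t) * g t) ∧
  ∀ φ χ : 𝓢(ℝ, ℂ),
    (∀ᵐ ξ : ℝ, χ ξ = symbol N γ m ((ξ : ℂ) + ϑ * Complex.I) * φ ξ) →
    ∫ t : ℝ, ((Real.exp (ϑ * t) * w t : ℝ) : ℂ) * fourierHat χ t =
      ∫ t : ℝ, ((Real.exp (ϑ * t) * g t : ℝ) : ℂ) * fourierHat φ t

/-- `w` solves `P_γ^m w - κ w = h`, the operator being read on the line `ℝ + iϑ`. -/
def IsSolution (N : ℕ) (γ : ℝ) (m : ℕ) (κ ϑ : ℝ) (w h : ℝ → ℝ) : Prop :=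
  IsFracOp N γ m ϑ w (fun t => κ * w t + h t)

/-- `e^{-σ_j t} [d_j cos (τ_j t) + d_j' sin (τ_j t)]`. -/
def mode (τ σ d d' : ℕ → ℝ) (j : ℕ) (t : ℝ) : ℝ :=
  Real.exp (-(σ j * t)) * (d j * Real.cos (τ j * t) + d' j * Real.sin (τ j * t))

/-- The Green's function `𝒢_m`. -/
def green (τ σ d d' : ℕ → ℝ) (t : ℝ) : ℝ :=
  d 0 * Real.exp (-(σ 0 * |t|)) + ∑' j : ℕ, mode τ σ d d' (j + 1) |t|

/-- The Green's function of the line lying between the `J`-th and the `J + 1`-st poles. -/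
def shiftedGreen (τ σ d d' : ℕ → ℝ) (J : ℕ) (t : ℝ) : ℝ :=
  if 0 < t then ∑' j : ℕ, mode τ σ d d' (J + 1 + j) t
  else green τ σ d d' t - ∑ j ∈ Finset.range (J + 1), mode τ σ d d' j t

/-- `∫ h(t') k(t - t') dt'`. -/
def convolve (h k : ℝ → ℝ) (t : ℝ) : ℝ := ∫ s : ℝ, h s * k (t - s)

/-- The coefficient functions `D_j(t)` of the multipole expansion. -/
def multipole (τ σ d d' : ℕ → ℝ) (h : ℝ → ℝ) (j : ℕ) (t : ℝ) : ℝ :=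
  -(d j *
      (Real.cos (τ j * t) * (∫ s in Set.Ioi t, Real.exp (σ j * s) * Real.cos (τ j * s) * h s) +
        Real.sin (τ j * t) * ∫ s in Set.Ioi t, Real.exp (σ j * s) * Real.sin (τ j * s) * h s) +
    d' j *
      (Real.sin (τ j * t) * (∫ s in Set.Ioi t, Real.exp (σ j * s) * Real.cos (τ j * s) * h s) -
        Real.cos (τ j * t) * ∫ s in Set.Ioi t, Real.exp (σ j * s) * Real.sin (τ j * s) * h s))

end HardyCylinder

end

/-!
By Euler's product for the Gamma function, `Θ_m` is, in the variable `x = z²`, the limit of rational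
functions `c_n ∏ (b_k + x) / (p_k + x)` with interlacing zeros `-b_k` and poles `-p_k`. Between two
consecutive poles such a function takes the value `κ` exactly once, so that its resolvent at `κ` has
a partial fraction expansion with nonnegative coefficients. These expansions converge along a
subsequence, and their limit is `1 / (Θ_m - κ)` up to a nonnegative constant, which vanishes because
`Θ_m → ∞` on the positive axis:
`1 / (Θ_m(z) - κ) = ∑ 2 d_j σ_j / (z² + σ_j²)` with `d_j > 0`.
In particular all poles are simple and lie on the imaginary axis (`τ_j = 0`, `d_j' = 0`).

Inverting the Fourier transform termwise gives `𝒢_m = ∑ d_j e^{-σ_j |t|}`. On the line `ℝ + iϑ` with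
`σ_J < ϑ < σ_{J+1}` the inverse transform differs by the modes `d_j e^{-σ_j t}`, `j ≤ J`, which it
loses on the whole line; convolution of `h` with the part lost for `t < 0` produces the multipoles
`D_j e^{-σ_j t}`, and what remains is the convolution with a kernel decaying at both ends.
-/

noncomputable section

namespace HardyCylinder

/-- The left ends `0, p 0, p 1, …` of the gaps between consecutive terms of `p`. -/
def leftEnd (p : ℕ → ℝ) : ℕ → ℝ
  | 0 => 0
  | k + 1 => p k

/-- Interlacing sequences `0 < b 0 < p 0 < b 1 < p 1 < …`, such as the zeros `-b k` and the poles
`-p k` of a rational function that takes every value between two consecutive poles. -/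
structure Interlacing (b p : ℕ → ℝ) : Prop where
  leftEnd_lt : ∀ k, leftEnd p k < b k
  lt : ∀ k, b k < p k

namespace Interlacing

variable {b p : ℕ → ℝ}

theorem strictMono_leftEnd (H : Interlacing b p) : StrictMono (leftEnd p) :=
  strictMono_nat_of_lt_succ fun k => (H.leftEnd_lt k).trans (H.lt k)

theorem le_leftEnd (H : Interlacing b p) {i k : ℕ} (h : i < k) : p i ≤ leftEnd p k :=
  H.strictMono_leftEnd.monotone h

theorem leftEnd_nonneg (H : Interlacing b p) (k : ℕ) : 0 ≤ leftEnd p k :=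
  H.strictMono_leftEnd.monotone k.zero_le

theorem zero_pos (H : Interlacing b p) (k : ℕ) : 0 < b k :=
  (H.leftEnd_nonneg k).trans_lt (H.leftEnd_lt k)

theorem pole_pos (H : Interlacing b p) (k : ℕ) : 0 < p k := (H.zero_pos k).trans (H.lt k)

theorem pole_lt_zero (H : Interlacing b p) {i k : ℕ} (h : i < k) : p i < b k :=
  (H.le_leftEnd h).trans_lt (H.leftEnd_lt k)

theorem zero_le_zero (H : Interlacing b p) {i k : ℕ} (h : i ≤ k) : b i ≤ b k := by
  rcases h.eq_or_lt with rfl | h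
  · exact le_rfl
  · exact ((H.lt i).trans (H.pole_lt_zero h)).le

theorem strictMono_of_mem_gap (H : Interlacing b p) {a : ℕ → ℝ}
    (hl : ∀ k, leftEnd p k < a k) (hr : ∀ k, a k ≤ b k) : StrictMono a :=
  strictMono_nat_of_lt_succ fun k => ((hr k).trans_lt (H.lt k)).trans (hl (k + 1))

end Interlacing

theorem neg_one_pow_mul_prod_sub_pos {s : ℕ → ℝ} {x : ℝ} {k n : ℕ} (hkn : k ≤ n)
    (hlt : ∀ i < k, s i < x) (hgt : ∀ i, k ≤ i → x < s i) :
    0 < (-1) ^ k * ∏ i ∈ Finset.range n, (s i - x) := by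
  induction n, hkn using Nat.le_induction with
  | base =>
    rw [← Finset.card_range k, ← Finset.prod_const, Finset.card_range, ← Finset.prod_mul_distrib]
    exact Finset.prod_pos fun i hi => by linarith [hlt i (Finset.mem_range.1 hi)]
  | succ n hkn ih =>
    rw [Finset.prod_range_succ, ← mul_assoc]
    exact mul_pos ih (sub_pos.2 (hgt n hkn))

theorem Interlacing.exists_root {b p : ℕ → ℝ} (H : Interlacing b p) {M κ : ℝ} (hM : 0 < M)
    (hκ : 0 ≤ κ) {k n : ℕ} (hkn : k < n)
    (hpos : κ * ∏ i ∈ Finset.range n, p i < M * ∏ i ∈ Finset.range n, b i) :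
    ∃ a, leftEnd p k < a ∧ a ≤ b k ∧
      M * ∏ i ∈ Finset.range n, (b i - a) = κ * ∏ i ∈ Finset.range n, (p i - a) := by
  set f : ℝ → ℝ := fun x =>
    (-1) ^ k * (M * ∏ i ∈ Finset.range n, (b i - x) - κ * ∏ i ∈ Finset.range n, (p i - x)) with hf
  have hleft : 0 < f (leftEnd p k) := by
    rcases k with _ | k
    · simpa only [hf, leftEnd, pow_zero, one_mul, sub_zero, sub_pos] using hpos
    · have hp : ∏ i ∈ Finset.range n, (p i - p k) = 0 :=
        Finset.prod_eq_zero (Finset.mem_range.2 (by omega : k < n)) (sub_self _)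
      have hb : 0 < (-1) ^ (k + 1) * ∏ i ∈ Finset.range n, (b i - p k) :=
        neg_one_pow_mul_prod_sub_pos hkn.le
          (fun i hi => (H.zero_le_zero (Nat.le_of_lt_succ hi)).trans_lt (H.lt k))
          fun i hi => H.pole_lt_zero hi
      simp only [hf, leftEnd, hp]
      linarith [mul_pos hM hb]
  have hright : f (b k) ≤ 0 := by
    have hb : ∏ i ∈ Finset.range n, (b i - b k) = 0 :=
      Finset.prod_eq_zero (Finset.mem_range.2 hkn) (sub_self _)
    have hp : 0 < (-1) ^ k * ∏ i ∈ Finset.range n, (p i - b k) :=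
      neg_one_pow_mul_prod_sub_pos hkn.le (fun i hi => H.pole_lt_zero hi)
        fun i hi => (H.zero_le_zero hi).trans_lt (H.lt i)
    simp only [hf, hb]
    linarith [mul_nonneg hκ hp.le]
  obtain ⟨a, ⟨hla, hab⟩, ha⟩ := intermediate_value_Icc' (H.leftEnd_lt k).le
    (by fun_prop : Continuous f).continuousOn ⟨hright, hleft.le⟩
  refine ⟨a, hla.lt_of_ne fun h => hleft.ne' (h ▸ ha), hab, ?_⟩
  simpa only [hf, mul_eq_zero, pow_eq_zero_iff', neg_eq_zero, one_ne_zero, false_and, false_or,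
    sub_eq_zero] using ha

section PartialFractions

variable {ι K : Type*} [Field K]

open Polynomial Lagrange in
theorem degree_nodal_sub_nodal_lt (s : Finset ι) (u v : ι → K) :
    (nodal s u - nodal s v).degree < s.card := by
  rw [← degree_nodal (s := s) (v := u)]
  exact degree_sub_lt_left (by rw [degree_nodal, degree_nodal]) nodal_ne_zero
    (by rw [nodal_monic.leadingCoeff, nodal_monic.leadingCoeff])

open Lagrange in
theorem eval_nodal_neg (s : Finset ι) (u : ι → K) (x : K) :
    (nodal s fun i => -u i).eval x = ∏ i ∈ s, (u i + x) := by
  rw [eval_nodal]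
  exact Finset.prod_congr rfl fun i _ => by ring

theorem mul_prod_sub_mul_prod {s : Finset ι} {a b p : ι → K} {M κ : K} (ha : Set.InjOn a s)
    (hroot : ∀ i ∈ s, M * ∏ j ∈ s, (b j - a i) = κ * ∏ j ∈ s, (p j - a i)) (x : K) :
    M * ∏ j ∈ s, (b j + x) - κ * ∏ j ∈ s, (p j + x) = (M - κ) * ∏ j ∈ s, (a j + x) := by
  let q (u : ι → K) := Lagrange.nodal s fun i => -u i
  have hdeg : (M • (q b - q a) - κ • (q p - q a)).degree < s.card :=
    (Polynomial.degree_sub_le _ _).trans_lt <| max_lt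
      ((Polynomial.degree_smul_le _ _).trans_lt (degree_nodal_sub_nodal_lt s _ _))
      ((Polynomial.degree_smul_le _ _).trans_lt (degree_nodal_sub_nodal_lt s _ _))
  have hzero : M • (q b - q a) - κ • (q p - q a) = 0 := by
    refine Polynomial.eq_zero_of_degree_lt_of_eval_index_eq_zero s (v := fun i => -a i)
      (fun i hi j hj h => ha hi hj (neg_injective h)) hdeg fun i hi => ?_
    have hai : ∏ j ∈ s, (a j + -a i) = 0 := Finset.prod_eq_zero hi (add_neg_cancel _)
    have hi := hroot i hi
    simp only [sub_eq_add_neg] at hi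
    simp only [q, Polynomial.eval_sub, Polynomial.eval_smul, eval_nodal_neg, smul_eq_mul, hai]
    linear_combination hi
  have hx := congrArg (Polynomial.eval x) hzero
  simp only [q, Polynomial.eval_sub, Polynomial.eval_smul, eval_nodal_neg, smul_eq_mul,
    Polynomial.eval_zero] at hx
  linear_combination hx

variable [DecidableEq ι]

/-- The residue at `-a i` of `∏ j ∈ s, (p j + x) / (a j + x)`. -/
def prodResidue (s : Finset ι) (p a : ι → K) (i : ι) : K :=
  (∏ j ∈ s, (p j - a i)) * ∏ j ∈ s.erase i, (a j - a i)⁻¹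

theorem prod_add_eq_mul_one_add_sum {s : Finset ι} {a : ι → K} (p : ι → K) (ha : Set.InjOn a s)
    {x : K} (hx : ∀ i ∈ s, x ≠ -a i) :
    ∏ j ∈ s, (p j + x) = (∏ j ∈ s, (a j + x)) * (1 + ∑ i ∈ s, prodResidue s p a i / (x + a i)) := by
  have hinterp : Lagrange.nodal s (fun i => -p i) - Lagrange.nodal s (fun i => -a i) =
      Lagrange.interpolate s (fun i => -a i) fun i => ∏ j ∈ s, (p j - a i) := by
    refine Lagrange.eq_interpolate_of_eval_eq _
      (fun i hi j hj h => ha hi hj (neg_injective h)) (degree_nodal_sub_nodal_lt s _ _)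
      fun i hi => ?_
    have hai : ∏ j ∈ s, (a j + -a i) = 0 := Finset.prod_eq_zero hi (add_neg_cancel _)
    rw [Polynomial.eval_sub, eval_nodal_neg, eval_nodal_neg, hai, sub_zero]
    simp only [sub_eq_add_neg]
  have heval := Lagrange.eval_interpolate_not_at_node (fun i => ∏ j ∈ s, (p j - a i)) hx
  rw [← hinterp, Polynomial.eval_sub, eval_nodal_neg, eval_nodal_neg] at heval
  rw [mul_one_add, ← sub_eq_iff_eq_add', heval]
  refine congrArg _ (Finset.sum_congr rfl fun i _ => ?_)
  simp only [prodResidue, Lagrange.nodalWeight, sub_neg_eq_add, div_eq_mul_inv, neg_add_eq_sub]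
  ring

theorem mul_prod_div_sub_mul_eq_one {s : Finset ι} {a b p : ι → K} {M κ : K}
    (ha : Set.InjOn a s)
    (hroot : ∀ i ∈ s, M * ∏ j ∈ s, (b j - a i) = κ * ∏ j ∈ s, (p j - a i)) (hM : M ≠ κ) {x : K}
    (hxp : ∀ i ∈ s, x ≠ -p i) (hxa : ∀ i ∈ s, x ≠ -a i) :
    (M * ∏ j ∈ s, (b j + x) / (p j + x) - κ) *
      ((1 + ∑ i ∈ s, prodResidue s p a i / (x + a i)) / (M - κ)) = 1 := by
  have hp : ∏ j ∈ s, (p j + x) ≠ 0 :=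
    Finset.prod_ne_zero_iff.2 fun i hi h => hxp i hi (eq_neg_of_add_eq_zero_right h)
  have hM' : M - κ ≠ 0 := sub_ne_zero.2 hM
  have hb := mul_prod_sub_mul_prod ha hroot x
  have hpa := prod_add_eq_mul_one_add_sum p ha hxa
  rw [Finset.prod_div_distrib]
  field_simp
  linear_combination (1 + ∑ i ∈ s, prodResidue s p a i / (x + a i)) * hb - (M - κ) * hpa

end PartialFractions

theorem Interlacing.prodResidue_nonneg {b p a : ℕ → ℝ} (H : Interlacing b p)
    (hl : ∀ k, leftEnd p k < a k) (hr : ∀ k, a k ≤ b k) {n i : ℕ} (hi : i < n) :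
    0 ≤ prodResidue (Finset.range n) p a i := by
  have hmono := H.strictMono_of_mem_gap hl hr
  rw [prodResidue, ← Finset.mul_prod_erase _ _ (Finset.mem_range.2 hi), mul_assoc,
    ← Finset.prod_mul_distrib]
  refine mul_nonneg (sub_nonneg.2 ((hr i).trans (H.lt i).le)) (Finset.prod_nonneg fun k hk => ?_)
  rcases (Finset.ne_of_mem_erase hk).lt_or_gt with h | h
  · exact mul_nonneg_of_nonpos_of_nonpos (sub_nonpos.2 ((H.le_leftEnd h).trans (hl i).le))
      (inv_nonpos.2 (sub_nonpos.2 (hmono h).le))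
  · exact mul_nonneg (sub_nonneg.2 (((hmono h).le.trans (hr k)).trans (H.lt k).le))
      (inv_nonneg.2 (sub_nonneg.2 (hmono h).le))

/-- The rational function `c n * ∏ k ≤ n, (b k + x) / (p k + x)`; Euler's formula for the Gamma
function presents the symbol as a limit of such functions of `x = z ^ 2`. -/
def truncProd (c b p : ℕ → ℝ) (n : ℕ) (x : ℂ) : ℂ :=
  c n * ∏ k ∈ Finset.range (n + 1), (b k + x) / (p k + x)

theorem truncProd_ofReal (c b p : ℕ → ℝ) (n : ℕ) (y : ℝ) :
    truncProd c b p n y =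
      ((c n * ∏ k ∈ Finset.range (n + 1), (b k + y) / (p k + y) : ℝ) : ℂ) := by
  simp only [truncProd]
  push_cast
  rfl

theorem Interlacing.exists_partialFractions {b p c : ℕ → ℝ} (H : Interlacing b p) {κ : ℝ} {n : ℕ}
    (hκ : 0 ≤ κ) (hpos : κ < c n * ∏ k ∈ Finset.range (n + 1), b k / p k) :
    ∃ a d : ℕ → ℝ, (∀ k, leftEnd p k < a k ∧ a k ≤ b k) ∧ (∀ k, 0 ≤ d k) ∧
      (∀ k ∉ Finset.range (n + 1), d k = 0) ∧ κ < c n ∧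
      ∀ x : ℂ, (∀ k, x ≠ -(p k : ℂ)) → (∀ k, x ≠ -(a k : ℂ)) →
        (truncProd c b p n x - κ) *
          (1 / (c n - κ) + ∑ k ∈ Finset.range (n + 1), d k / (x + a k)) = 1 := by
  have hprod : 0 < ∏ k ∈ Finset.range (n + 1), b k / p k :=
    Finset.prod_pos fun k _ => div_pos (H.zero_pos k) (H.pole_pos k)
  have hc : 0 < c n := pos_of_mul_pos_left (hκ.trans_lt hpos) hprod.le
  have hκc : κ < c n := hpos.trans_le <| mul_le_of_le_one_right hc.le <|
    Finset.prod_le_one (fun k _ => (div_pos (H.zero_pos k) (H.pole_pos k)).le)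
      fun k _ => (div_le_one (H.pole_pos k)).2 (H.lt k).le
  rw [Finset.prod_div_distrib, ← mul_div_assoc,
    lt_div_iff₀ (Finset.prod_pos fun k _ => H.pole_pos k)] at hpos
  have hroot (k : ℕ) : ∃ a, leftEnd p k < a ∧ a ≤ b k ∧ (k < n + 1 →
      c n * ∏ i ∈ Finset.range (n + 1), (b i - a) =
        κ * ∏ i ∈ Finset.range (n + 1), (p i - a)) := by
    by_cases hk : k < n + 1
    · obtain ⟨a, hl, hr, ha⟩ := H.exists_root hc hκ hk hpos
      exact ⟨a, hl, hr, fun _ => ha⟩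
    · exact ⟨b k, H.leftEnd_lt k, le_rfl, fun h => absurd h hk⟩
  choose a hl hr ha using hroot
  have hinj := (Complex.ofReal_injective.comp (H.strictMono_of_mem_gap hl hr).injective).injOn
    (s := (Finset.range (n + 1) : Set ℕ))
  refine ⟨a, fun i => if i ∈ Finset.range (n + 1) then
      prodResidue (Finset.range (n + 1)) p a i / (c n - κ) else 0,
    fun k => ⟨hl k, hr k⟩, fun k => ?_, fun k hk => if_neg hk, hκc, fun x hxp hxa => ?_⟩
  · dsimp only
    split_ifs with hk
    · exact div_nonneg (H.prodResidue_nonneg hl hr (Finset.mem_range.1 hk)) (sub_pos.2 hκc).le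
    · exact le_rfl
  · have h := mul_prod_div_sub_mul_eq_one (a := fun i => (a i : ℂ)) (b := fun i => (b i : ℂ))
      (p := fun i => (p i : ℂ)) (M := (c n : ℂ)) (κ := (κ : ℂ)) hinj
      (fun i hi => by exact_mod_cast congrArg Complex.ofReal (ha i (Finset.mem_range.1 hi)))
      (by exact_mod_cast hκc.ne') (fun i _ => hxp i) (fun i _ => hxa i)
    rw [add_div, Finset.sum_div] at h
    refine Eq.trans (congrArg (fun t : ℂ => (truncProd c b p n x - κ) * (1 / (c n - κ) + t))
      (Finset.sum_congr rfl fun i hi => ?_)) h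
    simp only [if_pos hi, prodResidue]
    push_cast
    ring

theorem Interlacing.exists_expansion_truncProd {b p c : ℕ → ℝ} (H : Interlacing b p) {κ : ℝ}
    {n : ℕ} (hκ : 0 ≤ κ) (hpos : κ < c n * ∏ k ∈ Finset.range (n + 1), b k / p k) :
    ∃ a e : ℕ → ℝ, (∀ k, leftEnd p k < a k ∧ a k ≤ b k) ∧ (∀ k, 0 ≤ e k) ∧
      (∀ s : Finset ℕ, ∑ k ∈ s, e k ≤ 1 / (c n * ∏ k ∈ Finset.range (n + 1), b k / p k - κ)) ∧
      ∀ x : ℂ, (∀ k, x ≠ -(p k : ℂ)) → (∀ k, x ≠ -(a k : ℂ)) →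
        (truncProd c b p n x - κ) *
          (((1 / (c n * ∏ k ∈ Finset.range (n + 1), b k / p k - κ) : ℝ) : ℂ) -
            x * ∑' k, e k / (x + a k)) = 1 := by
  obtain ⟨a, d, ha, hd, hd0, hκc, hid⟩ := H.exists_partialFractions hκ hpos
  have ha0 (k : ℕ) : 0 < a k := (H.leftEnd_nonneg k).trans_lt (ha k).1
  have hne_zero {s : ℕ → ℝ} (hs : ∀ k, 0 < s k) (k : ℕ) : (0 : ℂ) ≠ -(s k : ℂ) :=
    (neg_ne_zero.2 (by exact_mod_cast (hs k).ne')).symm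
  set r := c n * ∏ k ∈ Finset.range (n + 1), b k / p k with hr
  have hvalue_zero : 1 / (r - κ) = 1 / (c n - κ) + ∑ k ∈ Finset.range (n + 1), d k / a k := by
    have h := hid 0 (hne_zero H.pole_pos) (hne_zero ha0)
    rw [← Complex.ofReal_zero, truncProd_ofReal] at h
    simp only [Complex.ofReal_zero, zero_add, add_zero, ← hr] at h
    rw [one_div]
    exact (eq_inv_of_mul_eq_one_right (by exact_mod_cast h)).symm
  refine ⟨a, fun k => d k / a k, ha, fun k => div_nonneg (hd k) (ha0 k).le, fun s => ?_,
    fun x hxp hxa => ?_⟩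
  · have hsum : ∑ k ∈ s, d k / a k ≤ ∑ k ∈ Finset.range (n + 1), d k / a k :=
      sum_le_hasSum s (fun k _ => div_nonneg (hd k) (ha0 k).le)
        (hasSum_sum_of_ne_finset_zero (L := .unconditional ℕ) fun k hk => by
          rw [hd0 k hk, zero_div])
    linarith [one_div_nonneg.2 (sub_pos.2 hκc).le]
  · rw [← hid x hxp hxa, hvalue_zero,
      tsum_eq_sum (s := Finset.range (n + 1)) fun k hk => by simp [hd0 k hk]]
    push_cast
    rw [add_sub_assoc, Finset.mul_sum, ← Finset.sum_sub_distrib]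
    congr 2
    refine Finset.sum_congr rfl fun k _ => ?_
    have hak : (a k : ℂ) ≠ 0 := by exact_mod_cast (ha0 k).ne'
    have hxk : x + a k ≠ 0 := fun h => hxa k (eq_neg_of_add_eq_zero_left h)
    field_simp
    ring

theorem half_le_norm_add {x : ℂ} {a : ℝ} (h : 2 * ‖x‖ ≤ a) : a / 2 ≤ ‖x + a‖ := by
  have hsub := norm_sub_le (x + a) x
  rw [add_sub_cancel_left, Complex.norm_real] at hsub
  linarith [Real.le_norm_self a]

theorem norm_div_add_le {x : ℂ} {l a e C : ℝ} (hl : 2 * ‖x‖ < l) (hla : l ≤ a) (he : 0 ≤ e)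
    (heC : e ≤ C) : ‖(e : ℂ) / (x + a)‖ ≤ 2 * C * l⁻¹ := by
  have hl₀ : 0 < l := by linarith [norm_nonneg x]
  have hden : l / 2 ≤ ‖x + a‖ :=
    (div_le_div_of_nonneg_right hla zero_le_two).trans (half_le_norm_add (hl.le.trans hla))
  rw [norm_div, Complex.norm_real, Real.norm_of_nonneg he]
  calc e / ‖x + a‖ ≤ C / (l / 2) := div_le_div₀ (he.trans heC) heC (half_pos hl₀) hden
    _ = 2 * C * l⁻¹ := by ring

section SimpleFractionLimit

variable {l a' e' : ℕ → ℝ} {a e : ℕ → ℕ → ℝ} {x : ℂ}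

theorem eventually_forall_ne_neg (hl : Tendsto l atTop atTop) (hla : ∀ n k, l k ≤ a n k)
    (ha : ∀ k, Tendsto (fun n => a n k) atTop (𝓝 (a' k))) (hx : ∀ k, x ≠ -(a' k : ℂ)) :
    ∀ᶠ n in atTop, ∀ k, x ≠ -(a n k : ℂ) := by
  obtain ⟨K, hK⟩ := eventually_atTop.1 (hl.eventually (eventually_gt_atTop (2 * ‖x‖)))
  have hsmall : ∀ᶠ n in atTop, ∀ k ∈ Finset.range K, x ≠ -(a n k : ℂ) :=
    (Finset.eventually_all _).2 fun k _ =>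
      (((Complex.continuous_ofReal.tendsto _).comp (ha k)).neg.eventually_ne (hx k).symm).mono
        fun _ h => Ne.symm h
  filter_upwards [hsmall] with n hn k
  rcases lt_or_ge k K with hk | hk
  · exact hn k (Finset.mem_range.2 hk)
  · intro h
    have hak := (hK k hk).trans_le (hla n k)
    have hzero := half_le_norm_add hak.le
    rw [h, neg_add_cancel, norm_zero] at hzero
    linarith [norm_nonneg x]

theorem tendsto_tsum_div_add {C : ℝ} (hl : Tendsto l atTop atTop)
    (hsum : Summable fun k => (l k)⁻¹) (hla : ∀ n k, l k ≤ a n k) (he : ∀ n k, 0 ≤ e n k)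
    (heC : ∀ n k, e n k ≤ C) (ha : ∀ k, Tendsto (fun n => a n k) atTop (𝓝 (a' k)))
    (he' : ∀ k, Tendsto (fun n => e n k) atTop (𝓝 (e' k))) (hx : ∀ k, x ≠ -(a' k : ℂ)) :
    Tendsto (fun n => ∑' k, (e n k : ℂ) / (x + a n k)) atTop
      (𝓝 (∑' k, (e' k : ℂ) / (x + a' k))) := by
  have hterm (k : ℕ) : Tendsto (fun n => (e n k : ℂ) / (x + a n k)) atTop
      (𝓝 ((e' k : ℂ) / (x + a' k))) :=
    ((Complex.continuous_ofReal.tendsto _).comp (he' k)).div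
      (tendsto_const_nhds.add ((Complex.continuous_ofReal.tendsto _).comp (ha k)))
      fun h => hx k (eq_neg_of_add_eq_zero_left h)
  obtain ⟨K, hK⟩ := eventually_atTop.1 (hl.eventually (eventually_gt_atTop (2 * ‖x‖)))
  refine tendsto_tsum_of_dominated_convergence
    (bound := fun k => if k < K then ‖(e' k : ℂ) / (x + a' k)‖ + 1 else 2 * C * (l k)⁻¹)
    ((hsum.mul_left (2 * C)).congr_cofinite ?_) hterm ?_
  · rw [Nat.cofinite_eq_atTop]
    filter_upwards [eventually_ge_atTop K] with k hk
    rw [if_neg hk.not_gt]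
  · have hsmall : ∀ᶠ n in atTop, ∀ k ∈ Finset.range K,
        ‖(e n k : ℂ) / (x + a n k)‖ ≤ ‖(e' k : ℂ) / (x + a' k)‖ + 1 :=
      (Finset.eventually_all _).2 fun k _ =>
        (hterm k).norm.eventually (eventually_le_nhds (lt_add_one _))
    filter_upwards [hsmall] with n hn k
    split_ifs with hk
    · exact hn k (Finset.mem_range.2 hk)
    · exact norm_div_add_le (hK k (not_lt.1 hk)) (hla n k) (he n k) (heC n k)

end SimpleFractionLimit

namespace Interlacing

variable {b p c : ℕ → ℝ}

theorem summable_leftEnd_inv (hp : Summable fun k => (p k)⁻¹) :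
    Summable fun k => (leftEnd p k)⁻¹ :=
  (summable_nat_add_iff 1).1 hp

theorem tendsto_leftEnd (H : Interlacing b p) (hp : Summable fun k => (p k)⁻¹) :
    Tendsto (leftEnd p) atTop atTop := by
  rw [← tendsto_add_atTop_iff_nat 1]
  have hinv : Tendsto (fun k => (p k)⁻¹) atTop (𝓝[>] 0) :=
    tendsto_nhdsWithin_iff.2 ⟨hp.tendsto_atTop_zero, .of_forall fun k => inv_pos.2 (H.pole_pos k)⟩
  exact hinv.inv_tendsto_nhdsGT_zero.congr fun k => inv_inv (p k)

theorem exists_expansion_of_tendsto (H : Interlacing b p) (hp : Summable fun k => (p k)⁻¹)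
    {κ F₀ : ℝ} (hκ : 0 ≤ κ) (hκF : κ < F₀)
    (hF₀ : Tendsto (fun n => c n * ∏ k ∈ Finset.range (n + 1), b k / p k) atTop (𝓝 F₀)) :
    ∃ a e : ℕ → ℝ, (∀ k, leftEnd p k ≤ a k ∧ a k ≤ b k) ∧ (∀ k, 0 ≤ e k) ∧
      (∀ s : Finset ℕ, ∑ k ∈ s, e k ≤ 1 / (F₀ - κ)) ∧
      ∀ x y : ℂ, Tendsto (fun n => truncProd c b p n x) atTop (𝓝 y) →
        (∀ k, x ≠ -(p k : ℂ)) → (∀ k, x ≠ -(a k : ℂ)) →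
          (y - κ) * (((1 / (F₀ - κ) : ℝ) : ℂ) - x * ∑' k, e k / (x + a k)) = 1 := by
  set r : ℕ → ℝ := fun n => c n * ∏ k ∈ Finset.range (n + 1), b k / p k
  have hlim : Tendsto (fun n => 1 / (r n - κ)) atTop (𝓝 (1 / (F₀ - κ))) :=
    tendsto_const_nhds.div (hF₀.sub_const κ) (sub_pos.2 hκF).ne'
  obtain ⟨n₀, hn₀⟩ := eventually_atTop.1 ((hF₀.eventually (eventually_gt_nhds hκF)).and
    (hlim.eventually (eventually_lt_nhds (lt_add_one _))))
  choose a e ha he hes hid using fun n =>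
    H.exists_expansion_truncProd hκ (hn₀ (n₀ + n) (Nat.le_add_right _ _)).1
  have heC (n k : ℕ) : e n k ≤ 1 / (F₀ - κ) + 1 := by
    have hsingle := hes n {k}
    rw [Finset.sum_singleton] at hsingle
    exact hsingle.trans (hn₀ (n₀ + n) (Nat.le_add_right _ _)).2.le
  have hcomp : IsCompact (Set.univ.pi fun k : ℕ =>
      Set.Icc (leftEnd p k) (b k) ×ˢ Set.Icc 0 (1 / (F₀ - κ) + 1)) :=
    isCompact_univ_pi fun k => isCompact_Icc.prod isCompact_Icc
  obtain ⟨L, hL, φ, hφ, hLφ⟩ := hcomp.tendsto_subseq (x := fun n k => (a n k, e n k))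
    fun n k _ => ⟨⟨(ha n k).1.le, (ha n k).2⟩, he n k, heC n k⟩
  rw [tendsto_pi_nhds] at hLφ
  have ha' (k : ℕ) : Tendsto (fun n => a (φ n) k) atTop (𝓝 (L k).1) :=
    (continuous_fst.tendsto _).comp (hLφ k)
  have he' (k : ℕ) : Tendsto (fun n => e (φ n) k) atTop (𝓝 (L k).2) :=
    (continuous_snd.tendsto _).comp (hLφ k)
  have hsub : Tendsto (fun n => n₀ + φ n) atTop atTop :=
    tendsto_atTop_mono (fun n => Nat.le_add_left _ _) hφ.tendsto_atTop
  refine ⟨fun k => (L k).1, fun k => (L k).2, fun k => (hL k trivial).1,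
    fun k => (hL k trivial).2.1, fun s => ?_, fun x y hy hxp hxa => ?_⟩
  · exact le_of_tendsto_of_tendsto' (tendsto_finsetSum s fun k _ => he' k) (hlim.comp hsub)
      fun n => hes (φ n) s
  · have hleft (n k : ℕ) : leftEnd p k ≤ a (φ n) k := (ha (φ n) k).1.le
    have hsum := tendsto_tsum_div_add (H.tendsto_leftEnd hp) (summable_leftEnd_inv hp) hleft
      (fun n => he (φ n)) (fun n => heC (φ n)) ha' he' hxa
    refine tendsto_nhds_unique (((hy.comp hsub).sub_const (κ : ℂ)).mul
      (((Complex.continuous_ofReal.tendsto _).comp (hlim.comp hsub)).sub (hsum.const_mul x)))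
      (tendsto_const_nhds.congr' ?_)
    filter_upwards [eventually_forall_ne_neg (H.tendsto_leftEnd hp) hleft ha' hxa] with n hn
    exact (hid (φ n) x hxp hn).symm

end Interlacing

theorem tendsto_add_div_add_atTop (u v : ℝ) :
    Tendsto (fun y : ℝ => (u + y) / (v + y)) atTop (𝓝 1) := by
  have hv : Tendsto (fun y : ℝ => v + y) atTop atTop := tendsto_atTop_add_const_left _ _ tendsto_id
  have hdiv := ((tendsto_const_nhds (x := u - v)).div_atTop hv).const_add 1
  rw [add_zero] at hdiv
  refine hdiv.congr' ?_
  filter_upwards [hv.eventually (eventually_gt_atTop 0)] with y hy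
  field_simp
  ring

namespace Interlacing

variable {b p c : ℕ → ℝ} {F : ℝ → ℝ}

theorem tendsto_prod_pole_div_zero (hc : Tendsto c atTop atTop) {F₀ : ℝ} (hF₀ : 0 < F₀)
    (hlim : Tendsto (fun n => c n * ∏ k ∈ Finset.range (n + 1), b k / p k) atTop (𝓝 F₀)) :
    Tendsto (fun n => ∏ k ∈ Finset.range (n + 1), p k / b k) atTop atTop := by
  refine (hc.atTop_mul_pos (inv_pos.2 hF₀) (hlim.inv₀ hF₀.ne')).congr' ?_
  filter_upwards [hc.eventually (eventually_gt_atTop 0)] with n hn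
  rw [mul_inv, mul_inv_cancel_left₀ hn.ne', ← Finset.prod_inv_distrib]
  simp only [inv_div]

theorem one_le_div_mul_div (H : Interlacing b p) (k : ℕ) {y : ℝ} (hy : 0 ≤ y) :
    1 ≤ (b k + y) / (p k + y) * (p k / b k) := by
  have hb := H.zero_pos k
  have hp := H.pole_pos k
  rw [div_mul_div_comm, one_le_div (by positivity)]
  nlinarith [mul_le_mul_of_nonneg_right (H.lt k).le hy]

theorem prod_le_prod_of_le (H : Interlacing b p) {K n : ℕ} (hn : K ≤ n) {y : ℝ} (hy : 0 ≤ y) :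
    (∏ k ∈ Finset.range (n + 1), b k / p k) *
        ∏ k ∈ Finset.range (K + 1), (b k + y) / (p k + y) * (p k / b k) ≤
      ∏ k ∈ Finset.range (n + 1), (b k + y) / (p k + y) := by
  calc _ ≤ (∏ k ∈ Finset.range (n + 1), b k / p k) *
        ∏ k ∈ Finset.range (n + 1), (b k + y) / (p k + y) * (p k / b k) := by
        refine mul_le_mul_of_nonneg_left ?_ (Finset.prod_nonneg fun k _ =>
          (div_pos (H.zero_pos k) (H.pole_pos k)).le)
        exact Finset.prod_le_prod_of_subset_of_one_le
          (Finset.range_subset_range.2 (Nat.succ_le_succ hn))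
          (fun k _ => zero_le_one.trans (H.one_le_div_mul_div k hy))
          fun k _ _ => H.one_le_div_mul_div k hy
    _ = ∏ k ∈ Finset.range (n + 1), (b k + y) / (p k + y) := by
        rw [← Finset.prod_mul_distrib]
        refine Finset.prod_congr rfl fun k _ => ?_
        have hb := (H.zero_pos k).ne'
        have hp := (H.pole_pos k).ne'
        field_simp

/-- Finitely many factors of `F y / F 0 = ∏ ((b k + y) / (p k + y)) * (p k / b k)` already tend to
`∏ p k / b k`, which is large, and the remaining ones are at least `1`. -/
theorem tendsto_atTop_of_tendsto_truncProd (H : Interlacing b p) (hc : Tendsto c atTop atTop)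
    (hF₀ : 0 < F 0) (hF : ∀ y, 0 ≤ y →
      Tendsto (fun n => c n * ∏ k ∈ Finset.range (n + 1), (b k + y) / (p k + y)) atTop
        (𝓝 (F y))) :
    Tendsto F atTop atTop := by
  have hlim₀ : Tendsto (fun n => c n * ∏ k ∈ Finset.range (n + 1), b k / p k) atTop
      (𝓝 (F 0)) := by simpa only [add_zero] using hF 0 le_rfl
  have hle (K : ℕ) {y : ℝ} (hy : 0 ≤ y) :
      F 0 * ∏ k ∈ Finset.range (K + 1), (b k + y) / (p k + y) * (p k / b k) ≤ F y := by
    refine le_of_tendsto_of_tendsto (hlim₀.mul_const _) (hF y hy) ?_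
    filter_upwards [eventually_ge_atTop K, hc.eventually (eventually_ge_atTop 0)] with n hn hcn
    rw [mul_assoc]
    exact mul_le_mul_of_nonneg_left (H.prod_le_prod_of_le hn hy) hcn
  refine tendsto_atTop.2 fun C => ?_
  obtain ⟨K, hK⟩ := ((tendsto_prod_pole_div_zero hc hF₀ hlim₀).eventually
    (eventually_gt_atTop (C / F 0))).exists
  have hlim : Tendsto
      (fun y => ∏ k ∈ Finset.range (K + 1), (b k + y) / (p k + y) * (p k / b k)) atTop
      (𝓝 (∏ k ∈ Finset.range (K + 1), p k / b k)) :=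
    tendsto_finsetProd _ fun k _ => by
      simpa only [one_mul] using (tendsto_add_div_add_atTop (b k) (p k)).mul_const (p k / b k)
  filter_upwards [hlim.eventually (eventually_gt_nhds hK), eventually_ge_atTop 0] with y hy hy0
  exact ((div_lt_iff₀' hF₀).1 hy).le.trans (hle K hy0)

end Interlacing

theorem mul_tsum_div_add_le {a e : ℕ → ℝ} (ha : ∀ k, 0 ≤ a k) (he : ∀ k, 0 ≤ e k)
    (hsum : Summable e) {y : ℝ} (hy : 0 < y) : y * ∑' k, e k / (y + a k) ≤ ∑' k, e k := by
  have hterm (k : ℕ) : y * (e k / (y + a k)) ≤ e k := by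
    have hak := ha k
    rw [mul_div_assoc', div_le_iff₀ (by positivity), mul_comm]
    exact mul_le_mul_of_nonneg_left (by linarith) (he k)
  rw [← tsum_mul_left]
  refine Summable.tsum_le_tsum hterm (.of_nonneg_of_le (fun k => ?_) hterm hsum) hsum
  have hak := ha k
  have hek := he k
  positivity

theorem tsum_eq_of_mul_eq_one {a e : ℕ → ℝ} (ha : ∀ k, 0 ≤ a k) (he : ∀ k, 0 ≤ e k) {h₀ : ℝ}
    (hle : ∀ s : Finset ℕ, ∑ k ∈ s, e k ≤ h₀) {G : ℝ → ℝ} (hG : Tendsto G atTop atTop)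
    (hid : ∀ y > 0, G y * (h₀ - y * ∑' k, e k / (y + a k)) = 1) : ∑' k, e k = h₀ := by
  have hsum : Summable e := summable_of_sum_le he hle
  refine le_antisymm (hsum.tsum_le_of_sum_le hle) ?_
  have hlim : Tendsto (fun y => h₀ - (G y)⁻¹) atTop (𝓝 (h₀ - 0)) :=
    tendsto_const_nhds.sub hG.inv_tendsto_atTop
  rw [sub_zero] at hlim
  refine le_of_tendsto hlim ?_
  filter_upwards [eventually_gt_atTop 0] with y hy
  rw [← eq_inv_of_mul_eq_one_right (hid y hy), sub_sub_cancel]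
  exact mul_tsum_div_add_le ha he hsum hy

theorem tsum_sub_mul_tsum_div_add {a e : ℕ → ℝ} (hlim : Tendsto a atTop atTop)
    (hsum : Summable fun k => ‖e k‖) {x : ℂ} (hx : ∀ k, x ≠ -(a k : ℂ)) :
    ((∑' k, e k : ℝ) : ℂ) - x * ∑' k, e k / (x + a k) =
      ∑' k, ((e k * a k : ℝ) : ℂ) / (x + a k) := by
  have hne (k : ℕ) : x + a k ≠ 0 := fun h => hx k (eq_neg_of_add_eq_zero_left h)
  have hdiv : Summable fun k => (e k : ℂ) / (x + a k) := by
    refine Summable.of_norm_bounded_eventually hsum ?_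
    rw [Nat.cofinite_eq_atTop]
    filter_upwards [hlim.eventually (eventually_ge_atTop (2 * ‖x‖)),
      hlim.eventually (eventually_ge_atTop 2)] with k hxk hk
    rw [norm_div, Complex.norm_real]
    exact div_le_self (norm_nonneg _) (by linarith [half_le_norm_add hxk])
  rw [Complex.ofReal_tsum, ← tsum_mul_left,
    ← (Complex.summable_ofReal.2 hsum.of_norm).tsum_sub (hdiv.mul_left _)]
  refine tsum_congr fun k => ?_
  have hk := hne k
  push_cast
  field_simp
  ring

/-- Summability of the coefficients against `1 / a k` expresses that the limit is a Stieltjes sum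
without a constant term. -/
theorem Interlacing.exists_stieltjes {b p c : ℕ → ℝ} {F : ℝ → ℝ} (H : Interlacing b p)
    (hp : Summable fun k => (p k)⁻¹) (hc : Tendsto c atTop atTop) {κ : ℝ} (hκ : 0 ≤ κ)
    (hκF : κ < F 0) (hF : ∀ y, 0 ≤ y →
      Tendsto (fun n => c n * ∏ k ∈ Finset.range (n + 1), (b k + y) / (p k + y)) atTop
        (𝓝 (F y))) :
    ∃ a d : ℕ → ℝ, (∀ k, leftEnd p k ≤ a k ∧ a k ≤ b k) ∧ (∀ k, 0 ≤ d k) ∧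
      (∀ k, a k = 0 → d k = 0) ∧ (Summable fun k => d k / a k) ∧
      ∀ x y : ℂ, Tendsto (fun n => truncProd c b p n x) atTop (𝓝 y) →
        (∀ k, x ≠ -(p k : ℂ)) → (∀ k, x ≠ -(a k : ℂ)) →
          (y - κ) * ∑' k, d k / (x + a k) = 1 := by
  obtain ⟨a, e, ha, he, hes, hid⟩ := H.exists_expansion_of_tendsto hp hκ hκF
    (by simpa only [add_zero] using hF 0 le_rfl)
  have ha0 (k : ℕ) : 0 ≤ a k := (H.leftEnd_nonneg k).trans (ha k).1
  have hsum : Summable e := summable_of_sum_le he hes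
  have htotal : ∑' k, e k = 1 / (F 0 - κ) := by
    refine tsum_eq_of_mul_eq_one ha0 he hes (G := fun y => F y - κ)
      (tendsto_atTop_add_const_right _ _
        (H.tendsto_atTop_of_tendsto_truncProd hc (hκ.trans_lt hκF) hF)) fun y hy => ?_
    have hne {s : ℕ → ℝ} (hs : ∀ k, 0 ≤ s k) (k : ℕ) : (y : ℂ) ≠ -(s k : ℂ) := by
      exact_mod_cast (by linarith [hs k] : -s k < y).ne'
    have hlim : Tendsto (fun n => truncProd c b p n y) atTop (𝓝 (F y : ℂ)) := by
      simp only [truncProd_ofReal]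
      exact (Complex.continuous_ofReal.tendsto _).comp (hF y hy.le)
    exact_mod_cast hid y (F y) hlim (hne fun k => (H.pole_pos k).le) (hne ha0)
  refine ⟨a, fun k => e k * a k, ha, fun k => mul_nonneg (he k) (ha0 k),
    fun k hk => by simp only [hk, mul_zero], hsum.of_nonneg_of_le
      (fun k => div_nonneg (mul_nonneg (he k) (ha0 k)) (ha0 k))
      (fun k => (mul_div_assoc _ _ _).trans_le <|
        mul_le_of_le_one_right (he k) (div_self_le_one _)),
    fun x y hy hxp hxa => ?_⟩
  rw [← hid x y hy hxp hxa, ← htotal, ← tsum_sub_mul_tsum_div_add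
    (tendsto_atTop_mono (fun k => (ha k).1) (H.tendsto_leftEnd hp)) hsum.norm hxa]

/-- `4 (c + k)²`. The points with `z ^ 2 = -node A_m k` are the poles of `Θ_m`, those with
`z ^ 2 = -node B_m k` its zeros. -/
def node (c : ℝ) (k : ℕ) : ℝ := 4 * (c + k) ^ 2

theorem node_pos {c : ℝ} (hc : 0 < c) (k : ℕ) : 0 < node c k := by
  unfold node
  positivity

theorem interlacing_node {B γ : ℝ} (hB : 0 < B) (hγ₀ : 0 < γ) (hγ₁ : γ < 1) :
    Interlacing (node B) (node (B + γ)) where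
  leftEnd_lt k := by
    rcases k with - | k
    · exact node_pos hB 0
    · simp only [leftEnd, node, Nat.cast_succ]
      gcongr 4 * ?_ ^ 2
      linarith
  lt k := by
    unfold node
    gcongr 4 * ?_ ^ 2
    linarith

theorem summable_node_inv (c : ℝ) : Summable fun k => (node c k)⁻¹ := by
  refine ((Real.summable_one_div_nat_add_rpow c 2).2 one_lt_two).mul_left 4⁻¹ |>.congr fun k => ?_
  rw [Real.rpow_two, sq_abs, node, mul_inv, one_div, add_comm c]

theorem node_add_sq (c : ℝ) (k : ℕ) (z : ℂ) :
    (node c k : ℂ) + z ^ 2 =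
      4 * ((c + z / 2 * Complex.I + k) * (c - z / 2 * Complex.I + k)) := by
  rw [node]
  push_cast
  linear_combination z ^ 2 * Complex.I_sq

theorem sq_eq_neg_node_iff {c : ℝ} {k : ℕ} {z : ℂ} :
    z ^ 2 = -(node c k : ℂ) ↔
      c + z / 2 * Complex.I = -k ∨ c - z / 2 * Complex.I = -k := by
  rw [eq_neg_iff_add_eq_zero, add_comm, node_add_sq, mul_eq_zero_iff_left (by norm_num),
    mul_eq_zero, eq_neg_iff_add_eq_zero, eq_neg_iff_add_eq_zero]

/-- The factor `Γ(c + iz/2) Γ(c - iz/2)`, of which `Θ_m` is a quotient. -/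
def gammaPair (c : ℝ) (z : ℂ) : ℂ :=
  Complex.Gamma (c + z / 2 * Complex.I) * Complex.Gamma (c - z / 2 * Complex.I)

theorem gammaPair_eq_zero_iff {c : ℝ} {z : ℂ} :
    gammaPair c z = 0 ↔ ∃ k, z ^ 2 = -(node c k : ℂ) := by
  simp only [gammaPair, mul_eq_zero, Complex.Gamma_eq_zero_iff, sq_eq_neg_node_iff, exists_or]

theorem continuousAt_gammaPair {c : ℝ} {z : ℂ} (hz : ∀ k, z ^ 2 ≠ -(node c k : ℂ)) :
    ContinuousAt (gammaPair c) z := by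
  refine .mul
    (.comp (Complex.differentiableAt_Gamma _ fun k h => hz k ?_).continuousAt (by fun_prop))
    (.comp (Complex.differentiableAt_Gamma _ fun k h => hz k ?_).continuousAt (by fun_prop))
  exacts [sq_eq_neg_node_iff.2 (.inl h), sq_eq_neg_node_iff.2 (.inr h)]

theorem continuous_gammaPair_inv (c : ℝ) : Continuous fun z => (gammaPair c z)⁻¹ := by
  simp only [gammaPair, mul_inv]
  exact (Complex.differentiable_one_div_Gamma.continuous.comp (by fun_prop)).mul
    (Complex.differentiable_one_div_Gamma.continuous.comp (by fun_prop))

/-- `Θ_m` for arbitrary parameters: `symbol N γ m = gammaQuot A_m B_m γ`. -/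
def gammaQuot (A B γ : ℝ) (z : ℂ) : ℂ :=
  ((2 ^ (2 * γ) : ℝ) : ℂ) * gammaPair A z / gammaPair B z

theorem gammaQuot_eq_zero {A B γ : ℝ} {z : ℂ} {k : ℕ} (hz : z ^ 2 = -(node B k : ℂ)) :
    gammaQuot A B γ z = 0 := by
  rw [gammaQuot, gammaPair_eq_zero_iff.2 ⟨k, hz⟩, div_zero]

theorem inv_gammaQuot (A B γ : ℝ) (z : ℂ) :
    (gammaQuot A B γ z)⁻¹ = gammaQuot B A (-γ) z := by
  rw [gammaQuot, gammaQuot, inv_div, mul_neg, Real.rpow_neg zero_le_two, Complex.ofReal_inv,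
    div_mul_eq_div_div_swap, div_eq_inv_mul _ ((2 ^ (2 * γ) : ℝ) : ℂ), mul_div_assoc]

theorem continuousAt_gammaQuot {A B γ : ℝ} {z : ℂ} (hz : ∀ k, z ^ 2 ≠ -(node A k : ℂ)) :
    ContinuousAt (gammaQuot A B γ) z :=
  (continuousAt_const.mul (continuousAt_gammaPair hz)).mul (continuous_gammaPair_inv B).continuousAt

theorem gammaQuot_zero (A B γ : ℝ) :
    gammaQuot A B γ 0 = ((2 ^ (2 * γ) * Real.Gamma A ^ 2 / Real.Gamma B ^ 2 : ℝ) : ℂ) := by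
  simp only [gammaQuot, gammaPair, zero_div, zero_mul, add_zero, sub_zero, Complex.Gamma_ofReal]
  push_cast
  ring

theorem gammaSeq_mul_gammaSeq (c : ℝ) (z : ℂ) {n : ℕ} (hn : n ≠ 0) :
    Complex.GammaSeq (c + z / 2 * Complex.I) n * Complex.GammaSeq (c - z / 2 * Complex.I) n =
      ((n ^ (2 * c) : ℝ) : ℂ) * (n.factorial ^ 2 * 4 ^ (n + 1)) /
        ∏ k ∈ Finset.range (n + 1), ((node c k : ℂ) + z ^ 2) := by
  have hpow : (n : ℂ) ^ (c + z / 2 * Complex.I) * (n : ℂ) ^ (c - z / 2 * Complex.I) =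
      ((n ^ (2 * c) : ℝ) : ℂ) := by
    rw [← Complex.cpow_add _ _ (Nat.cast_ne_zero.2 hn), Complex.ofReal_cpow (Nat.cast_nonneg n)]
    push_cast
    ring_nf
  simp only [node_add_sq, Finset.prod_mul_distrib, Finset.prod_const, Finset.card_range]
  rw [Complex.GammaSeq, Complex.GammaSeq, div_mul_div_comm, ← hpow, mul_comm (4 ^ (n + 1)),
    ← mul_assoc _ _ (4 ^ (n + 1)), mul_div_mul_right _ _ (pow_ne_zero _ (by norm_num))]
  ring

theorem gammaSeq_quot_eq_truncProd (B γ : ℝ) (z : ℂ) {n : ℕ} (hn : n ≠ 0) :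
    ((2 ^ (2 * γ) : ℝ) : ℂ) *
        (Complex.GammaSeq ((B + γ : ℝ) + z / 2 * Complex.I) n *
          Complex.GammaSeq ((B + γ : ℝ) - z / 2 * Complex.I) n) /
        (Complex.GammaSeq (B + z / 2 * Complex.I) n *
          Complex.GammaSeq (B - z / 2 * Complex.I) n) =
      truncProd (fun n => (2 * n) ^ (2 * γ)) (node B) (node (B + γ)) n (z ^ 2) := by
  have hn' : (0 : ℝ) < n := Nat.cast_pos.2 (Nat.pos_of_ne_zero hn)
  have hpow : ((n ^ (2 * B) : ℝ) : ℂ) ≠ 0 :=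
    Complex.ofReal_ne_zero.2 (Real.rpow_pos_of_pos hn' _).ne'
  have hfac : (n.factorial ^ 2 * 4 ^ (n + 1) : ℂ) ≠ 0 :=
    mul_ne_zero (pow_ne_zero _ (Nat.cast_ne_zero.2 n.factorial_ne_zero))
      (pow_ne_zero _ (by norm_num))
  rw [gammaSeq_mul_gammaSeq _ z hn, gammaSeq_mul_gammaSeq _ z hn, truncProd,
    Finset.prod_div_distrib, Real.mul_rpow zero_le_two hn'.le, mul_add 2 B, Real.rpow_add hn',
    mul_div_assoc', div_div_div_eq, Complex.ofReal_mul, Complex.ofReal_mul, mul_div_assoc']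
  rw [mul_comm (∏ k ∈ Finset.range (n + 1), ((node (B + γ) k : ℂ) + z ^ 2)),
    ← mul_div_mul_left _ (∏ k ∈ Finset.range (n + 1), ((node (B + γ) k : ℂ) + z ^ 2))
      (mul_ne_zero hpow hfac)]
  ring

theorem tendsto_truncProd_node (B γ : ℝ) (z : ℂ) :
    Tendsto (fun n => truncProd (fun n => (2 * n) ^ (2 * γ)) (node B) (node (B + γ)) n (z ^ 2))
      atTop (𝓝 (gammaQuot (B + γ) B γ z)) := by
  by_cases h : gammaPair B z = 0
  · obtain ⟨k, hk⟩ := gammaPair_eq_zero_iff.1 h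
    rw [gammaQuot_eq_zero hk]
    refine tendsto_const_nhds.congr' ?_
    filter_upwards [eventually_ge_atTop k] with n hn
    rw [truncProd, Finset.prod_eq_zero (Finset.mem_range_succ_iff.2 hn), mul_zero]
    rw [hk, add_neg_cancel, zero_div]
  · have hseq (c : ℝ) := (Complex.GammaSeq_tendsto_Gamma (c + z / 2 * Complex.I)).mul
      (Complex.GammaSeq_tendsto_Gamma (c - z / 2 * Complex.I))
    refine (((hseq (B + γ)).const_mul ((2 ^ (2 * γ) : ℝ) : ℂ)).div (hseq B) h).congr' ?_
    filter_upwards [eventually_ne_atTop 0] with n hn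
    exact gammaSeq_quot_eq_truncProd B γ z hn

theorem tendsto_prod_node (B γ : ℝ) {y : ℝ} (hy : 0 ≤ y) :
    Tendsto (fun n : ℕ => (2 * n : ℝ) ^ (2 * γ) *
        ∏ k ∈ Finset.range (n + 1), (node B k + y) / (node (B + γ) k + y))
      atTop (𝓝 (gammaQuot (B + γ) B γ √y).re) := by
  refine ((Complex.continuous_re.tendsto _).comp (tendsto_truncProd_node B γ √y)).congr fun n => ?_
  rw [Function.comp_apply, ← Complex.ofReal_pow, Real.sq_sqrt hy, truncProd_ofReal,
    Complex.ofReal_re]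

theorem gammaQuot_zero_mono {B B' γ : ℝ} (hB : 0 < B) (hγ : 0 ≤ γ) (h : B ≤ B') :
    (gammaQuot (B + γ) B γ 0).re ≤ (gammaQuot (B' + γ) B' γ 0).re := by
  have hlim (B : ℝ) := tendsto_prod_node B γ le_rfl
  simp only [Real.sqrt_zero, Complex.ofReal_zero, add_zero] at hlim
  refine le_of_tendsto_of_tendsto' (hlim B) (hlim B') fun n => ?_
  have hB' : 0 < B' := hB.trans_le h
  simp only [node]
  gcongr ?_ * ∏ k ∈ _, ?_ with k
  rw [mul_div_mul_left _ _ four_ne_zero, mul_div_mul_left _ _ four_ne_zero, ← div_pow, ← div_pow]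
  have hle : (B + k) / (B + γ + k) ≤ (B' + k) / (B' + γ + k) := by
    rw [div_le_div_iff₀ (by positivity) (by positivity)]
    nlinarith
  gcongr

/-- The Stieltjes sum `∑ d j / (w + s j)`. -/
def simpleFractions (d s : ℕ → ℝ) (w : ℂ) : ℂ := ∑' j, (d j : ℂ) / (w + s j)

/-- Coefficients `d` and nodes `s` for which the Stieltjes sum `simpleFractions d s` converges. A
node `0` is harmless as long as its coefficient vanishes. -/
structure IsStieltjes (d s : ℕ → ℝ) : Prop where
  nonneg : ∀ j, 0 ≤ s j
  tendsto : Tendsto s atTop atTop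
  coeff_nonneg : ∀ j, 0 ≤ d j
  coeff_eq_zero : ∀ j, s j = 0 → d j = 0
  summable : Summable fun j => d j / s j

theorem exists_uniform_gap {s : ℕ → ℝ} (hlim : Tendsto s atTop atTop) (w₀ : ℂ) :
    ∃ η > (0 : ℝ), ∀ᶠ w : ℂ in 𝓝 w₀, ∀ j, w₀ + s j ≠ 0 → η * (1 + s j) ≤ ‖w + s j‖ := by
  obtain ⟨k, hk⟩ := eventually_atTop.1 (hlim.eventually
    (eventually_ge_atTop (2 * (‖w₀‖ + 1))))
  have hfin : ∀ᶠ q : ℝ × ℂ in 𝓝 0 ×ˢ 𝓝 w₀, ∀ j ∈ Finset.range k,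
      w₀ + s j ≠ 0 → q.1 * (1 + s j) < ‖q.2 + s j‖ := by
    refine (Finset.eventually_all _).2 fun j _ => ?_
    by_cases hj : w₀ + s j = 0
    · exact .of_forall fun _ h => absurd hj h
    rw [← nhds_prod_eq]
    refine (ContinuousAt.eventually_lt (by fun_prop) (by fun_prop) ?_).mono fun _ h _ => h
    rw [zero_mul]
    exact norm_pos_iff.2 hj
  have hη : ∀ᶠ q : ℝ × ℂ in 𝓝 0 ×ˢ 𝓝 w₀, q.1 < 1 / 4 :=
    tendsto_fst.eventually (eventually_lt_nhds (by norm_num))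
  have hw : ∀ᶠ q : ℝ × ℂ in 𝓝 0 ×ˢ 𝓝 w₀, ‖q.2‖ < ‖w₀‖ + 1 :=
    (tendsto_snd.norm).eventually (eventually_lt_nhds (lt_add_one _))
  have hall : ∀ᶠ q : ℝ × ℂ in 𝓝 0 ×ˢ 𝓝 w₀, ∀ j, w₀ + s j ≠ 0 →
      q.1 * (1 + s j) ≤ ‖q.2 + s j‖ := by
    filter_upwards [hfin, hη, hw] with q hq hη hw j hj
    rcases lt_or_ge j k with hjk | hjk
    · exact (hq j (Finset.mem_range.2 hjk) hj).le
    · have hsj := hk j hjk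
      have hw₀ := norm_nonneg w₀
      have hhalf := half_le_norm_add (x := q.2) (a := s j) (by linarith)
      nlinarith
  obtain ⟨η, hη, hη0⟩ :=
    ((hall.curry.filter_mono nhdsWithin_le_nhds).and (self_mem_nhdsWithin (s := Set.Ioi 0))).exists
  exact ⟨η, hη0, hη⟩

theorem eventually_forall_add_ne_zero {s : ℕ → ℝ} (hs : ∀ j, 0 ≤ s j)
    (hlim : Tendsto s atTop atTop) (w₀ : ℂ) : ∀ᶠ w : ℂ in 𝓝[≠] w₀, ∀ j, w + s j ≠ 0 := by
  obtain ⟨η, hη, hgap⟩ := exists_uniform_gap hlim w₀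
  filter_upwards [nhdsWithin_le_nhds hgap, self_mem_nhdsWithin] with w hw hne j hj
  by_cases hj₀ : w₀ + s j = 0
  · exact hne (add_right_cancel (hj.trans hj₀.symm))
  · have hle := hw j hj₀
    rw [hj, norm_zero] at hle
    have hsj := hs j
    exact hle.not_gt (by positivity)

theorem tendsto_sq_nhdsNE (z₀ : ℂ) : Tendsto (fun z : ℂ => z ^ 2) (𝓝[≠] z₀) (𝓝[≠] (z₀ ^ 2)) := by
  refine tendsto_nhdsWithin_of_tendsto_nhds_of_eventually_within _
    ((continuous_pow 2).continuousAt.mono_left nhdsWithin_le_nhds) ?_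
  have hneg : ∀ᶠ z in 𝓝[≠] z₀, z ≠ -z₀ := by
    by_cases h : z₀ = -z₀
    · rw [← h]
      exact self_mem_nhdsWithin
    · exact nhdsWithin_le_nhds (isOpen_ne.mem_nhds h)
  filter_upwards [hneg, self_mem_nhdsWithin] with z hz hz₀ h
  exact (sq_eq_sq_iff_eq_or_eq_neg.1 h).elim hz₀ hz

theorem eventually_forall_sq_ne {s : ℕ → ℝ} (hs : ∀ j, 0 ≤ s j) (hlim : Tendsto s atTop atTop)
    (z₀ : ℂ) : ∀ᶠ z in 𝓝[≠] z₀, ∀ j, z ^ 2 ≠ -(s j : ℂ) := by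
  filter_upwards [(tendsto_sq_nhdsNE z₀).eventually (eventually_forall_add_ne_zero hs hlim _)]
    with z hz j h
  exact hz j (by rw [h, neg_add_cancel])

namespace IsStieltjes

variable {d s : ℕ → ℝ}

theorem norm_div_le (H : IsStieltjes d s) {η : ℝ} (hη : 0 < η) {w : ℂ} {j : ℕ}
    (h : η * (1 + s j) ≤ ‖w + s j‖) : ‖(d j : ℂ) / (w + s j)‖ ≤ η⁻¹ * (d j / s j) := by
  rcases (H.nonneg j).eq_or_lt' with hj | hj
  · rw [H.coeff_eq_zero j hj, Complex.ofReal_zero, zero_div, zero_div, norm_zero, mul_zero]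
  rw [norm_div, Complex.norm_real, Real.norm_of_nonneg (H.coeff_nonneg j), inv_mul_eq_div, div_div,
    mul_comm (s j)]
  exact div_le_div_of_nonneg_left (H.coeff_nonneg j) (by positivity) (by nlinarith)

theorem summable_div (H : IsStieltjes d s) (w : ℂ) : Summable fun j => (d j : ℂ) / (w + s j) := by
  obtain ⟨η, hη, hgap⟩ := exists_uniform_gap H.tendsto w
  refine .of_norm_bounded (H.summable.mul_left η⁻¹) fun j => ?_
  by_cases hj : w + s j = 0
  · rw [hj, div_zero, norm_zero]
    exact mul_nonneg (inv_nonneg.2 hη.le) (div_nonneg (H.coeff_nonneg j) (H.nonneg j))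
  · exact H.norm_div_le hη (hgap.self_of_nhds j hj)

theorem analyticAt (H : IsStieltjes d s) {w : ℂ} (hw : ∀ j, w + s j ≠ 0 ∨ d j = 0) :
    AnalyticAt ℂ (simpleFractions d s) w := by
  obtain ⟨η, hη, hgap⟩ := exists_uniform_gap H.tendsto w
  obtain ⟨U, hU, hUo, hwU⟩ := eventually_nhds_iff.1 hgap
  refine DifferentiableOn.analyticAt (s := U) ?_ (hUo.mem_nhds hwU)
  refine Complex.differentiableOn_tsum_of_summable_norm (u := fun j => η⁻¹ * (d j / s j))
    (H.summable.mul_left η⁻¹) (fun j => ?_) hUo fun j v hv => ?_ <;> rcases hw j with hj | hj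
  · refine .div (by fun_prop) (by fun_prop) fun v hv h₀ => ?_
    have hle := hU v hv j hj
    have hsj := H.nonneg j
    rw [h₀, norm_zero] at hle
    exact hle.not_gt (by positivity)
  · simp only [hj, Complex.ofReal_zero, zero_div, differentiableOn_const]
  · exact H.norm_div_le hη (hU v hv j hj)
  · simp only [hj, Complex.ofReal_zero, zero_div, norm_zero, mul_zero, le_refl]

theorem update (H : IsStieltjes d s) (k : ℕ) : IsStieltjes (Function.update d k 0) s := by
  have hle (j : ℕ) : 0 ≤ Function.update d k 0 j ∧ Function.update d k 0 j ≤ d j := by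
    rcases eq_or_ne j k with rfl | hj
    · simp only [Function.update_self, le_refl, H.coeff_nonneg, and_self]
    · simp only [Function.update_of_ne hj, le_refl, H.coeff_nonneg, and_self]
  exact
    { nonneg := H.nonneg
      tendsto := H.tendsto
      coeff_nonneg := fun j => (hle j).1
      coeff_eq_zero := fun j hj => le_antisymm ((hle j).2.trans_eq (H.coeff_eq_zero j hj)) (hle j).1
      summable := H.summable.of_nonneg_of_le (fun j => div_nonneg (hle j).1 (H.nonneg j))
        fun j => div_le_div_of_nonneg_right (hle j).2 (H.nonneg j) }

theorem simpleFractions_eq_add (H : IsStieltjes d s) (k : ℕ) (w : ℂ) :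
    simpleFractions d s w = d k / (w + s k) + simpleFractions (Function.update d k 0) s w := by
  rw [simpleFractions, (H.summable_div w).tsum_eq_add_tsum_ite k, simpleFractions]
  congr 1
  refine tsum_congr fun j => ?_
  rcases eq_or_ne j k with rfl | hj
  · simp only [if_true, Function.update_self, Complex.ofReal_zero, zero_div]
  · simp only [if_neg hj, Function.update_of_ne hj]

theorem analyticAt_update (H : IsStieltjes d s) {k : ℕ} {w : ℂ} (hw : ∀ j ≠ k, w + s j ≠ 0) :
    AnalyticAt ℂ (simpleFractions (Function.update d k 0) s) w := by
  refine (H.update k).analyticAt fun j => ?_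
  rcases eq_or_ne j k with rfl | hj
  · exact .inr (Function.update_self ..)
  · exact .inl (hw j hj)

theorem tendsto_add_mul (H : IsStieltjes d s) (hs : s.Injective) (k : ℕ) :
    Tendsto (fun w => (w + s k) * simpleFractions d s w) (𝓝[≠] (-(s k : ℂ))) (𝓝 (d k)) := by
  have han : AnalyticAt ℂ (simpleFractions (Function.update d k 0) s) (-(s k : ℂ)) :=
    H.analyticAt_update fun j hj h => hj (hs (by exact_mod_cast neg_add_eq_zero.1 h |>.symm))
  have hlim : Tendsto (fun w : ℂ => d k + (w + s k) * simpleFractions (Function.update d k 0) s w)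
      (𝓝 (-(s k : ℂ))) (𝓝 (d k + (-s k + s k) * _)) :=
    tendsto_const_nhds.add ((tendsto_id.add_const _).mul han.continuousAt)
  rw [neg_add_cancel, zero_mul, add_zero] at hlim
  refine (hlim.mono_left nhdsWithin_le_nhds).congr' ?_
  filter_upwards [self_mem_nhdsWithin] with w hw
  have hne : w + s k ≠ 0 := fun h => hw (eq_neg_of_add_eq_zero_left h)
  rw [H.simpleFractions_eq_add k w, mul_add, mul_div_cancel₀ _ hne]

end IsStieltjes

theorem IsStieltjes.re_simpleFractions_le {d s : ℕ → ℝ} (H : IsStieltjes d s) {x y : ℝ}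
    (hxy : x ≤ y) (hgap : ∀ j, d j = 0 ∨ s j < x ∨ y < s j) :
    (simpleFractions d s (-x)).re ≤ (simpleFractions d s (-y)).re := by
  rw [simpleFractions, simpleFractions, Complex.re_tsum (H.summable_div _),
    Complex.re_tsum (H.summable_div _)]
  refine (Complex.hasSum_re (H.summable_div _).hasSum).summable.tsum_le_tsum (fun j => ?_)
    (Complex.hasSum_re (H.summable_div _).hasSum).summable
  simp only [neg_add_eq_sub, ← Complex.ofReal_sub, ← Complex.ofReal_div, Complex.ofReal_re]
  rcases hgap j with hj | hj | hj
  · simp only [hj, zero_div, le_refl]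
  · rw [← neg_sub x, ← neg_sub y, div_neg, div_neg, neg_le_neg_iff]
    exact div_le_div_of_nonneg_left (H.coeff_nonneg j) (sub_pos.2 hj) (sub_le_sub_right hxy _)
  · exact div_le_div_of_nonneg_left (H.coeff_nonneg j) (sub_pos.2 hj) (sub_le_sub_left hxy _)

theorem tendsto_node (c : ℝ) : Tendsto (node c) atTop atTop :=
  ((tendsto_pow_atTop two_ne_zero).comp
    (tendsto_atTop_add_const_left _ c tendsto_natCast_atTop_atTop)).const_mul_atTop four_pos

theorem eventually_sq_ne_neg_node (c : ℝ) (z₀ : ℂ) :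
    ∀ᶠ z in 𝓝[≠] z₀, ∀ k, z ^ 2 ≠ -(node c k : ℂ) :=
  eventually_forall_sq_ne (fun _ => by unfold node; positivity) (tendsto_node c) z₀

/-- A Stieltjes expansion of `1 / (Θ - κ)`, `Θ = gammaQuot (B + γ) B γ`, in the variable `z ^ 2`,
with one node in each closed gap `[leftEnd p k, b k]`. The coefficients may still vanish. -/
structure IsGapExpansion (B γ κ : ℝ) (a e : ℕ → ℝ) : Prop where
  node_mem : ∀ k, leftEnd (node (B + γ)) k ≤ a k ∧ a k ≤ node B k
  isStieltjes : IsStieltjes e a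
  identity : ∀ z : ℂ, (∀ k, z ^ 2 ≠ -(node (B + γ) k : ℂ)) → (∀ k, z ^ 2 ≠ -(a k : ℂ)) →
    (gammaQuot (B + γ) B γ z - κ) * simpleFractions e a (z ^ 2) = 1

theorem exists_isGapExpansion {B γ κ : ℝ} (hB : 0 < B) (hγ₀ : 0 < γ) (hγ₁ : γ < 1) (hκ : 0 ≤ κ)
    (hκΘ : κ < (gammaQuot (B + γ) B γ 0).re) : ∃ a e, IsGapExpansion B γ κ a e := by
  have H := interlacing_node hB hγ₀ hγ₁
  have hc : Tendsto (fun n : ℕ => (2 * n : ℝ) ^ (2 * γ)) atTop atTop :=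
    (tendsto_rpow_atTop (by positivity)).comp
      (tendsto_natCast_atTop_atTop.const_mul_atTop two_pos)
  obtain ⟨a, e, ha, he, he₀, hsum, hid⟩ := H.exists_stieltjes (summable_node_inv _) hc hκ
    (F := fun y => (gammaQuot (B + γ) B γ √y).re)
    (by simpa only [Real.sqrt_zero, Complex.ofReal_zero] using hκΘ)
    fun y hy => tendsto_prod_node B γ hy
  exact ⟨a, e, ha,
    { nonneg := fun k => (H.leftEnd_nonneg k).trans (ha k).1
      tendsto := tendsto_atTop_mono (fun k => (ha k).1) (H.tendsto_leftEnd (summable_node_inv _))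
      coeff_nonneg := he
      coeff_eq_zero := he₀
      summable := hsum },
    fun z => hid _ _ (tendsto_truncProd_node B γ z)⟩

namespace IsGapExpansion

variable {B γ κ : ℝ} {a e : ℕ → ℝ}

theorem eventually_identity (H : IsGapExpansion B γ κ a e) (z₀ : ℂ) :
    ∀ᶠ z in 𝓝[≠] z₀, (gammaQuot (B + γ) B γ z - κ) * simpleFractions e a (z ^ 2) = 1 := by
  filter_upwards [eventually_sq_ne_neg_node (B + γ) z₀,
    eventually_forall_sq_ne H.isStieltjes.nonneg H.isStieltjes.tendsto z₀] with z hp ha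
  exact H.identity z hp ha

theorem identity_of_regular (H : IsGapExpansion B γ κ a e) {z₀ : ℂ}
    (hp : ∀ k, z₀ ^ 2 ≠ -(node (B + γ) k : ℂ)) (ha : ∀ j, z₀ ^ 2 + a j ≠ 0 ∨ e j = 0) :
    (gammaQuot (B + γ) B γ z₀ - κ) * simpleFractions e a (z₀ ^ 2) = 1 := by
  have hcont : ContinuousAt
      (fun z => (gammaQuot (B + γ) B γ z - κ) * simpleFractions e a (z ^ 2)) z₀ :=
    ((continuousAt_gammaQuot hp).sub continuousAt_const).mul
      (.comp (f := fun z : ℂ => z ^ 2) (H.isStieltjes.analyticAt ha).continuousAt (by fun_prop))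
  exact tendsto_nhds_unique_of_eventuallyEq (hcont.tendsto.mono_left nhdsWithin_le_nhds)
    tendsto_const_nhds (H.eventually_identity z₀)

theorem tendsto_zero (H : IsGapExpansion B γ κ a e) (hI : Interlacing (node B) (node (B + γ)))
    {k : ℕ} {z₀ : ℂ} (hz₀ : z₀ ^ 2 = -(node (B + γ) k : ℂ)) :
    Tendsto (fun z => simpleFractions e a (z ^ 2)) (𝓝[≠] z₀) (𝓝 0) := by
  have hz₀B (j : ℕ) : z₀ ^ 2 ≠ -(node B j : ℂ) := by
    rw [hz₀, Ne, neg_inj, Complex.ofReal_inj]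
    rcases le_or_gt j k with h | h
    · exact ((hI.zero_le_zero h).trans_lt (hI.lt k)).ne'
    · exact (hI.pole_lt_zero h).ne
  have hinv : Tendsto (gammaQuot B (B + γ) (-γ)) (𝓝[≠] z₀) (𝓝 0) := by
    rw [← gammaQuot_eq_zero hz₀ (A := B) (γ := -γ)]
    exact (continuousAt_gammaQuot hz₀B).tendsto.mono_left nhdsWithin_le_nhds
  have hquot := hinv.div (tendsto_const_nhds (x := (1 : ℂ)).sub (hinv.const_mul (κ : ℂ)))
    (by rw [mul_zero, sub_zero]; exact one_ne_zero)
  rw [zero_div] at hquot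
  refine hquot.congr' ?_
  filter_upwards [H.eventually_identity z₀, eventually_sq_ne_neg_node B z₀,
    eventually_sq_ne_neg_node (B + γ) z₀] with z hid hzB hzA
  have hΘ : gammaQuot (B + γ) B γ z ≠ 0 := by
    refine div_ne_zero (mul_ne_zero ?_ (mt gammaPair_eq_zero_iff.1 (not_exists.2 hzA)))
      (mt gammaPair_eq_zero_iff.1 (not_exists.2 hzB))
    exact Complex.ofReal_ne_zero.2 (by positivity)
  have hne := left_ne_zero_of_mul_eq_one hid
  rw [eq_inv_of_mul_eq_one_right hid, Pi.div_apply, ← inv_gammaQuot]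
  field_simp

theorem re_leftEnd_nonneg (H : IsGapExpansion B γ κ a e)
    (hI : Interlacing (node B) (node (B + γ))) (hκΘ : κ < (gammaQuot (B + γ) B γ 0).re) {k : ℕ}
    (hregular : ∀ j, (-(leftEnd (node (B + γ)) k : ℝ) : ℂ) + a j ≠ 0 ∨ e j = 0) :
    0 ≤ (simpleFractions e a (-(leftEnd (node (B + γ)) k : ℝ))).re := by
  rcases k with - | k
  · simp only [leftEnd, Complex.ofReal_zero, neg_zero] at hregular ⊢
    have hid := H.identity_of_regular (z₀ := 0) (fun j h => ?_)
      (by simpa only [zero_pow two_ne_zero] using hregular)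
    · rw [zero_pow two_ne_zero, gammaQuot_zero, ← Complex.ofReal_sub] at hid
      have hre := congrArg Complex.re hid
      rw [Complex.re_ofReal_mul, Complex.one_re] at hre
      rw [gammaQuot_zero, Complex.ofReal_re] at hκΘ
      exact (pos_of_mul_pos_right (hre ▸ one_pos) (sub_pos.2 hκΘ).le).le
    · rw [zero_pow two_ne_zero, eq_comm, neg_eq_zero, Complex.ofReal_eq_zero] at h
      exact (hI.pole_pos j).ne' h
  · obtain ⟨z₀, hz₀⟩ := IsAlgClosed.exists_pow_nat_eq (-(node (B + γ) k : ℂ)) two_pos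
    have hcont : ContinuousAt (fun z => simpleFractions e a (z ^ 2)) z₀ :=
      .comp (f := fun z : ℂ => z ^ 2)
        (H.isStieltjes.analyticAt (hz₀ ▸ hregular)).continuousAt (by fun_prop)
    have hzero := tendsto_nhds_unique (hcont.tendsto.mono_left nhdsWithin_le_nhds)
      (H.tendsto_zero hI hz₀)
    rw [hz₀] at hzero
    simp only [leftEnd, hzero, Complex.zero_re, le_refl]

/-- With a vanishing coefficient the resolvent, increasing across the gap, could not pass from
values `≥ 0` at the left end to the value `-1 / κ` at the zero `b k` of `Θ`. -/
theorem coeff_pos (H : IsGapExpansion B γ κ a e) (hI : Interlacing (node B) (node (B + γ)))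
    (hκ : 0 ≤ κ) (hκΘ : κ < (gammaQuot (B + γ) B γ 0).re) (k : ℕ) : 0 < e k := by
  refine (H.isStieltjes.coeff_nonneg k).lt_of_ne' fun hk => ?_
  have hgap (j : ℕ) : e j = 0 ∨ a j < leftEnd (node (B + γ)) k ∨ node B k < a j := by
    rcases lt_trichotomy j k with hj | rfl | hj
    · exact .inr (.inl (((H.node_mem j).2.trans_lt (hI.lt j)).trans_le (hI.le_leftEnd hj)))
    · exact .inl hk
    · exact .inr (.inr ((hI.lt k).trans_le ((hI.le_leftEnd hj).trans (H.node_mem j).1)))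
  have hregular {x : ℝ} (hl : leftEnd (node (B + γ)) k ≤ x) (hr : x ≤ node B k) (j : ℕ) :
      (-x : ℂ) + a j ≠ 0 ∨ e j = 0 := by
    rw [neg_add_eq_sub, ← Complex.ofReal_sub, Complex.ofReal_ne_zero, sub_ne_zero, or_comm]
    exact (hgap j).imp_right
      (·.elim (fun h => (h.trans_le hl).ne) (fun h => (hr.trans_lt h).ne'))
  have hlb := (hI.leftEnd_lt k).le
  have hright : -κ * (simpleFractions e a (-(node B k : ℝ))).re = 1 := by
    obtain ⟨z, hz⟩ := IsAlgClosed.exists_pow_nat_eq (-(node B k : ℂ)) two_pos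
    have hid := H.identity_of_regular (z₀ := z) (fun j => ?_) (hz ▸ hregular hlb le_rfl)
    · rw [gammaQuot_eq_zero hz, hz, zero_sub, ← Complex.ofReal_neg κ] at hid
      rw [← Complex.re_ofReal_mul, hid, Complex.one_re]
    · rw [hz, Ne, neg_inj, Complex.ofReal_inj]
      rcases lt_or_ge j k with h | h
      · exact (hI.pole_lt_zero h).ne'
      · exact ((hI.zero_le_zero h).trans_lt (hI.lt j)).ne
  have hleft : 0 ≤ (simpleFractions e a (-(leftEnd (node (B + γ)) k : ℝ))).re :=
    H.re_leftEnd_nonneg hI hκΘ (hregular le_rfl hlb)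
  nlinarith [H.isStieltjes.re_simpleFractions_le hlb hgap]

theorem leftEnd_lt (H : IsGapExpansion B γ κ a e) (hI : Interlacing (node B) (node (B + γ)))
    {k : ℕ} (he : ∀ k, 0 < e k) : leftEnd (node (B + γ)) k < a k := by
  refine (H.node_mem k).1.lt_of_ne' fun hk => ?_
  have hmono : StrictMono a := strictMono_nat_of_lt_succ fun k =>
    ((H.node_mem k).2.trans_lt (hI.lt k)).trans_le (H.node_mem (k + 1)).1
  rcases k with - | k
  · exact (he 0).ne' (H.isStieltjes.coeff_eq_zero 0 hk)
  obtain ⟨z₀, hz₀⟩ := IsAlgClosed.exists_pow_nat_eq (-(a (k + 1) : ℂ)) two_pos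
  have hlim := (H.isStieltjes.tendsto_add_mul hmono.injective (k + 1)).comp
    (hz₀ ▸ tendsto_sq_nhdsNE z₀)
  have hsq : Tendsto (fun z : ℂ => z ^ 2 + a (k + 1)) (𝓝[≠] z₀) (𝓝 (z₀ ^ 2 + a (k + 1))) :=
    (Continuous.tendsto (by fun_prop) z₀).mono_left nhdsWithin_le_nhds
  have hzero := hsq.mul (H.tendsto_zero hI (k := k) (by rw [hz₀, hk]; rfl))
  rw [mul_zero] at hzero
  exact (he (k + 1)).ne' (Complex.ofReal_eq_zero.1 (tendsto_nhds_unique hlim hzero))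

end IsGapExpansion

/-- `1 / (Θ - κ)` as the sum of `2 d j σ j / (z ^ 2 + σ j ^ 2)`: the Fourier transform of the
kernel `∑ d j exp (-σ j |t|)`. -/
def resolventSum (σ d : ℕ → ℝ) (z : ℂ) : ℂ :=
  simpleFractions (fun j => 2 * d j * σ j) (fun j => σ j ^ 2) (z ^ 2)

/-- `resolventSum σ d` represents `1 / (Θ - κ)`, where `Θ` may have poles at the points with
`z ^ 2 = -node A k`. -/
structure IsExpansion (A : ℝ) (Θ : ℂ → ℂ) (κ : ℝ) (σ d : ℕ → ℝ) : Prop where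
  base_pos : 0 < A
  pos_zero : 0 < σ 0
  strictMono : StrictMono σ
  tendsto : Tendsto σ atTop atTop
  coeff_pos : ∀ j, 0 < d j
  summable : Summable fun j => d j / σ j
  identity : ∀ z : ℂ, (∀ k, z ^ 2 ≠ -(node A k : ℂ)) → (∀ j, z ^ 2 ≠ -((σ j ^ 2 : ℝ) : ℂ)) →
    (Θ z - κ) * resolventSum σ d z = 1

theorem exists_isExpansion {B γ κ : ℝ} (hB : 0 < B) (hγ₀ : 0 < γ) (hγ₁ : γ < 1) (hκ : 0 ≤ κ)
    (hκΘ : κ < (gammaQuot (B + γ) B γ 0).re) :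
    ∃ σ d, IsExpansion (B + γ) (gammaQuot (B + γ) B γ) κ σ d := by
  have hI := interlacing_node hB hγ₀ hγ₁
  obtain ⟨a, e, H⟩ := exists_isGapExpansion hB hγ₀ hγ₁ hκ hκΘ
  have he := H.coeff_pos hI hκ hκΘ
  have hl (k : ℕ) : leftEnd (node (B + γ)) k < a k := H.leftEnd_lt hI he
  have ha (k : ℕ) : 0 < √(a k) := Real.sqrt_pos.2 ((hI.leftEnd_nonneg k).trans_lt (hl k))
  have hsq (k : ℕ) : √(a k) ^ 2 = a k := Real.sq_sqrt (H.isStieltjes.nonneg k)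
  have hcoeff (k : ℕ) : 2 * (e k / (2 * √(a k))) * √(a k) = e k := by
    have := (ha k).ne'
    field_simp
  refine ⟨fun k => √(a k), fun k => e k / (2 * √(a k)),
    { base_pos := add_pos hB hγ₀
      pos_zero := ha 0
      strictMono := fun i j hij => Real.sqrt_lt_sqrt (H.isStieltjes.nonneg i)
        (hI.strictMono_of_mem_gap hl (fun k => (H.node_mem k).2) hij)
      tendsto := Real.tendsto_sqrt_atTop.comp H.isStieltjes.tendsto
      coeff_pos := fun k => div_pos (he k) (mul_pos two_pos (ha k))
      summable := (H.isStieltjes.summable.div_const 2).congr fun k => ?_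
      identity := fun z hp hσ => ?_ }⟩
  · rw [div_div, div_div, mul_assoc, Real.mul_self_sqrt (H.isStieltjes.nonneg k), mul_comm]
  · simp only [resolventSum, hcoeff, hsq] at hσ ⊢
    exact H.identity z hp hσ

theorem HasResidue.of_eventuallyEq {f G : ℂ → ℂ} {z₀ : ℂ} (hG : AnalyticAt ℂ G z₀)
    (h : ∀ᶠ z in 𝓝[≠] z₀, f z = (z - z₀)⁻¹ * G z) : HasResidue f z₀ (G z₀) := by
  obtain ⟨ε, hε, hball⟩ := Metric.eventually_nhds_iff_ball.1
    (hG.eventually_analyticAt.and (eventually_nhdsWithin_iff.1 h))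
  filter_upwards [Ioo_mem_nhdsGT hε] with r hr
  have hsub : Metric.closedBall z₀ r ⊆ Metric.ball z₀ ε := Metric.closedBall_subset_ball hr.2
  rw [circleIntegral.integral_congr (g := fun z => (z - z₀)⁻¹ • G z) hr.1.le]
  · rw [DiffContOnCl.circleIntegral_sub_inv_smul _ (Metric.mem_ball_self hr.1), smul_eq_mul]
    refine DifferentiableOn.diffContOnCl fun z hz => ?_
    rw [closure_ball _ hr.1.ne'] at hz
    exact (hball z (hsub hz)).1.differentiableAt.differentiableWithinAt
  · intro z hz
    exact (hball z (hsub (Metric.sphere_subset_closedBall hz))).2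
      (Metric.ne_of_mem_sphere hz hr.1.ne')

theorem meromorphicOrderAt_eq_neg_one {f G : ℂ → ℂ} {z₀ : ℂ} (hG : AnalyticAt ℂ G z₀)
    (hG₀ : G z₀ ≠ 0) (h : ∀ᶠ z in 𝓝[≠] z₀, f z = (z - z₀)⁻¹ * G z) :
    MeromorphicAt f z₀ ∧ meromorphicOrderAt f z₀ = -1 := by
  have hmer : MeromorphicAt f z₀ := MeromorphicAt.congr
    (((MeromorphicAt.id z₀).sub (.const z₀ z₀)).inv.mul hG.meromorphicAt) (h.mono fun _ => .symm)
  refine ⟨hmer, (meromorphicOrderAt_eq_int_iff (n := -1) hmer).2 ⟨G, hG, hG₀, ?_⟩⟩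
  simpa only [zpow_neg_one, smul_eq_mul] using h

theorem sq_eq_neg_sq_iff {z : ℂ} {x : ℝ} :
    z ^ 2 = -((x ^ 2 : ℝ) : ℂ) ↔ z = x * Complex.I ∨ z = -(x * Complex.I) := by
  rw [← sq_eq_sq_iff_eq_or_eq_neg, mul_pow, Complex.I_sq, mul_neg_one, Complex.ofReal_pow]

namespace IsExpansion

variable {A κ : ℝ} {Θ : ℂ → ℂ} {σ d : ℕ → ℝ}

theorem pos (H : IsExpansion A Θ κ σ d) (j : ℕ) : 0 < σ j :=
  H.pos_zero.trans_le (H.strictMono.monotone j.zero_le)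

theorem isStieltjes (H : IsExpansion A Θ κ σ d) :
    IsStieltjes (fun j => 2 * d j * σ j) (fun j => σ j ^ 2) where
  nonneg j := sq_nonneg _
  tendsto := (tendsto_pow_atTop two_ne_zero).comp H.tendsto
  coeff_nonneg j := (mul_pos (mul_pos two_pos (H.coeff_pos j)) (H.pos j)).le
  coeff_eq_zero j hj := absurd hj (pow_pos (H.pos j) 2).ne'
  summable := (H.summable.mul_left 2).congr fun j => by
    rw [sq, mul_div_mul_right _ _ (H.pos j).ne', mul_div_assoc]

theorem eventually_eq (H : IsExpansion A Θ κ σ d) (z₀ : ℂ) :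
    ∀ᶠ z in 𝓝[≠] z₀, 1 / (Θ z - κ) = resolventSum σ d z := by
  filter_upwards [eventually_sq_ne_neg_node A z₀,
    eventually_forall_sq_ne H.isStieltjes.nonneg H.isStieltjes.tendsto z₀] with z hA hσ
  rw [one_div, eq_inv_of_mul_eq_one_right (H.identity z hA hσ)]

theorem analyticAt_resolventSum (H : IsExpansion A Θ κ σ d) {z : ℂ}
    (hz : ∀ j, z ^ 2 ≠ -((σ j ^ 2 : ℝ) : ℂ)) : AnalyticAt ℂ (resolventSum σ d) z :=
  AnalyticAt.comp (f := fun z : ℂ => z ^ 2)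
    (H.isStieltjes.analyticAt fun j => .inl fun h => hz j (eq_neg_of_add_eq_zero_left h))
    (by fun_prop)

theorem ne_zero_of_sq_eq (H : IsExpansion A Θ κ σ d) {z : ℂ} {k : ℕ}
    (hz : z ^ 2 = -((σ k ^ 2 : ℝ) : ℂ)) : z ≠ 0 := by
  rintro rfl
  rw [zero_pow two_ne_zero, eq_comm, neg_eq_zero, Complex.ofReal_eq_zero] at hz
  exact (pow_pos (H.pos k) 2).ne' hz

theorem exists_polar_part (H : IsExpansion A Θ κ σ d) {z₀ : ℂ} {k : ℕ}
    (hz₀ : z₀ ^ 2 = -((σ k ^ 2 : ℝ) : ℂ)) :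
    ∃ G : ℂ → ℂ, AnalyticAt ℂ G z₀ ∧ G z₀ = d k * σ k / z₀ ∧
      ∀ᶠ z in 𝓝[≠] z₀, 1 / (Θ z - κ) = (z - z₀)⁻¹ * G z := by
  have hne := H.ne_zero_of_sq_eq hz₀
  let g : ℂ → ℂ := simpleFractions (Function.update (fun j => 2 * d j * σ j) k 0) fun j => σ j ^ 2
  have hg : AnalyticAt ℂ (fun z => g (z ^ 2)) z₀ := by
    refine .comp (f := fun z : ℂ => z ^ 2)
      (H.isStieltjes.analyticAt_update fun j hj h => hj ?_) (by fun_prop)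
    rw [hz₀, neg_add_eq_zero, Complex.ofReal_inj, sq_eq_sq₀ (H.pos k).le (H.pos j).le] at h
    exact H.strictMono.injective h.symm
  refine ⟨fun z => 2 * d k * σ k / (z + z₀) + (z - z₀) * g (z ^ 2), ?_, ?_, ?_⟩
  · refine (analyticAt_const.div (by fun_prop) ?_).add (.mul (by fun_prop) hg)
    rw [← two_mul]
    exact mul_ne_zero two_ne_zero hne
  · simp only [sub_self, zero_mul, add_zero, ← two_mul, mul_assoc,
      mul_div_mul_left _ _ (two_ne_zero' ℂ)]
  · filter_upwards [H.eventually_eq z₀, self_mem_nhdsWithin] with z hz hzne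
    have hsub := sub_ne_zero.2 hzne
    have hfac : z ^ 2 + ((σ k ^ 2 : ℝ) : ℂ) = (z - z₀) * (z + z₀) := by
      linear_combination hz₀
    rw [hz, resolventSum, H.isStieltjes.simpleFractions_eq_add k, hfac, mul_add (z - z₀)⁻¹,
      inv_mul_cancel_left₀ hsub, div_mul_eq_div_div_swap, inv_mul_eq_div]
    push_cast
    rfl

theorem orderAt_neg (H : IsExpansion A Θ κ σ d) {z₀ : ℂ} {k : ℕ}
    (hz₀ : z₀ ^ 2 = -((σ k ^ 2 : ℝ) : ℂ)) : MeromorphicAt (fun z => 1 / (Θ z - κ)) z₀ ∧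
      meromorphicOrderAt (fun z => 1 / (Θ z - κ)) z₀ < 0 := by
  obtain ⟨G, hG, hG₀, hev⟩ := H.exists_polar_part hz₀
  have hG₀_ne : G z₀ ≠ 0 := hG₀ ▸ div_ne_zero
    (mul_ne_zero (Complex.ofReal_ne_zero.2 (H.coeff_pos k).ne')
      (Complex.ofReal_ne_zero.2 (H.pos k).ne')) (H.ne_zero_of_sq_eq hz₀)
  obtain ⟨hmer, hord⟩ := meromorphicOrderAt_eq_neg_one hG hG₀_ne hev
  exact ⟨hmer, hord.trans_lt (by decide)⟩

theorem orderAt_nonneg (H : IsExpansion A Θ κ σ d) {z : ℂ}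
    (hz : ∀ j, z ^ 2 ≠ -((σ j ^ 2 : ℝ) : ℂ)) : MeromorphicAt (fun z => 1 / (Θ z - κ)) z ∧
      0 ≤ meromorphicOrderAt (fun z => 1 / (Θ z - κ)) z := by
  have han := H.analyticAt_resolventSum hz
  refine ⟨han.meromorphicAt.congr ((H.eventually_eq z).mono fun _ => .symm), ?_⟩
  rw [meromorphicOrderAt_congr (H.eventually_eq z)]
  exact han.meromorphicOrderAt_nonneg

theorem meromorphic (H : IsExpansion A Θ κ σ d) : Meromorphic fun z => 1 / (Θ z - κ) := fun z => by
  by_cases! hz : ∀ j, z ^ 2 ≠ -((σ j ^ 2 : ℝ) : ℂ)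
  · exact (H.orderAt_nonneg hz).1
  · exact (H.orderAt_neg hz.choose_spec).1

theorem orderAt_neg_iff (H : IsExpansion A Θ κ σ d) (z : ℂ) :
    meromorphicOrderAt (fun z => 1 / (Θ z - κ)) z < 0 ↔
      ∃ j, z = σ j * Complex.I ∨ z = -(σ j * Complex.I) := by
  simp only [← sq_eq_neg_sq_iff]
  refine ⟨fun h => ?_, fun ⟨j, hj⟩ => (H.orderAt_neg hj).2⟩
  by_contra! hz
  exact h.not_ge (H.orderAt_nonneg hz).2

theorem hasResidue (H : IsExpansion A Θ κ σ d) (k : ℕ) :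
    HasResidue (fun z => 1 / (Θ z - κ)) (σ k * Complex.I) (d k / Complex.I) := by
  obtain ⟨G, hG, hG₀, hev⟩ := H.exists_polar_part (sq_eq_neg_sq_iff.2 (.inl rfl))
  rw [mul_comm (d k : ℂ), mul_div_mul_left _ _ (Complex.ofReal_ne_zero.2 (H.pos k).ne')] at hG₀
  exact hG₀ ▸ .of_eventuallyEq hG hev

end IsExpansion

theorem integrable_tsum_of_summable_integral_norm {α E ι : Type*} [MeasurableSpace α]
    {μ : Measure α} [NormedAddCommGroup E] [CompleteSpace E] [Countable ι] {F : ι → α → E}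
    (hF : ∀ i, Integrable (F i) μ) (hsum : Summable fun i => ∫ a, ‖F i a‖ ∂μ) :
    Integrable (fun a => ∑' i, F i a) μ := by
  have hL : ∑' i, ‖(hF i).toL1 (F i)‖ₑ ≠ ⊤ := tsum_enorm_ne_top_iff_summable_norm.2
    (hsum.congr fun i => (L1.norm_of_fun_eq_integral_norm (hF i)).symm)
  refine (L1.integrable_coeFn (∑' i, (hF i).toL1 (F i))).congr ?_
  filter_upwards [Lp.hasSum_coeFn_tsum hL, ae_all_iff.2 fun i => (hF i).coeFn_toL1] with a ha hi
  simpa only [hi] using ha.tsum_eq.symm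

theorem integrable_and_integral_eq_of_halfLines {F : ℝ → ℂ} (hpos : IntegrableOn F (Set.Ioi 0))
    (hneg : IntegrableOn (fun t => F (-t)) (Set.Ioi 0)) :
    Integrable F ∧ ∫ t, F t = (∫ t in Set.Ioi 0, F t) + ∫ t in Set.Ioi 0, F (-t) := by
  have hIic : IntegrableOn F (Set.Iic 0) := by
    rw [integrableOn_Iic_iff_integrableOn_Iio]
    rw [← neg_zero] at hneg
    simpa only [neg_neg] using hneg.comp_neg_Iio
  have h : Integrable F := by
    simpa only [Set.Iic_union_Ioi, integrableOn_univ] using hIic.union hpos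
  refine ⟨h, ?_⟩
  rw [integral_comp_neg_Ioi, neg_zero, add_comm, intervalIntegral.integral_Iic_add_Ioi hIic hpos]

/-- The Dirichlet series `∑ d j e^{-s j t}`. -/
def expSum (d s : ℕ → ℝ) (t : ℝ) : ℝ := ∑' j, d j * Real.exp (-(s j * t))

section expSum

variable {d s : ℕ → ℝ}

theorem exp_term_le (hd : ∀ j, 0 ≤ d j) (hs : ∀ j, 0 < s j) {t : ℝ} (ht : 0 < t) (j : ℕ) :
    d j * Real.exp (-(s j * t)) ≤ d j / s j * t⁻¹ := by
  have hst : 0 < s j * t := mul_pos (hs j) ht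
  calc d j * Real.exp (-(s j * t)) ≤ d j * (s j * t)⁻¹ := by
        rw [Real.exp_neg]
        exact mul_le_mul_of_nonneg_left
          (inv_anti₀ hst (by linarith [Real.add_one_le_exp (s j * t)])) (hd j)
    _ = d j / s j * t⁻¹ := by rw [mul_inv, div_eq_mul_inv, mul_assoc]

theorem summable_exp_terms (hd : ∀ j, 0 ≤ d j) (hs : ∀ j, 0 < s j)
    (hsum : Summable fun j => d j / s j) {t : ℝ} (ht : 0 < t) :
    Summable fun j => d j * Real.exp (-(s j * t)) :=
  .of_nonneg_of_le (fun j => mul_nonneg (hd j) (Real.exp_pos _).le)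
    (exp_term_le hd hs ht) (hsum.mul_right _)

theorem expSum_nonneg (hd : ∀ j, 0 ≤ d j) (t : ℝ) : 0 ≤ expSum d s t :=
  tsum_nonneg fun j => mul_nonneg (hd j) (Real.exp_pos _).le

theorem exp_mul_expSum_le (hd : ∀ j, 0 ≤ d j) (hs : ∀ j, 0 < s j)
    (hsum : Summable fun j => d j / s j) {c t : ℝ} (hc : ∀ j, c ≤ s j) (ht : 1 ≤ t) :
    Real.exp (c * t) * expSum d s t ≤ Real.exp c * expSum d s 1 := by
  rw [expSum, expSum, ← tsum_mul_left, ← tsum_mul_left]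
  refine Summable.tsum_le_tsum (fun j => ?_)
    ((summable_exp_terms hd hs hsum (zero_lt_one.trans_le ht)).mul_left _)
    ((summable_exp_terms hd hs hsum one_pos).mul_left _)
  rw [mul_left_comm, mul_left_comm (Real.exp c), ← Real.exp_add, ← Real.exp_add]
  refine mul_le_mul_of_nonneg_left (Real.exp_le_exp.2 ?_) (hd j)
  linarith [mul_nonneg (sub_nonneg.2 (hc j)) (sub_nonneg.2 ht)]

theorem contDiffOn_expSum (hd : ∀ j, 0 ≤ d j) (hs : ∀ j, 0 < s j)
    (hsum : Summable fun j => d j / s j) {n : WithTop ℕ∞} :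
    ContDiffOn ℝ n (expSum d s) (Set.Ioi 0) := by
  let f : ℂ → ℂ := fun z => ∑' j, (d j : ℂ) * Complex.exp (-(s j * z))
  have hf : ∀ z : ℂ, 0 < z.re → AnalyticAt ℂ f z := fun z hz => by
    have hU : IsOpen {w : ℂ | z.re / 2 < w.re} := isOpen_lt continuous_const Complex.continuous_re
    have hdiff : DifferentiableOn ℂ f {w : ℂ | z.re / 2 < w.re} := by
      refine Complex.differentiableOn_tsum_of_summable_norm
        (summable_exp_terms hd hs hsum (half_pos hz)) (fun j => by fun_prop) hU fun j w hw => ?_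
      rw [norm_mul, Complex.norm_of_nonneg (hd j), Complex.norm_exp, Complex.neg_re,
        Complex.re_ofReal_mul]
      exact mul_le_mul_of_nonneg_left
        (Real.exp_le_exp.2 (neg_le_neg (mul_le_mul_of_nonneg_left (le_of_lt hw) (hs j).le))) (hd j)
    exact hdiff.analyticAt (hU.mem_nhds (half_lt_self hz))
  have hfre : expSum d s = fun t : ℝ => (f t).re := by
    funext t
    rw [← Complex.ofReal_re (expSum d s t), expSum, Complex.ofReal_tsum]
    push_cast
    rfl
  intro t ht
  have hft : ContDiffAt ℝ n f (t : ℂ) := (hf t ht).contDiffAt.restrict_scalars ℝ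
  rw [hfre]
  exact (Complex.reCLM.contDiff.contDiffAt.comp t
    (hft.comp t Complex.ofRealCLM.contDiff.contDiffAt)).contDiffWithinAt

theorem laplace_expSum (hd : ∀ j, 0 ≤ d j) {w : ℂ} (hs : ∀ j, 0 < s j + w.re)
    (hsum : Summable fun j => d j / (s j + w.re)) :
    IntegrableOn (fun t : ℝ => Complex.exp (-(w * t)) * expSum d s t) (Set.Ioi 0) ∧
      ∫ t in Set.Ioi (0 : ℝ), Complex.exp (-(w * t)) * expSum d s t = simpleFractions d s w := by
  let F : ℕ → ℝ → ℂ := fun j t => d j * Complex.exp (-(w + s j) * t)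
  have hre : ∀ j, (-(w + s j)).re = -(s j + w.re) := fun j => by
    rw [Complex.neg_re, Complex.add_re, Complex.ofReal_re, add_comm]
  have hneg : ∀ j, (-(w + s j)).re < 0 := fun j => by rw [hre]; exact neg_lt_zero.2 (hs j)
  have hF : ∀ j, IntegrableOn (F j) (Set.Ioi 0) := fun j =>
    (integrableOn_exp_mul_complex_Ioi (hneg j) 0).const_mul _
  have hnorm : Summable fun j => ∫ t in Set.Ioi (0 : ℝ), ‖F j t‖ := by
    refine hsum.congr fun j => ?_
    have : ∀ t, ‖F j t‖ = d j * Real.exp (-(s j + w.re) * t) := fun t => by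
      rw [norm_mul, Complex.norm_of_nonneg (hd j), Complex.norm_exp, Complex.re_mul_ofReal, hre]
    simp_rw [this]
    rw [integral_const_mul, integral_exp_mul_Ioi (neg_lt_zero.2 (hs j)), mul_zero, Real.exp_zero,
      neg_div_neg_eq, mul_one_div]
  have htsum : (fun t : ℝ => Complex.exp (-(w * t)) * expSum d s t) = fun t => ∑' j, F j t := by
    funext t
    rw [expSum, Complex.ofReal_tsum, ← tsum_mul_left]
    refine tsum_congr fun j => ?_
    push_cast
    rw [mul_left_comm, ← Complex.exp_add, ← neg_add, ← add_mul, ← neg_mul]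
  rw [htsum]
  refine ⟨integrable_tsum_of_summable_integral_norm hF hnorm, ?_⟩
  rw [← integral_tsum_of_summable_integral_norm hF hnorm]
  refine tsum_congr fun j => ?_
  rw [integral_const_mul, integral_exp_mul_complex_Ioi (hneg j), Complex.ofReal_zero, mul_zero,
    Complex.exp_zero, neg_div_neg_eq, mul_one_div]

end expSum

/-- The kernel with a pole at each `i σ_j`, `j ≥ n`, of the upper half-plane and at each `-i σ_j`
of the lower one; it decays at both ends. -/
def decayKernel (d σ : ℕ → ℝ) (n : ℕ) (u : ℝ) : ℝ :=
  if 0 < u then expSum (fun j => d (n + j)) (fun j => σ (n + j)) u else expSum d σ (-u)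

/-- The kernel whose Fourier transform on the horizontal lines of the strip between `i σ_{n-1}`
and `i σ_n` is the inverted symbol; crossing the first `n` poles changes `decayKernel` for
`u ≤ 0`. -/
def stripKernel (d σ : ℕ → ℝ) (n : ℕ) (u : ℝ) : ℝ :=
  decayKernel d σ n u -
    (Set.Iic 0).indicator (fun u => ∑ j ∈ Finset.range n, d j * Real.exp (-(σ j * u))) u

/-- The line `ℝ + iϑ` lies in the open strip between `i σ_{n-1}` (or `-i σ_0`, for `n = 0`) and
`i σ_n`, for an increasing sequence `σ`. -/
structure InStrip (σ : ℕ → ℝ) (n : ℕ) (ϑ : ℝ) : Prop where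
  neg_lt : -σ 0 < ϑ
  lower_lt : ∀ j < n, σ j < ϑ
  lt_upper : ϑ < σ n

section kernels

variable {d σ : ℕ → ℝ} {n : ℕ} {u : ℝ}

theorem decayKernel_of_pos (hu : 0 < u) :
    decayKernel d σ n u = expSum (fun j => d (n + j)) (fun j => σ (n + j)) u := if_pos hu

theorem decayKernel_of_nonpos (hu : u ≤ 0) : decayKernel d σ n u = expSum d σ (-u) :=
  if_neg hu.not_gt

theorem stripKernel_of_pos (hu : 0 < u) : stripKernel d σ n u = decayKernel d σ n u := by
  rw [stripKernel, Set.indicator_of_notMem (Set.notMem_Iic.2 hu), sub_zero]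

theorem stripKernel_of_nonpos (hu : u ≤ 0) : stripKernel d σ n u =
    decayKernel d σ n u - ∑ j ∈ Finset.range n, d j * Real.exp (-(σ j * u)) := by
  rw [stripKernel, Set.indicator_of_mem (Set.mem_Iic.2 hu)]

theorem exp_neg_I_mul_mul_I (c t : ℝ) :
    Complex.exp (-(Complex.I * (c * Complex.I) * t)) = (Real.exp (c * t) : ℂ) := by
  push_cast
  congr 1
  linear_combination (-(c : ℂ) * t) * Complex.I_sq

end kernels

namespace IsExpansion

variable {A κ : ℝ} {Θ : ℂ → ℂ} {σ d : ℕ → ℝ} {n : ℕ}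

theorem coeff_nonneg (H : IsExpansion A Θ κ σ d) (j : ℕ) : 0 ≤ d j := (H.coeff_pos j).le

theorem le_add (H : IsExpansion A Θ κ σ d) (n j : ℕ) : σ n ≤ σ (n + j) :=
  H.strictMono.monotone (Nat.le_add_right n j)

theorem isStieltjes_exponents (H : IsExpansion A Θ κ σ d) : IsStieltjes d σ where
  nonneg j := (H.pos j).le
  tendsto := H.tendsto
  coeff_nonneg := H.coeff_nonneg
  coeff_eq_zero j hj := absurd hj (H.pos j).ne'
  summable := H.summable

theorem summable_shift (H : IsExpansion A Θ κ σ d) (n : ℕ) :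
    Summable fun j => d (n + j) / σ (n + j) := H.summable.comp_injective (add_right_injective n)

theorem laplace_shift (H : IsExpansion A Θ κ σ d) {w : ℂ} (hw : 0 < σ n + w.re) :
    IntegrableOn (fun t : ℝ => Complex.exp (-(w * t)) *
        expSum (fun j => d (n + j)) (fun j => σ (n + j)) t) (Set.Ioi 0) ∧
      ∫ t in Set.Ioi (0 : ℝ), Complex.exp (-(w * t)) *
          expSum (fun j => d (n + j)) (fun j => σ (n + j)) t =
        simpleFractions (fun j => d (n + j)) (fun j => σ (n + j)) w := by
  have hpos : ∀ j, 0 < σ (n + j) + w.re := fun j => by linarith [H.le_add n j]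
  refine laplace_expSum (fun j => H.coeff_nonneg _) hpos
    (((H.isStieltjes_exponents.summable_div w.re).norm.comp_injective
      (add_right_injective n)).congr fun j => ?_)
  rw [Function.comp_apply, ← Complex.ofReal_add, ← Complex.ofReal_div, add_comm w.re,
    Complex.norm_of_nonneg (div_nonneg (H.coeff_nonneg _) (hpos j).le)]

theorem fourier_decayKernel (H : IsExpansion A Θ κ σ d) {z : ℂ} (hz₀ : -σ 0 < z.im)
    (hz : z.im < σ n) :
    Integrable (fun t : ℝ => Complex.exp (-(Complex.I * z * t)) * decayKernel d σ n t) ∧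
      ∫ t : ℝ, Complex.exp (-(Complex.I * z * t)) * decayKernel d σ n t =
        simpleFractions (fun j => d (n + j)) (fun j => σ (n + j)) (Complex.I * z) +
          simpleFractions d σ (-(Complex.I * z)) := by
  have hre : (Complex.I * z).re = -z.im := Complex.I_mul_re z
  obtain ⟨hpos, hpos_eq⟩ := H.laplace_shift (n := n) (w := Complex.I * z) (by rw [hre]; linarith)
  obtain ⟨hneg, hneg_eq⟩ := H.laplace_shift (n := 0) (w := -(Complex.I * z))
    (by rw [Complex.neg_re, hre]; linarith)
  simp only [zero_add] at hneg hneg_eq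
  have hcongr_pos : Set.EqOn
      (fun t : ℝ => Complex.exp (-(Complex.I * z * t)) * decayKernel d σ n t)
      (fun t : ℝ => Complex.exp (-(Complex.I * z * t)) *
        expSum (fun j => d (n + j)) (fun j => σ (n + j)) t) (Set.Ioi 0) := fun t ht => by
    dsimp only
    rw [decayKernel_of_pos ht]
  have hcongr_neg : Set.EqOn
      (fun t : ℝ => Complex.exp (-(Complex.I * z * (-t : ℝ))) * decayKernel d σ n (-t))
      (fun t : ℝ => Complex.exp (-(-(Complex.I * z) * t)) * expSum d σ t)
      (Set.Ioi 0) := fun t ht => by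
    dsimp only
    rw [decayKernel_of_nonpos (neg_nonpos.2 (le_of_lt ht)), neg_neg, Complex.ofReal_neg, mul_neg,
      neg_mul]
  rw [← hpos_eq, ← hneg_eq, ← setIntegral_congr_fun measurableSet_Ioi hcongr_pos,
    ← setIntegral_congr_fun measurableSet_Ioi hcongr_neg]
  exact integrable_and_integral_eq_of_halfLines (hpos.congr_fun hcongr_pos.symm measurableSet_Ioi)
    (hneg.congr_fun hcongr_neg.symm measurableSet_Ioi)

theorem simpleFractions_shift (H : IsExpansion A Θ κ σ d) (n : ℕ) (w : ℂ) :
    (∑ j ∈ Finset.range n, (d j : ℂ) / (w + σ j)) +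
        simpleFractions (fun j => d (n + j)) (fun j => σ (n + j)) w = simpleFractions d σ w := by
  simpa only [simpleFractions, add_comm n] using
    (H.isStieltjes_exponents.summable_div w).sum_add_tsum_nat_add n

theorem resolventSum_eq (H : IsExpansion A Θ κ σ d) {z : ℂ}
    (hz : ∀ j, z ^ 2 ≠ -((σ j ^ 2 : ℝ) : ℂ)) :
    resolventSum σ d z =
      simpleFractions d σ (Complex.I * z) + simpleFractions d σ (-(Complex.I * z)) := by
  rw [simpleFractions, simpleFractions,
    ← (H.isStieltjes_exponents.summable_div _).tsum_add (H.isStieltjes_exponents.summable_div _)]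
  refine tsum_congr fun j => ?_
  have hmul : (Complex.I * z + σ j) * (-(Complex.I * z) + σ j) = z ^ 2 + ((σ j ^ 2 : ℝ) : ℂ) := by
    push_cast
    linear_combination (-z ^ 2) * Complex.I_sq
  have hne : z ^ 2 + ((σ j ^ 2 : ℝ) : ℂ) ≠ 0 := fun h => hz j (eq_neg_of_add_eq_zero_left h)
  rw [div_add_div _ _ (left_ne_zero_of_mul (hmul ▸ hne)) (right_ne_zero_of_mul (hmul ▸ hne)), hmul]
  push_cast
  ring

theorem integrableOn_exp_mul_modes {z : ℂ} (hlow : ∀ j < n, σ j < z.im) :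
    IntegrableOn (fun t : ℝ => Complex.exp (-(Complex.I * z * t)) *
        ((∑ j ∈ Finset.range n, d j * Real.exp (-(σ j * t)) : ℝ) : ℂ)) (Set.Iic 0) ∧
      ∫ t in Set.Iic (0 : ℝ), Complex.exp (-(Complex.I * z * t)) *
          ((∑ j ∈ Finset.range n, d j * Real.exp (-(σ j * t)) : ℝ) : ℂ) =
        -∑ j ∈ Finset.range n, (d j : ℂ) / (Complex.I * z + σ j) := by
  have hre : ∀ j ∈ Finset.range n, 0 < (-(Complex.I * z + σ j)).re := fun j hj => by
    rw [Complex.neg_re, Complex.add_re, Complex.I_mul_re, Complex.ofReal_re]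
    linarith [hlow j (Finset.mem_range.1 hj)]
  have hterm : ∀ t : ℝ, Complex.exp (-(Complex.I * z * t)) *
      ((∑ j ∈ Finset.range n, d j * Real.exp (-(σ j * t)) : ℝ) : ℂ) =
      ∑ j ∈ Finset.range n, d j * Complex.exp (-(Complex.I * z + σ j) * t) := fun t => by
    push_cast
    rw [Finset.mul_sum]
    refine Finset.sum_congr rfl fun j _ => ?_
    rw [mul_left_comm, ← Complex.exp_add, ← neg_add, ← add_mul, ← neg_mul]
  have hint : ∀ j ∈ Finset.range n, IntegrableOn
      (fun t : ℝ => (d j : ℂ) * Complex.exp (-(Complex.I * z + σ j) * t)) (Set.Iic 0) :=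
    fun j hj => (integrableOn_exp_mul_complex_Iic (hre j hj) 0).const_mul _
  simp_rw [hterm]
  refine ⟨integrable_finsetSum _ hint, ?_⟩
  rw [integral_finsetSum _ hint, ← Finset.sum_neg_distrib]
  refine Finset.sum_congr rfl fun j hj => ?_
  rw [integral_const_mul, integral_exp_mul_complex_Iic (hre j hj), Complex.ofReal_zero, mul_zero,
    Complex.exp_zero, one_div, inv_neg, mul_neg, div_eq_mul_inv]

theorem fourier_stripKernel (H : IsExpansion A Θ κ σ d) {z : ℂ} (hz : InStrip σ n z.im) :
    Integrable (fun t : ℝ => Complex.exp (-(Complex.I * z * t)) * stripKernel d σ n t) ∧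
      ∫ t : ℝ, Complex.exp (-(Complex.I * z * t)) * stripKernel d σ n t =
        simpleFractions d σ (Complex.I * z) + simpleFractions d σ (-(Complex.I * z)) := by
  obtain ⟨hdecay, hdecay_eq⟩ := H.fourier_decayKernel hz.neg_lt hz.lt_upper
  obtain ⟨hmodes, hmodes_eq⟩ := integrableOn_exp_mul_modes (d := d) hz.lower_lt
  have hsplit : (fun t : ℝ => Complex.exp (-(Complex.I * z * t)) * stripKernel d σ n t) =
      (fun t : ℝ => Complex.exp (-(Complex.I * z * t)) * decayKernel d σ n t) -
        (Set.Iic 0).indicator (fun t : ℝ => Complex.exp (-(Complex.I * z * t)) *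
          ((∑ j ∈ Finset.range n, d j * Real.exp (-(σ j * t)) : ℝ) : ℂ)) := by
    funext t
    rw [Pi.sub_apply, stripKernel, Set.indicator_apply, Set.indicator_apply]
    split_ifs
    · rw [Complex.ofReal_sub, mul_sub]
    · rw [sub_zero, sub_zero]
  rw [hsplit]
  refine ⟨hdecay.sub (hmodes.integrable_indicator measurableSet_Iic), ?_⟩
  rw [integral_sub' hdecay (hmodes.integrable_indicator measurableSet_Iic),
    integral_indicator measurableSet_Iic, hdecay_eq, hmodes_eq,
    ← H.simpleFractions_shift n (Complex.I * z)]
  ring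

theorem integrable_exp_mul_decayKernel (H : IsExpansion A Θ κ σ d) {c : ℝ} (hc₀ : -σ 0 < c)
    (hc : c < σ n) : Integrable fun t => Real.exp (c * t) * decayKernel d σ n t := by
  have him : (c * Complex.I).im = c := by rw [Complex.im_ofReal_mul, Complex.I_im, mul_one]
  refine (H.fourier_decayKernel (n := n) (z := c * Complex.I) (by rwa [him])
    (by rwa [him])).1.re.congr (.of_forall fun t => ?_)
  dsimp only
  rw [exp_neg_I_mul_mul_I, ← Complex.ofReal_mul, RCLike.re_eq_complex_re, Complex.ofReal_re]

theorem integrable_exp_mul_stripKernel (H : IsExpansion A Θ κ σ d) {ϑ : ℝ}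
    (hϑ : InStrip σ n ϑ) :
    Integrable fun t => Real.exp (ϑ * t) * stripKernel d σ n t := by
  have him : (ϑ * Complex.I).im = ϑ := by rw [Complex.im_ofReal_mul, Complex.I_im, mul_one]
  refine (H.fourier_stripKernel (n := n) (z := ϑ * Complex.I) (by rwa [him])).1.re.congr
    (.of_forall fun t => ?_)
  dsimp only
  rw [exp_neg_I_mul_mul_I, ← Complex.ofReal_mul, RCLike.re_eq_complex_re, Complex.ofReal_re]

theorem contDiffOn_decayKernel (H : IsExpansion A Θ κ σ d) {m : WithTop ℕ∞} :
    ContDiffOn ℝ m (decayKernel d σ n) {0}ᶜ := by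
  intro t ht
  refine ContDiffAt.contDiffWithinAt ?_
  rcases lt_or_gt_of_ne (ht : t ≠ 0) with h | h
  · have hexp : ContDiffAt ℝ m (expSum d σ) (-t) :=
      (contDiffOn_expSum H.coeff_nonneg H.pos H.summable).contDiffAt (Ioi_mem_nhds (neg_pos.2 h))
    refine (hexp.comp t contDiff_neg.contDiffAt).congr_of_eventuallyEq ?_
    filter_upwards [Iio_mem_nhds h] with x hx
    exact decayKernel_of_nonpos (le_of_lt hx)
  · refine ((contDiffOn_expSum (fun j => H.coeff_nonneg _) (fun j => H.pos _)
      (H.summable_shift n)).contDiffAt (Ioi_mem_nhds h)).congr_of_eventuallyEq ?_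
    filter_upwards [Ioi_mem_nhds h] with x hx
    exact decayKernel_of_pos hx

theorem contDiffOn_stripKernel (H : IsExpansion A Θ κ σ d) {m : WithTop ℕ∞} :
    ContDiffOn ℝ m (stripKernel d σ n) {0}ᶜ := by
  intro t ht
  have hdecay := (H.contDiffOn_decayKernel (n := n) (m := m)).contDiffAt
    (isOpen_compl_singleton.mem_nhds ht)
  refine ContDiffAt.contDiffWithinAt ?_
  rcases lt_or_gt_of_ne (ht : t ≠ 0) with h | h
  · refine (hdecay.sub (by fun_prop : ContDiffAt ℝ m
      (fun t => ∑ j ∈ Finset.range n, d j * Real.exp (-(σ j * t))) t)).congr_of_eventuallyEq ?_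
    filter_upwards [Iio_mem_nhds h] with x hx
    exact stripKernel_of_nonpos (le_of_lt hx)
  · refine hdecay.congr_of_eventuallyEq ?_
    filter_upwards [Ioi_mem_nhds h] with x hx
    exact stripKernel_of_pos hx

end IsExpansion

/-- Membership in `L¹ + L^∞`, with everywhere defined summands. It is the class of functions whose
convolution with an integrable kernel exists and is tempered. -/
def IsSumL1Linf (g : ℝ → ℂ) : Prop :=
  ∃ g₁ g₂ : ℝ → ℂ, (∀ t, g t = g₁ t + g₂ t) ∧ Integrable g₁ ∧
    AEStronglyMeasurable g₂ volume ∧ ∃ C, ∀ t, ‖g₂ t‖ ≤ C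

theorem exists_bound_of_isBigO_one {E : Type*} [SeminormedAddCommGroup E] {g : ℝ → E}
    (hg : g =O[cocompact ℝ] fun _ => (1 : ℝ)) : ∃ C R, 0 ≤ C ∧ ∀ s, R < ‖s‖ → ‖g s‖ ≤ C := by
  obtain ⟨C, hC₀, hC⟩ := hg.exists_nonneg
  obtain ⟨S, hS, hS'⟩ := mem_cocompact.1 hC.bound
  obtain ⟨R, hR⟩ := hS.isBounded.subset_closedBall 0
  refine ⟨C, R, hC₀, fun s hs => ?_⟩
  have hmem : s ∈ Sᶜ := fun h => hs.not_ge (mem_closedBall_zero_iff.1 (hR h))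
  simpa only [Set.mem_ofPred_eq, norm_one, mul_one] using hS' hmem

theorem isSumL1Linf_of_isBigO {g : ℝ → ℂ} (hg : LocallyIntegrable g)
    (hO : g =O[cocompact ℝ] fun _ => (1 : ℝ)) : IsSumL1Linf g := by
  obtain ⟨C, R, hC₀, hC⟩ := exists_bound_of_isBigO_one hO
  set S := Metric.closedBall (0 : ℝ) R
  have hS : MeasurableSet S := Metric.isClosed_closedBall.measurableSet
  refine ⟨S.indicator g, Sᶜ.indicator g,
    fun t => (Set.indicator_self_add_compl_apply S g t).symm,
    (hg.integrableOn_isCompact (isCompact_closedBall 0 R)).integrable_indicator hS,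
    hg.aestronglyMeasurable.indicator hS.compl, C, fun t => ?_⟩
  by_cases ht : t ∈ Sᶜ
  · rw [Set.indicator_of_mem ht]
    exact hC t (not_le.1 fun h => ht (mem_closedBall_zero_iff.2 h))
  · rwa [Set.indicator_of_notMem ht, norm_zero]

namespace IsSumL1Linf

variable {g K ψ : ℝ → ℂ} {M : ℝ}

theorem integrable_mul (hg : IsSumL1Linf g) (hψ : Integrable ψ) (hM : ∀ t, ‖ψ t‖ ≤ M) :
    Integrable fun t => g t * ψ t := by
  obtain ⟨g₁, g₂, hsum, hg₁, hg₂, C, hC⟩ := hg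
  simp_rw [hsum, add_mul]
  exact (hg₁.mul_bdd hψ.aestronglyMeasurable (.of_forall hM)).add (hψ.bdd_mul hg₂ (.of_forall hC))

theorem integrable_prod (hg : IsSumL1Linf g) (hK : Integrable K) (hψ : Integrable ψ)
    (hM : ∀ t, ‖ψ t‖ ≤ M) :
    Integrable (fun p : ℝ × ℝ => g p.2 * K (p.1 - p.2) * ψ p.1) (volume.prod volume) := by
  obtain ⟨g₁, g₂, hsum, hg₁, hg₂, C, hC⟩ := hg
  simp_rw [hsum, add_mul]
  refine Integrable.add ?_ ?_
  · have hconv := hg₁.convolution_integrand (ContinuousLinearMap.mul ℂ ℂ) hK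
    simp only [ContinuousLinearMap.mul_apply'] at hconv
    exact hconv.mul_bdd hψ.aestronglyMeasurable.comp_fst (.of_forall fun p => hM p.1)
  · have hconv := (hψ.convolution_integrand (ContinuousLinearMap.mul ℂ ℂ) hK.comp_neg).swap
    simp only [ContinuousLinearMap.mul_apply'] at hconv
    refine (hconv.bdd_mul hg₂.comp_snd (.of_forall fun p => hC p.2)).congr (.of_forall fun p => ?_)
    simp only [Function.comp, Prod.swap, neg_sub]
    ring

theorem ae_integrable (hg : IsSumL1Linf g) (hK : Integrable K) :
    ∀ᵐ t, Integrable fun s => g s * K (t - s) := by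
  obtain ⟨g₁, g₂, hsum, hg₁, hg₂, C, hC⟩ := hg
  filter_upwards [(hg₁.convolution_integrand (ContinuousLinearMap.mul ℂ ℂ) hK).prod_right_ae]
    with t ht
  simp only [ContinuousLinearMap.mul_apply'] at ht
  simp_rw [hsum, add_mul]
  exact ht.add ((hK.comp_sub_left t).bdd_mul hg₂ (.of_forall hC))

theorem integrable_conv_mul (hg : IsSumL1Linf g) (hK : Integrable K) (hψ : Integrable ψ)
    (hM : ∀ t, ‖ψ t‖ ≤ M) : Integrable fun t => (∫ s, g s * K (t - s)) * ψ t := by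
  simpa only [integral_mul_const] using (hg.integrable_prod hK hψ hM).integral_prod_left

theorem integrable_mul_inner (hg : IsSumL1Linf g) (hK : Integrable K) (hψ : Integrable ψ)
    (hM : ∀ t, ‖ψ t‖ ≤ M) : Integrable fun s => g s * ∫ t, K (t - s) * ψ t := by
  simpa only [mul_assoc, integral_const_mul] using
    (hg.integrable_prod hK hψ hM).integral_prod_right

theorem integral_conv_mul (hg : IsSumL1Linf g) (hK : Integrable K) (hψ : Integrable ψ)
    (hM : ∀ t, ‖ψ t‖ ≤ M) :
    ∫ t, (∫ s, g s * K (t - s)) * ψ t = ∫ s, g s * ∫ t, K (t - s) * ψ t := by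
  simp_rw [← integral_mul_const, ← integral_const_mul, ← mul_assoc]
  exact integral_integral_swap (hg.integrable_prod hK hψ hM)

end IsSumL1Linf

theorem fourierHat_eq (φ : 𝓢(ℝ, ℂ)) (ξ : ℝ) :
    fourierHat φ ξ = ((1 / √(2 * Real.pi) : ℝ) : ℂ) *
      (FourierTransform.fourier φ : 𝓢(ℝ, ℂ)) (ξ / (2 * Real.pi)) := by
  rw [fourierHat, SchwartzMap.fourier_coe, Real.fourier_real_eq_integral_exp_smul]
  congr 1
  refine integral_congr_ae (.of_forall fun t => ?_)
  dsimp only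
  rw [smul_eq_mul]
  congr 2
  have hpi : (Real.pi : ℂ) ≠ 0 := Complex.ofReal_ne_zero.2 Real.pi_ne_zero
  push_cast
  field_simp

theorem integrable_fourierHat (φ : 𝓢(ℝ, ℂ)) : Integrable (fourierHat φ) := by
  simp_rw [funext (fourierHat_eq φ)]
  exact (((FourierTransform.fourier φ : 𝓢(ℝ, ℂ)).integrable (μ := volume)).comp_div
    (by positivity)).const_mul _

theorem schwartz_bounded (φ : 𝓢(ℝ, ℂ)) : ∃ M, ∀ t, ‖φ t‖ ≤ M :=
  ⟨_, fun t => SchwartzMap.norm_le_seminorm ℝ φ t⟩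

theorem fourierHat_bounded (φ : 𝓢(ℝ, ℂ)) : ∃ M, ∀ t, ‖fourierHat φ t‖ ≤ M := by
  obtain ⟨M, hM⟩ := schwartz_bounded (FourierTransform.fourier φ : 𝓢(ℝ, ℂ))
  refine ⟨‖((1 / √(2 * Real.pi) : ℝ) : ℂ)‖ * M, fun t => ?_⟩
  rw [fourierHat_eq, norm_mul]
  exact mul_le_mul_of_nonneg_left (hM _) (norm_nonneg _)

theorem norm_exp_neg_I_mul (a b : ℝ) : ‖Complex.exp (-(Complex.I * a * b))‖ = 1 := by
  rw [← mul_neg, mul_assoc, ← Complex.ofReal_neg, ← Complex.ofReal_mul,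
    Complex.norm_exp_I_mul_ofReal]

theorem integrable_exp_neg_I_mul {f : ℝ → ℂ} (hf : Integrable f) (s : ℝ) :
    Integrable fun ξ : ℝ => Complex.exp (-(Complex.I * s * ξ)) * f ξ :=
  hf.bdd_mul (by fun_prop : Continuous fun ξ : ℝ =>
    Complex.exp (-(Complex.I * s * ξ))).aestronglyMeasurable
      (.of_forall fun ξ => (norm_exp_neg_I_mul s ξ).le)

section kernel

variable {K : ℝ → ℂ}

theorem integral_kernel_mul_fourierHat (hK : Integrable K) (χ : 𝓢(ℝ, ℂ)) (s : ℝ) :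
    ∫ t, K (t - s) * fourierHat χ t =
      fourierHat (fun ξ => χ ξ * ∫ t : ℝ, Complex.exp (-(Complex.I * ξ * t)) * K t) s := by
  have hexp : ∀ u ξ : ℝ, Complex.exp (-(Complex.I * ((u + s : ℝ) : ℂ) * ξ)) =
      Complex.exp (-(Complex.I * s * ξ)) * Complex.exp (-(Complex.I * ξ * u)) := fun u ξ => by
    rw [← Complex.exp_add]
    push_cast
    ring_nf
  have hint : Integrable (fun p : ℝ × ℝ => K p.1 *
      (Complex.exp (-(Complex.I * ((p.1 + s : ℝ) : ℂ) * p.2)) * χ p.2)) (volume.prod volume) := by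
    have hcont : Continuous fun p : ℝ × ℝ =>
        Complex.exp (-(Complex.I * ((p.1 + s : ℝ) : ℂ) * p.2)) := by fun_prop
    refine ((hK.mul_prod (χ.integrable (μ := volume))).bdd_mul hcont.aestronglyMeasurable
      (.of_forall fun p => (norm_exp_neg_I_mul _ _).le)).congr (.of_forall fun p => ?_)
    ring
  rw [← integral_add_right_eq_self (fun t => K (t - s) * fourierHat χ t) s]
  simp only [add_sub_cancel_right, fourierHat, mul_left_comm (K _)]
  rw [integral_const_mul]
  congr 1
  simp_rw [← integral_const_mul]
  rw [integral_integral_swap hint]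
  refine integral_congr_ae (.of_forall fun ξ => integral_congr_ae (.of_forall fun u => ?_))
  dsimp only
  rw [hexp]
  ring

theorem integrable_mul_fourierIntegral (hK : Integrable K) (φ : 𝓢(ℝ, ℂ)) :
    Integrable fun ξ : ℝ => φ ξ * ∫ t : ℝ, Complex.exp (-(Complex.I * ξ * t)) * K t := by
  have hmeas : AEStronglyMeasurable
      (fun ξ : ℝ => ∫ t : ℝ, Complex.exp (-(Complex.I * ξ * t)) * K t) volume :=
    AEStronglyMeasurable.integral_prod_right' (μ := volume)
      (f := fun p : ℝ × ℝ => Complex.exp (-(Complex.I * p.1 * p.2)) * K p.2)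
      ((by fun_prop : Continuous fun p : ℝ × ℝ =>
        Complex.exp (-(Complex.I * p.1 * p.2))).aestronglyMeasurable.mul
          hK.aestronglyMeasurable.comp_snd)
  refine (φ.integrable (μ := volume)).mul_bdd (c := ∫ t, ‖K t‖) hmeas (.of_forall fun ξ => ?_)
  refine (norm_integral_le_integral_norm _).trans_eq (integral_congr_ae (.of_forall fun t => ?_))
  dsimp only
  rw [norm_mul, norm_exp_neg_I_mul, one_mul]

theorem integral_kernel_mul_fourierHat_of_resolvent (hK : Integrable K) {κ : ℂ} {φ χ : 𝓢(ℝ, ℂ)}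
    (h : ∀ᵐ ξ : ℝ, χ ξ * (∫ t : ℝ, Complex.exp (-(Complex.I * ξ * t)) * K t) =
      φ ξ + κ * (φ ξ * ∫ t : ℝ, Complex.exp (-(Complex.I * ξ * t)) * K t)) (s : ℝ) :
    ∫ t, K (t - s) * fourierHat χ t =
      fourierHat φ s + κ * ∫ t, K (t - s) * fourierHat φ t := by
  rw [integral_kernel_mul_fourierHat hK χ s, integral_kernel_mul_fourierHat hK φ s]
  simp only [fourierHat]
  rw [mul_left_comm κ, ← mul_add, ← integral_const_mul κ, ← integral_add
    (integrable_exp_neg_I_mul φ.integrable s)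
    ((integrable_exp_neg_I_mul (integrable_mul_fourierIntegral hK φ) s).const_mul κ)]
  congr 1
  refine integral_congr_ae ?_
  filter_upwards [h] with ξ hξ
  rw [hξ]
  ring

theorem IsSumL1Linf.integral_conv_mul_fourierHat {g : ℝ → ℂ} (hg : IsSumL1Linf g)
    (hK : Integrable K) {κ : ℂ} {φ χ : 𝓢(ℝ, ℂ)}
    (h : ∀ᵐ ξ : ℝ, χ ξ * (∫ t : ℝ, Complex.exp (-(Complex.I * ξ * t)) * K t) =
      φ ξ + κ * (φ ξ * ∫ t : ℝ, Complex.exp (-(Complex.I * ξ * t)) * K t)) :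
    ∫ t, (∫ s, g s * K (t - s)) * fourierHat χ t =
      ∫ t, (κ * (∫ s, g s * K (t - s)) + g t) * fourierHat φ t := by
  obtain ⟨M, hM⟩ := fourierHat_bounded χ
  obtain ⟨M', hM'⟩ := fourierHat_bounded φ
  have hφ := integrable_fourierHat φ
  have hgφ := hg.integrable_mul hφ hM'
  calc ∫ t, (∫ s, g s * K (t - s)) * fourierHat χ t
      = ∫ s, (κ * (g s * ∫ t, K (t - s) * fourierHat φ t) + g s * fourierHat φ s) := by
        rw [hg.integral_conv_mul hK (integrable_fourierHat χ) hM]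
        refine integral_congr_ae (.of_forall fun s => ?_)
        dsimp only
        rw [integral_kernel_mul_fourierHat_of_resolvent hK h]
        ring
    _ = κ * (∫ t, (∫ s, g s * K (t - s)) * fourierHat φ t) + ∫ t, g t * fourierHat φ t := by
        rw [integral_add ((hg.integrable_mul_inner hK hφ hM').const_mul κ) hgφ,
          integral_const_mul, hg.integral_conv_mul hK hφ hM']
    _ = ∫ t, (κ * (∫ s, g s * K (t - s)) + g t) * fourierHat φ t := by
        simp_rw [add_mul, mul_assoc κ]
        rw [integral_add ((hg.integrable_conv_mul hK hφ hM').const_mul κ) hgφ, integral_const_mul]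

end kernel

theorem exp_mul_mul_exp_mul (h k : ℝ → ℝ) (ϑ t s : ℝ) :
    (Real.exp (ϑ * s) * h s) * (Real.exp (ϑ * (t - s)) * k (t - s)) =
      Real.exp (ϑ * t) * (h s * k (t - s)) := by
  rw [mul_mul_mul_comm, ← Real.exp_add, ← mul_add, add_sub_cancel]

theorem exp_mul_convolve (h k : ℝ → ℝ) (ϑ t : ℝ) :
    convolve (fun s => Real.exp (ϑ * s) * h s) (fun u => Real.exp (ϑ * u) * k u) t =
      Real.exp (ϑ * t) * convolve h k t := by
  simp_rw [convolve, exp_mul_mul_exp_mul]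
  exact integral_const_mul _ _

theorem integrable_of_exp_mul {h k : ℝ → ℝ} {ϑ t : ℝ}
    (hi : Integrable fun s => (Real.exp (ϑ * s) * h s) * (Real.exp (ϑ * (t - s)) * k (t - s))) :
    Integrable fun s => h s * k (t - s) := by
  simp_rw [exp_mul_mul_exp_mul] at hi
  exact (integrable_const_mul_iff (Real.exp_ne_zero _).isUnit _).1 hi

theorem isBigO_exp_of_exp_mul_convolve {h k f : ℝ → ℝ} {ϑ : ℝ} {l : Filter ℝ}
    (hO : convolve (fun s => Real.exp (ϑ * s) * h s) (fun u => Real.exp (ϑ * u) * k u) =O[l] f) :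
    convolve h k =O[l] fun t => f t * Real.exp (-(ϑ * t)) := by
  refine (hO.mul (isBigO_refl (fun t => Real.exp (-(ϑ * t))) l)).congr_left fun t => ?_
  rw [exp_mul_convolve, mul_right_comm, ← Real.exp_add, add_neg_cancel, Real.exp_zero, one_mul]

section weighted

variable {h k : ℝ → ℝ} {ϑ : ℝ}

theorem ae_integrable_convolve
    (hg : IsSumL1Linf fun t => ((Real.exp (ϑ * t) * h t : ℝ) : ℂ))
    (hK : Integrable fun t => Real.exp (ϑ * t) * k t) :
    ∀ᵐ t : ℝ, Integrable fun s => h s * k (t - s) := by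
  filter_upwards [hg.ae_integrable hK.ofReal] with t ht
  simp_rw [RCLike.ofReal_eq_complex_ofReal, ← Complex.ofReal_mul (_ * h _)] at ht
  exact integrable_of_exp_mul ht.re

theorem isSolution_convolve {N m : ℕ} {γ κ : ℝ}
    (hg : IsSumL1Linf fun t => ((Real.exp (ϑ * t) * h t : ℝ) : ℂ))
    (hK : Integrable fun t => Real.exp (ϑ * t) * k t)
    (hF : ∀ᵐ ξ : ℝ, (symbol N γ m (ξ + ϑ * Complex.I) - κ) *
      ∫ t : ℝ, Complex.exp (-(Complex.I * ((ξ : ℂ) + ϑ * Complex.I) * t)) * (k t : ℂ) = 1) :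
    IsSolution N γ m κ ϑ (convolve h k) h := by
  have hKC : Integrable fun t => ((Real.exp (ϑ * t) * k t : ℝ) : ℂ) :=
    Complex.ofRealCLM.integrable_comp hK
  have hw : ∀ t, ((Real.exp (ϑ * t) * convolve h k t : ℝ) : ℂ) =
      ∫ s, ((Real.exp (ϑ * s) * h s : ℝ) : ℂ) *
        ((Real.exp (ϑ * (t - s)) * k (t - s) : ℝ) : ℂ) := fun t => by
    simp_rw [← exp_mul_convolve, convolve, ← Complex.ofReal_mul (_ * h _)]
    exact integral_complex_ofReal.symm
  have hrhs : ∀ t, ((Real.exp (ϑ * t) * (κ * convolve h k t + h t) : ℝ) : ℂ) =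
      κ * ((Real.exp (ϑ * t) * convolve h k t : ℝ) : ℂ) + ((Real.exp (ϑ * t) * h t : ℝ) : ℂ) :=
    fun t => by rw [mul_add, mul_left_comm, Complex.ofReal_add, Complex.ofReal_mul κ]
  have htemp : IsTemperedFun fun t => Real.exp (ϑ * t) * convolve h k t := fun ψ => by
    obtain ⟨M, hM⟩ := schwartz_bounded ψ
    simpa only [hw] using hg.integrable_conv_mul hKC (ψ.integrable (μ := volume)) hM
  refine ⟨htemp, fun ψ => ?_, fun φ χ hχ => ?_⟩
  · obtain ⟨M, hM⟩ := schwartz_bounded ψ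
    simp_rw [hrhs, add_mul, mul_assoc]
    exact ((htemp ψ).const_mul _).add (hg.integrable_mul ψ.integrable hM)
  · simp_rw [hrhs, hw]
    refine hg.integral_conv_mul_fourierHat hKC ?_
    filter_upwards [hF, hχ] with ξ hξ hχξ
    have hline : ∫ t : ℝ, Complex.exp (-(Complex.I * ξ * t)) *
          ((Real.exp (ϑ * t) * k t : ℝ) : ℂ) =
        ∫ t : ℝ, Complex.exp (-(Complex.I * ((ξ : ℂ) + ϑ * Complex.I) * t)) * (k t : ℂ) := by
      refine integral_congr_ae (.of_forall fun t => ?_)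
      dsimp only
      rw [Complex.ofReal_mul, ← exp_neg_I_mul_mul_I, ← mul_assoc, ← Complex.exp_add, ← neg_add,
        ← add_mul, ← mul_add]
    rw [hline, hχξ]
    linear_combination φ ξ * hξ

end weighted

/-- The class of right-hand sides `h`: locally integrable, `O(e^{-δ t})` at `+∞` and `O(e^{δ₀ t})`
at `-∞`. -/
structure HasExpBounds (h : ℝ → ℝ) (δ δ₀ : ℝ) : Prop where
  locallyIntegrable : LocallyIntegrable h
  isBigO_atTop : h =O[atTop] fun t => Real.exp (-(δ * t))
  isBigO_atBot : h =O[atBot] fun t => Real.exp (δ₀ * t)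

theorem exp_mul_isBigO {h : ℝ → ℝ} {l : Filter ℝ} {a : ℝ} (ho : h =O[l] fun t => Real.exp (a * t))
    (c : ℝ) : (fun t => Real.exp (c * t) * h t) =O[l] fun t => Real.exp ((c + a) * t) := by
  simp_rw [add_mul, Real.exp_add]
  exact (isBigO_refl _ l).mul ho

theorem exp_mul_isBigO_one {h : ℝ → ℝ} {l : Filter ℝ} {a c : ℝ}
    (ho : h =O[l] fun t => Real.exp (a * t)) (hle : ∀ᶠ t in l, (c + a) * t ≤ 0) :
    (fun t => Real.exp (c * t) * h t) =O[l] fun _ => (1 : ℝ) :=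
  (exp_mul_isBigO ho c).trans
    (Real.isBigO_exp_comp_one.2 (isBoundedUnder_of_eventually_le hle))

namespace HasExpBounds

variable {h : ℝ → ℝ} {δ δ₀ c : ℝ}

theorem isBigO_atTop' (hh : HasExpBounds h δ δ₀) : h =O[atTop] fun t => Real.exp (-δ * t) := by
  simpa only [neg_mul] using hh.isBigO_atTop

theorem locallyIntegrable_exp_mul (hh : HasExpBounds h δ δ₀) (c : ℝ) :
    LocallyIntegrable fun t => Real.exp (c * t) * h t :=
  hh.locallyIntegrable.continuous_mul (by fun_prop)

theorem exp_mul_isBigO_one_atBot (hh : HasExpBounds h δ δ₀) (hc : -δ₀ ≤ c) :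
    (fun t => Real.exp (c * t) * h t) =O[atBot] fun _ => (1 : ℝ) := by
  refine exp_mul_isBigO_one hh.isBigO_atBot ?_
  filter_upwards [eventually_le_atBot 0] with t ht
  exact mul_nonpos_of_nonneg_of_nonpos (by linarith) ht

theorem exp_mul_isBigO_one_cocompact (hh : HasExpBounds h δ δ₀) (hc₀ : -δ₀ ≤ c) (hc : c ≤ δ) :
    (fun t => Real.exp (c * t) * h t) =O[cocompact ℝ] fun _ => (1 : ℝ) := by
  rw [cocompact_eq_atBot_atTop]
  refine (hh.exp_mul_isBigO_one_atBot hc₀).sup (exp_mul_isBigO_one hh.isBigO_atTop' ?_)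
  filter_upwards [eventually_ge_atTop 0] with t ht
  exact mul_nonpos_of_nonpos_of_nonneg (by linarith) ht

theorem isSumL1Linf_exp_mul (hh : HasExpBounds h δ δ₀) (hc₀ : -δ₀ ≤ c) (hc : c ≤ δ) :
    IsSumL1Linf fun t => ((Real.exp (c * t) * h t : ℝ) : ℂ) := by
  refine isSumL1Linf_of_isBigO (fun x => ?_) (isBigO_norm_left.1 ?_)
  · obtain ⟨s, hs, hint⟩ := hh.locallyIntegrable_exp_mul c x
    exact ⟨s, hs, Complex.ofRealCLM.integrable_comp hint⟩
  · simpa only [Complex.norm_real] using (hh.exp_mul_isBigO_one_cocompact hc₀ hc).norm_left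

theorem integrableOn_Ioi_exp_mul (hh : HasExpBounds h δ δ₀) (hc : c < δ) (t : ℝ) :
    IntegrableOn (fun s => Real.exp (c * s) * h s) (Set.Ioi t) :=
  (((hh.locallyIntegrable_exp_mul c).locallyIntegrableOn _).integrableOn_of_isBigO_atTop
    (exp_mul_isBigO hh.isBigO_atTop' c) ⟨Set.Ioi 0, Ioi_mem_atTop 0,
      integrableOn_exp_mul_Ioi (by linarith) 0⟩).mono_set Set.Ioi_subset_Ici_self

theorem integrable_exp_mul (hh : HasExpBounds h δ δ₀) (hc₀ : 0 < c + δ₀) (hc : c < δ) :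
    Integrable fun s => Real.exp (c * s) * h s :=
  (hh.locallyIntegrable_exp_mul c).integrable_of_isBigO_atBot_atTop
    (exp_mul_isBigO hh.isBigO_atBot c)
    ⟨Set.Iic 0, Iic_mem_atBot 0, integrableOn_exp_mul_Iic hc₀ 0⟩
    (exp_mul_isBigO hh.isBigO_atTop' c)
    ⟨Set.Ioi 0, Ioi_mem_atTop 0, integrableOn_exp_mul_Ioi (by linarith) 0⟩

end HasExpBounds

section boundedConvolution

variable {g K : ℝ → ℝ} {M : ℝ}

theorem convolve_isBigO_one (hg : LocallyIntegrable g)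
    (hO : g =O[cocompact ℝ] fun _ => (1 : ℝ)) (hK : Integrable K)
    (hM : ∀ u, 1 ≤ ‖u‖ → ‖K u‖ ≤ M) :
    (∀ᶠ t in cocompact ℝ, Integrable fun s => g s * K (t - s)) ∧
      convolve g K =O[cocompact ℝ] fun _ => (1 : ℝ) := by
  obtain ⟨C, R, hC₀, hC⟩ := exists_bound_of_isBigO_one hO
  set S := Metric.closedBall (0 : ℝ) R
  have hgS : Integrable (S.indicator fun s => ‖g s‖) :=
    (integrable_indicator_iff Metric.isClosed_closedBall.measurableSet).2
      (hg.integrableOn_isCompact (isCompact_closedBall 0 R)).norm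
  have hdom_int : ∀ t, Integrable fun s => C * ‖K (t - s)‖ + M * S.indicator (fun s => ‖g s‖) s :=
    fun t => ((hK.comp_sub_left t).norm.const_mul C).add (hgS.const_mul M)
  have hdom : ∀ t, R + 1 ≤ ‖t‖ → ∀ s,
      ‖g s * K (t - s)‖ ≤ C * ‖K (t - s)‖ + M * S.indicator (fun s => ‖g s‖) s := fun t ht s => by
    rw [norm_mul]
    by_cases hs : s ∈ S
    · have hts : 1 ≤ ‖t - s‖ := by
        linarith [norm_sub_norm_le t s, mem_closedBall_zero_iff.1 hs]
      rw [Set.indicator_of_mem hs, mul_comm M]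
      exact le_add_of_nonneg_of_le (mul_nonneg hC₀ (norm_nonneg _))
        (mul_le_mul_of_nonneg_left (hM _ hts) (norm_nonneg _))
    · rw [Set.indicator_of_notMem hs, mul_zero, add_zero]
      exact mul_le_mul_of_nonneg_right
        (hC s (not_le.1 fun hle => hs (mem_closedBall_zero_iff.2 hle))) (norm_nonneg _)
  have hlarge : ∀ᶠ t in cocompact ℝ, R + 1 ≤ ‖t‖ :=
    tendsto_norm_cocompact_atTop.eventually_ge_atTop _
  refine ⟨?_, .of_bound (C * (∫ u, ‖K u‖) + M * ∫ s, S.indicator (fun s => ‖g s‖) s) ?_⟩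
  · filter_upwards [hlarge] with t ht
    exact (hdom_int t).mono' (hg.aestronglyMeasurable.mul
      (hK.comp_sub_left t).aestronglyMeasurable) (.of_forall (hdom t ht))
  · filter_upwards [hlarge] with t ht
    rw [norm_one, mul_one]
    refine (norm_integral_le_of_norm_le (hdom_int t) (.of_forall (hdom t ht))).trans_eq ?_
    rw [integral_add ((hK.comp_sub_left t).norm.const_mul C) (hgS.const_mul M),
      integral_const_mul, integral_const_mul, integral_sub_left_eq_self (fun u => ‖K u‖)]

theorem convolve_isBigO_integral_Ioi (hO : g =O[atBot] fun _ => (1 : ℝ))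
    (hg : ∀ t, IntegrableOn g (Set.Ioi t)) (hK : IntegrableOn K (Set.Ici (-1)))
    (hM : ∀ u ≤ -1, ‖K u‖ ≤ M) :
    convolve g K =O[atBot] fun t => 1 + ∫ s in Set.Ioi (t + 1), ‖g s‖ := by
  obtain ⟨C, hC₀, hC⟩ := hO.exists_nonneg
  obtain ⟨b, hb⟩ := eventually_atBot.1 hC.bound
  have hM₀ : 0 ≤ M := (norm_nonneg _).trans (hM (-1) le_rfl)
  set K₁ := (Set.Ici (-1)).indicator fun u => ‖K u‖
  have hK₁ : Integrable K₁ := (integrable_indicator_iff measurableSet_Ici).2 hK.norm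
  refine .of_bound (C * (∫ u, K₁ u) + M) ?_
  filter_upwards [eventually_le_atBot (b - 1)] with t ht
  have hg₁ : Integrable ((Set.Ioi (t + 1)).indicator fun s => ‖g s‖) :=
    (integrable_indicator_iff measurableSet_Ioi).2 (hg (t + 1)).norm
  have hdom : ∀ s, ‖g s * K (t - s)‖ ≤
      C * K₁ (t - s) + M * (Set.Ioi (t + 1)).indicator (fun s => ‖g s‖) s := fun s => by
    rw [norm_mul]
    rcases le_or_gt s (t + 1) with hs | hs
    · rw [show K₁ (t - s) = ‖K (t - s)‖ from Set.indicator_of_mem (Set.mem_Ici.2 (by linarith)) _,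
        Set.indicator_of_notMem (Set.notMem_Ioi.2 hs), mul_zero, add_zero]
      exact mul_le_mul_of_nonneg_right
        (by simpa only [norm_one, mul_one] using hb s (by linarith)) (norm_nonneg _)
    · rw [show K₁ (t - s) = 0 from Set.indicator_of_notMem (Set.notMem_Ici.2 (by linarith)) _,
        Set.indicator_of_mem (Set.mem_Ioi.2 hs), mul_zero, zero_add, mul_comm M]
      exact mul_le_mul_of_nonneg_left (hM _ (by linarith)) (norm_nonneg _)
  have htail : 0 ≤ ∫ s in Set.Ioi (t + 1), ‖g s‖ := integral_nonneg fun s => norm_nonneg _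
  have hhead : 0 ≤ C * ∫ u, K₁ u :=
    mul_nonneg hC₀ (integral_nonneg (Set.indicator_nonneg fun u _ => norm_nonneg _))
  calc ‖convolve g K t‖ ≤ C * (∫ u, K₁ u) + M * ∫ s in Set.Ioi (t + 1), ‖g s‖ := by
        refine (norm_integral_le_of_norm_le (((hK₁.comp_sub_left t).const_mul C).add
          (hg₁.const_mul M)) (.of_forall hdom)).trans_eq ?_
        rw [integral_add' ((hK₁.comp_sub_left t).const_mul C) (hg₁.const_mul M),
          integral_const_mul, integral_const_mul, integral_sub_left_eq_self K₁,
          integral_indicator measurableSet_Ioi]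
    _ ≤ (C * (∫ u, K₁ u) + M) * ‖1 + ∫ s in Set.Ioi (t + 1), ‖g s‖‖ := by
        rw [Real.norm_of_nonneg (by linarith)]
        nlinarith

theorem integral_Ioi_norm_isBigO_abs (hO : g =O[atBot] fun _ => (1 : ℝ))
    (hg : ∀ t, IntegrableOn g (Set.Ioi t)) :
    (fun t => 1 + ∫ s in Set.Ioi (t + 1), ‖g s‖) =O[atBot] fun t => |t| := by
  obtain ⟨C, hC₀, hC⟩ := hO.exists_nonneg
  obtain ⟨b, hb⟩ := eventually_atBot.1 hC.bound
  set I := ∫ s in Set.Ioi b, ‖g s‖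
  have hI : 0 ≤ I := integral_nonneg fun s => norm_nonneg _
  refine .of_bound (1 + I + 2 * C) ?_
  filter_upwards [eventually_le_atBot (b - 1), eventually_le_atBot (-1), eventually_le_atBot (-b)]
    with t htb ht₁ ht
  have hsplit : ∫ s in Set.Ioi (t + 1), ‖g s‖ = (∫ s in Set.Ioc (t + 1) b, ‖g s‖) + I := by
    rw [← setIntegral_union (Set.Ioc_disjoint_Ioi le_rfl) measurableSet_Ioi
      ((hg (t + 1)).mono_set Set.Ioc_subset_Ioi_self).norm (hg b).norm,
      Set.Ioc_union_Ioi_eq_Ioi (by linarith)]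
  have hnear : ‖∫ s in Set.Ioc (t + 1) b, ‖g s‖‖ ≤ C * volume.real (Set.Ioc (t + 1) b) :=
    norm_setIntegral_le_of_norm_le_const measure_Ioc_lt_top fun s hs => by
      simpa only [norm_norm, norm_one, mul_one] using hb s hs.2
  rw [Real.volume_real_Ioc_of_le (by linarith)] at hnear
  have hnear' := (le_abs_self _).trans hnear
  rw [Real.norm_eq_abs, Real.norm_eq_abs, abs_abs, abs_of_nonpos (by linarith : t ≤ 0),
    abs_of_nonneg (add_nonneg zero_le_one (integral_nonneg fun s => norm_nonneg _)), hsplit]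
  nlinarith

end boundedConvolution

theorem convolve_isBigO_exp {h k : ℝ → ℝ} {δ δ₀ c M : ℝ} (hh : HasExpBounds h δ δ₀)
    (hc₀ : -δ₀ ≤ c) (hc : c ≤ δ) (hk : Integrable fun u => Real.exp (c * u) * k u)
    (hM : ∀ u, 1 ≤ ‖u‖ → ‖Real.exp (c * u) * k u‖ ≤ M) :
    (∀ᶠ t in cocompact ℝ, Integrable fun s => h s * k (t - s)) ∧
      convolve h k =O[cocompact ℝ] fun t => Real.exp (-(c * t)) := by
  obtain ⟨hint, hO⟩ := convolve_isBigO_one (hh.locallyIntegrable_exp_mul c)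
    (hh.exp_mul_isBigO_one_cocompact hc₀ hc) hk hM
  refine ⟨hint.mono fun t => integrable_of_exp_mul, ?_⟩
  simpa only [one_mul] using isBigO_exp_of_exp_mul_convolve hO

namespace IsExpansion

variable {A κ : ℝ} {Θ : ℂ → ℂ} {σ d : ℕ → ℝ} {h : ℝ → ℝ} {δ δ₀ c : ℝ} {n : ℕ}

theorem exists_bound_exp_mul_decayKernel (H : IsExpansion A Θ κ σ d) (hc₀ : -σ 0 ≤ c)
    (hc : c ≤ σ n) : ∃ M, ∀ u, 1 ≤ ‖u‖ → ‖Real.exp (c * u) * decayKernel d σ n u‖ ≤ M := by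
  set E := expSum (fun j => d (n + j)) (fun j => σ (n + j)) 1
  have hE : 0 ≤ Real.exp c * E :=
    mul_nonneg (Real.exp_pos c).le (expSum_nonneg (fun j => H.coeff_nonneg _) 1)
  have hE₀ : 0 ≤ Real.exp (-c) * expSum d σ 1 :=
    mul_nonneg (Real.exp_pos _).le (expSum_nonneg H.coeff_nonneg 1)
  refine ⟨Real.exp c * E + Real.exp (-c) * expSum d σ 1, fun u hu => ?_⟩
  rcases le_abs.1 (Real.norm_eq_abs u ▸ hu) with hu | hu
  · rw [decayKernel_of_pos (by linarith), Real.norm_of_nonneg (mul_nonneg (Real.exp_pos _).le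
      (expSum_nonneg (fun j => H.coeff_nonneg _) u))]
    exact le_add_of_le_of_nonneg (exp_mul_expSum_le (fun j => H.coeff_nonneg _)
      (fun j => H.pos _) (H.summable_shift n) (fun j => hc.trans (H.le_add n j)) hu) hE₀
  · rw [decayKernel_of_nonpos (by linarith), ← neg_mul_neg c u, Real.norm_of_nonneg
      (mul_nonneg (Real.exp_pos _).le (expSum_nonneg H.coeff_nonneg _))]
    exact le_add_of_nonneg_of_le hE (exp_mul_expSum_le H.coeff_nonneg H.pos H.summable
      (fun j => (neg_le.1 hc₀).trans (H.strictMono.monotone j.zero_le)) hu)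

theorem exists_bound_exp_mul_stripKernel (H : IsExpansion A Θ κ σ d) (hc : InStrip σ n c) :
    ∃ M, ∀ u, 1 ≤ ‖u‖ → ‖Real.exp (c * u) * stripKernel d σ n u‖ ≤ M := by
  obtain ⟨M, hM⟩ := H.exists_bound_exp_mul_decayKernel hc.neg_lt.le hc.lt_upper.le
  have hd : 0 ≤ ∑ j ∈ Finset.range n, d j := Finset.sum_nonneg fun j _ => H.coeff_nonneg j
  refine ⟨M + ∑ j ∈ Finset.range n, d j, fun u hu => ?_⟩
  rcases lt_or_ge 0 u with hu₀ | hu₀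
  · rw [stripKernel_of_pos hu₀]
    exact le_add_of_le_of_nonneg (hM u hu) hd
  · have hmodes : ‖Real.exp (c * u) * ∑ j ∈ Finset.range n, d j * Real.exp (-(σ j * u))‖ ≤
        ∑ j ∈ Finset.range n, d j := by
      rw [Finset.mul_sum]
      refine norm_sum_le_of_le _ fun j hj => ?_
      rw [mul_left_comm, ← Real.exp_add, Real.norm_of_nonneg
        (mul_nonneg (H.coeff_nonneg j) (Real.exp_pos _).le)]
      refine mul_le_of_le_one_right (H.coeff_nonneg j) (Real.exp_le_one_iff.2 ?_)
      linarith [mul_nonneg_of_nonpos_of_nonpos hu₀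
        (sub_nonpos.2 (hc.lower_lt j (Finset.mem_range.1 hj)).le)]
    rw [stripKernel_of_nonpos hu₀, mul_sub]
    exact (norm_sub_le _ _).trans (add_le_add (hM u hu) hmodes)

theorem convolve_stripKernel_isBigO (H : IsExpansion A Θ κ σ d) (hh : HasExpBounds h δ δ₀)
    (hδδ₀ : 0 ≤ δ + δ₀) (hδ : InStrip σ n δ) :
    (∀ᶠ t in cocompact ℝ, Integrable fun s => h s * stripKernel d σ n (t - s)) ∧
      convolve h (stripKernel d σ n) =O[cocompact ℝ] fun t => Real.exp (-(δ * t)) := by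
  obtain ⟨M, hM⟩ := H.exists_bound_exp_mul_stripKernel hδ
  exact convolve_isBigO_exp hh (by linarith) le_rfl (H.integrable_exp_mul_stripKernel hδ) hM

theorem convolve_decayKernel_isBigO_of_lt (H : IsExpansion A Θ κ σ d)
    (hh : HasExpBounds h δ δ₀) (hδδ₀ : 0 ≤ δ + δ₀) (hδ : δ < σ n) (hδ₀ : δ₀ < σ 0) :
    convolve h (decayKernel d σ n) =O[atBot] fun t => Real.exp (δ₀ * t) := by
  obtain ⟨M, hM⟩ := H.exists_bound_exp_mul_decayKernel (n := n) (c := -δ₀) (by linarith)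
    (by linarith)
  have hO := (convolve_isBigO_exp hh le_rfl (by linarith)
    (H.integrable_exp_mul_decayKernel (by linarith) (by linarith)) hM).2
  rw [cocompact_eq_atBot_atTop] at hO
  simpa only [neg_mul, neg_neg] using hO.mono le_sup_left

/-- The left tail of the kernel decays exactly like `e^{σ_0 u}`: with this weight the kernel is
bounded on the left, but not integrable. -/
theorem convolve_decayKernel_isBigO_integral (H : IsExpansion A Θ κ σ d)
    (hh : HasExpBounds h δ δ₀) (hδ : -σ 0 < δ) (hδ₀ : σ 0 ≤ δ₀) :
    convolve h (decayKernel d σ n) =O[atBot] fun t =>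
      (1 + ∫ s in Set.Ioi (t + 1), ‖Real.exp (-σ 0 * s) * h s‖) * Real.exp (σ 0 * t) := by
  have hσ₀ := H.pos 0
  have hσ : -σ 0 ≤ σ n := (neg_nonpos.2 hσ₀.le).trans (H.pos n).le
  obtain ⟨M, hM⟩ := H.exists_bound_exp_mul_decayKernel le_rfl hσ
  have hdecay : Integrable (decayKernel d σ n) := by
    simpa only [zero_mul, Real.exp_zero, one_mul] using
      H.integrable_exp_mul_decayKernel (n := n) (neg_lt_zero.2 hσ₀) (H.pos n)
  have hK : IntegrableOn (fun u => Real.exp (-σ 0 * u) * decayKernel d σ n u) (Set.Ici (-1)) := by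
    refine hdecay.integrableOn.bdd_mul (c := Real.exp (σ 0)) (by fun_prop)
      ((ae_restrict_iff' measurableSet_Ici).2 (.of_forall fun u hu => ?_))
    rw [Real.norm_of_nonneg (Real.exp_pos _).le, Real.exp_le_exp]
    nlinarith [Set.mem_Ici.1 hu]
  have hO := isBigO_exp_of_exp_mul_convolve (convolve_isBigO_integral_Ioi
    (hh.exp_mul_isBigO_one_atBot (neg_le_neg hδ₀)) (hh.integrableOn_Ioi_exp_mul hδ) hK
    fun u hu => hM u (by rw [Real.norm_eq_abs]; exact le_abs.2 (.inr (by linarith))))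
  simpa only [neg_mul, neg_neg] using hO

theorem convolve_decayKernel_isBigO (H : IsExpansion A Θ κ σ d) (hh : HasExpBounds h δ δ₀)
    (hδδ₀ : 0 ≤ δ + δ₀) (hδ₀ : -σ 0 < δ) (hδ : δ < σ n) :
    convolve h (decayKernel d σ n) =O[atBot] fun t =>
      if δ₀ < σ 0 then Real.exp (δ₀ * t)
      else if δ₀ = σ 0 then |t| * Real.exp (σ 0 * t)
      else Real.exp (σ 0 * t) := by
  rcases lt_trichotomy δ₀ (σ 0) with hlt | heq | hgt
  · simp only [if_pos hlt]
    exact H.convolve_decayKernel_isBigO_of_lt hh hδδ₀ hδ hlt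
  · simp only [heq, lt_irrefl, if_true, if_false]
    exact (H.convolve_decayKernel_isBigO_integral hh hδ₀ heq.ge).trans
      ((integral_Ioi_norm_isBigO_abs (hh.exp_mul_isBigO_one_atBot (neg_le_neg heq.ge))
        (hh.integrableOn_Ioi_exp_mul hδ₀)).mul (isBigO_refl _ _))
  · simp only [if_neg hgt.not_gt, if_neg hgt.ne']
    have hint := (hh.integrable_exp_mul (c := -σ 0) (by linarith) hδ₀).norm
    have hbound : (fun t => 1 + ∫ s in Set.Ioi (t + 1), ‖Real.exp (-σ 0 * s) * h s‖) =O[atBot]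
        fun _ => (1 : ℝ) := by
      refine .of_bound (1 + ∫ s, ‖Real.exp (-σ 0 * s) * h s‖) (.of_forall fun t => ?_)
      rw [norm_one, mul_one, Real.norm_of_nonneg
        (add_nonneg zero_le_one (integral_nonneg fun s => norm_nonneg _))]
      gcongr
      exacts [.of_forall fun s => norm_nonneg _, Measure.restrict_le_self]
    simpa only [one_mul] using (H.convolve_decayKernel_isBigO_integral hh hδ₀ hgt.le).trans
      (hbound.mul (isBigO_refl _ _))

end IsExpansion

theorem convolve_indicator_Iic_exp (h : ℝ → ℝ) (a b t : ℝ)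
    (hi : IntegrableOn (fun s => Real.exp (b * s) * h s) (Set.Ioi t)) :
    Integrable (fun s => h s * (Set.Iic 0).indicator (fun u => a * Real.exp (-(b * u))) (t - s)) ∧
      convolve h ((Set.Iic 0).indicator fun u => a * Real.exp (-(b * u))) t =
        a * (∫ s in Set.Ioi t, Real.exp (b * s) * h s) * Real.exp (-(b * t)) := by
  have heq : (fun s => h s * (Set.Iic 0).indicator (fun u => a * Real.exp (-(b * u))) (t - s)) =
      (Set.Ici t).indicator fun s => a * Real.exp (-(b * t)) * (Real.exp (b * s) * h s) := by
    funext s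
    simp only [Set.indicator_apply, Set.mem_Iic, Set.mem_Ici, sub_nonpos, mul_ite, mul_zero]
    refine if_congr Iff.rfl ?_ rfl
    rw [mul_sub, neg_sub, sub_eq_neg_add, Real.exp_add]
    ring
  rw [convolve, heq, integrable_indicator_iff measurableSet_Ici,
    integrableOn_Ici_iff_integrableOn_Ioi, integral_indicator measurableSet_Ici,
    integral_Ici_eq_integral_Ioi, integral_const_mul]
  exact ⟨hi.const_mul _, by ring⟩

theorem convolve_stripKernel_add {h : ℝ → ℝ} {d σ : ℕ → ℝ} {n : ℕ} {t : ℝ}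
    (hi : ∀ j < n, IntegrableOn (fun s => Real.exp (σ j * s) * h s) (Set.Ioi t))
    (ht : Integrable fun s => h s * stripKernel d σ n (t - s)) :
    convolve h (stripKernel d σ n) t + ∑ j ∈ Finset.range n,
      d j * (∫ s in Set.Ioi t, Real.exp (σ j * s) * h s) * Real.exp (-(σ j * t)) =
      convolve h (decayKernel d σ n) t := by
  have hmode : ∀ j ∈ Finset.range n, _ := fun j hj =>
    convolve_indicator_Iic_exp h (d j) (σ j) t (hi j (Finset.mem_range.1 hj))
  rw [← Finset.sum_congr rfl fun j hj => (hmode j hj).2]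
  simp only [convolve]
  rw [← integral_finsetSum _ fun j hj => (hmode j hj).1,
    ← integral_add ht (integrable_finsetSum _ fun j hj => (hmode j hj).1)]
  refine integral_congr_ae (.of_forall fun s => ?_)
  dsimp only
  rw [← Finset.mul_sum, ← mul_add, stripKernel]
  simp only [Set.indicator_apply]
  split_ifs
  · rw [sub_add_cancel]
  · rw [Finset.sum_const_zero, sub_zero, add_zero]

theorem sphereEigenvalue_nonneg {N : ℕ} (hN : 2 ≤ N) (m : ℕ) : 0 ≤ sphereEigenvalue N m := by
  have hN' : (2 : ℝ) ≤ N := Nat.ofNat_le_cast.2 hN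
  have hdeg : (0 : ℝ) ≤ harmonicDegree N m := Nat.cast_nonneg _
  exact mul_nonneg hdeg (by linarith)

theorem constA_eq (N : ℕ) (γ : ℝ) (m : ℕ) : constA N γ m = constB N γ m + γ := by
  rw [constA, constB]
  ring

theorem symbol_eq_gammaQuot (N : ℕ) (γ : ℝ) (m : ℕ) :
    symbol N γ m = gammaQuot (constB N γ m + γ) (constB N γ m) γ := by
  rw [← constA_eq]
  rfl

theorem div_four_le_constB {N : ℕ} (hN : 2 ≤ N) (γ : ℝ) (m : ℕ) :
    ((N : ℝ) - 2 * γ) / 4 ≤ constB N γ m := by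
  have hsqrt : (N : ℝ) / 2 - 1 ≤ √(((N : ℝ) / 2 - 1) ^ 2 + sphereEigenvalue N m) :=
    Real.le_sqrt_of_sq_le (le_add_of_nonneg_right (sphereEigenvalue_nonneg hN m))
  rw [constB]
  linarith

theorem hardyConst_eq_gammaQuot (N : ℕ) (γ : ℝ) :
    hardyConst N γ =
      (gammaQuot (((N : ℝ) - 2 * γ) / 4 + γ) (((N : ℝ) - 2 * γ) / 4) γ 0).re := by
  rw [gammaQuot_zero, Complex.ofReal_re, hardyConst]
  congr 4
  ring

theorem exists_isExpansion_symbol {N : ℕ} (hN : 2 ≤ N) {γ : ℝ} (hγ₀ : 0 < γ) (hγ₁ : γ < 1) (m : ℕ)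
    {κ : ℝ} (hκ₀ : 0 ≤ κ) (hκ : κ < hardyConst N γ) :
    ∃ A σ d, IsExpansion A (symbol N γ m) κ σ d := by
  have hN' : (2 : ℝ) ≤ N := Nat.ofNat_le_cast.2 hN
  have hκΘ : κ < (gammaQuot (constB N γ m + γ) (constB N γ m) γ 0).re :=
    (hκ.trans_eq (hardyConst_eq_gammaQuot N γ)).trans_le
      (gammaQuot_zero_mono (by linarith) hγ₀.le (div_four_le_constB hN γ m))
  have hB : 0 < constB N γ m := by linarith [div_four_le_constB hN γ m]
  rw [symbol_eq_gammaQuot]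
  exact ⟨_, exists_isExpansion hB hγ₀ hγ₁ hκ₀ hκΘ⟩

theorem sq_ne_neg_of_pos {z : ℂ} (hz : z.re ≠ 0 ∨ z.im = 0) {r : ℝ} (hr : 0 < r) :
    z ^ 2 ≠ -(r : ℂ) := fun heq => by
  have hre : z.re * z.re - z.im * z.im = -r := by
    simpa only [pow_two, Complex.mul_re, Complex.neg_re, Complex.ofReal_re] using
      congrArg Complex.re heq
  have him : z.re * z.im + z.im * z.re = 0 := by
    simpa only [pow_two, Complex.mul_im, Complex.neg_im, Complex.ofReal_im, neg_zero] using
      congrArg Complex.im heq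
  have him₀ : z.im = 0 :=
    hz.elim (fun hne => (mul_eq_zero.1 (by linarith : z.re * z.im = 0)).resolve_left hne) id
  rw [him₀] at hre
  nlinarith [mul_self_nonneg z.re]

theorem convolve_congr_ae {k k' : ℝ → ℝ} (h : ℝ → ℝ) (hk : k =ᵐ[volume] k') :
    convolve h k = convolve h k' := by
  funext t
  refine integral_congr_ae ?_
  filter_upwards [(volume.measurePreserving_sub_left t).quasiMeasurePreserving.ae_eq_comp hk]
    with s hs
  exact congrArg (h s * ·) hs

theorem mode_zero (σ d : ℕ → ℝ) (j : ℕ) (t : ℝ) :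
    mode 0 σ d 0 j t = d j * Real.exp (-(σ j * t)) := by
  simp only [mode, Pi.zero_apply, zero_mul, Real.cos_zero, mul_one, add_zero]
  exact mul_comm _ _

theorem multipole_zero (σ d : ℕ → ℝ) (h : ℝ → ℝ) (j : ℕ) (t : ℝ) :
    multipole 0 σ d 0 h j t = -(d j * ∫ s in Set.Ioi t, Real.exp (σ j * s) * h s) := by
  simp only [multipole, Pi.zero_apply, zero_mul, Real.cos_zero, Real.sin_zero, mul_one, one_mul,
    add_zero]

theorem tendsto_multipole_zero {σ d : ℕ → ℝ} {h : ℝ → ℝ} {j : ℕ}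
    (hi : Integrable fun s => Real.exp (σ j * s) * h s) :
    Tendsto (multipole 0 σ d 0 h j) atBot (𝓝 (-(d j * ∫ s, Real.exp (σ j * s) * h s))) := by
  have hlim : Tendsto (fun t => ∫ s in Set.Ioi t, Real.exp (σ j * s) * h s) atBot
      (𝓝 (∫ s, Real.exp (σ j * s) * h s)) :=
    (aecover_Ioi tendsto_id).integral_tendsto_of_countably_generated hi
  exact ((hlim.const_mul (d j)).neg).congr fun t => (multipole_zero σ d h j t).symm

namespace IsExpansion

variable {A κ : ℝ} {Θ : ℂ → ℂ} {σ d : ℕ → ℝ}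

theorem setOf_orderAt_neg (H : IsExpansion A Θ κ σ d) :
    {z : ℂ | meromorphicOrderAt (fun z => 1 / (Θ z - κ)) z < 0} =
      {z : ℂ | ∃ j : ℕ,
        z = ((0 : ℕ → ℝ) j : ℂ) + σ j * Complex.I ∨ z = ((0 : ℕ → ℝ) j : ℂ) - σ j * Complex.I ∨
        z = -((0 : ℕ → ℝ) j : ℂ) + σ j * Complex.I ∨
        z = -((0 : ℕ → ℝ) j : ℂ) - σ j * Complex.I} := by
  ext z
  simp only [Set.mem_ofPred_eq, H.orderAt_neg_iff, Pi.zero_apply, Complex.ofReal_zero, neg_zero,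
    zero_add, zero_sub]
  exact exists_congr fun j => by tauto

theorem exists_residue (H : IsExpansion A Θ κ σ d) (j : ℕ) :
    ∃ ρ : ℂ, HasResidue (fun z => 1 / (Θ z - κ)) (((0 : ℕ → ℝ) j : ℂ) + σ j * Complex.I) ρ ∧
      (d j : ℂ) - (0 : ℕ → ℝ) j * Complex.I =
        (if (0 : ℕ → ℝ) j = 0 then 1 else 2) * Complex.I * ρ := by
  simp only [Pi.zero_apply, Complex.ofReal_zero, zero_add, zero_mul, sub_zero, if_true, one_mul]
  exact ⟨_, H.hasResidue j, (mul_div_cancel₀ _ Complex.I_ne_zero).symm⟩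

theorem inStrip_zero (H : IsExpansion A Θ κ σ d) : InStrip σ 0 0 where
  neg_lt := neg_lt_zero.2 (H.pos 0)
  lower_lt _ hj := absurd hj (Nat.not_lt_zero _)
  lt_upper := H.pos 0

theorem inStrip_succ (H : IsExpansion A Θ κ σ d) {J : ℕ} {ϑ : ℝ} (hJ : σ J < ϑ)
    (hϑ : ϑ < σ (J + 1)) : InStrip σ (J + 1) ϑ where
  neg_lt := (neg_lt_zero.2 (H.pos 0)).trans ((H.pos J).trans hJ)
  lower_lt _ hj := (H.strictMono.monotone (Nat.le_of_lt_succ hj)).trans_lt hJ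
  lt_upper := hϑ

theorem summable_mode (H : IsExpansion A Θ κ σ d) (n : ℕ) {t : ℝ} (ht : 0 < t) :
    Summable fun j => mode 0 σ d 0 (n + j) t := by
  simp_rw [mode_zero]
  exact summable_exp_terms (fun j => H.coeff_nonneg _) (fun j => H.pos _) (H.summable_shift n) ht

theorem green_eq_stripKernel (H : IsExpansion A Θ κ σ d) {t : ℝ} (ht : t ≠ 0) :
    green 0 σ d 0 t = stripKernel d σ 0 t := by
  have hsum : green 0 σ d 0 t = expSum d σ |t| := by
    simp only [green, mode_zero, expSum]
    exact (summable_exp_terms H.coeff_nonneg H.pos H.summable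
      (abs_pos.2 ht)).tsum_eq_zero_add.symm
  rcases lt_or_gt_of_ne ht with hneg | hpos
  · rw [hsum, stripKernel_of_nonpos hneg.le, decayKernel_of_nonpos hneg.le, Finset.sum_range_zero,
      sub_zero, abs_of_neg hneg]
  · rw [hsum, stripKernel_of_pos hpos, decayKernel_of_pos hpos, abs_of_pos hpos]
    simp only [zero_add]

theorem shiftedGreen_eq_stripKernel (H : IsExpansion A Θ κ σ d) (J : ℕ) {t : ℝ} (ht : t ≠ 0) :
    shiftedGreen 0 σ d 0 J t = stripKernel d σ (J + 1) t := by
  rcases lt_or_gt_of_ne ht with hneg | hpos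
  · rw [shiftedGreen, if_neg hneg.not_gt, H.green_eq_stripKernel ht,
      stripKernel_of_nonpos hneg.le, stripKernel_of_nonpos hneg.le, decayKernel_of_nonpos hneg.le,
      decayKernel_of_nonpos hneg.le, Finset.sum_range_zero, sub_zero]
    simp only [mode_zero]
  · rw [shiftedGreen, if_pos hpos, stripKernel_of_pos hpos, decayKernel_of_pos hpos]
    simp only [mode_zero, expSum]

theorem green_ae_eq (H : IsExpansion A Θ κ σ d) : green 0 σ d 0 =ᵐ[volume] stripKernel d σ 0 :=
  ((Set.countable_singleton 0).ae_notMem volume).mono fun _ => H.green_eq_stripKernel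

theorem shiftedGreen_ae_eq (H : IsExpansion A Θ κ σ d) (J : ℕ) :
    shiftedGreen 0 σ d 0 J =ᵐ[volume] stripKernel d σ (J + 1) :=
  ((Set.countable_singleton 0).ae_notMem volume).mono fun _ => H.shiftedGreen_eq_stripKernel J

theorem hasSum_shiftedGreen (H : IsExpansion A Θ κ σ d) (J : ℕ) {t : ℝ} (ht : 0 < t) :
    HasSum (fun j => mode 0 σ d 0 (J + 1 + j) t) (shiftedGreen 0 σ d 0 J t) := by
  rw [shiftedGreen, if_pos ht]
  exact (H.summable_mode (J + 1) ht).hasSum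

section lines

variable {n : ℕ} {k : ℝ → ℝ}

theorem integrable_exp_mul_of_ae_eq (H : IsExpansion A Θ κ σ d)
    (hk : k =ᵐ[volume] stripKernel d σ n) {ϑ : ℝ} (hϑ : InStrip σ n ϑ) :
    Integrable fun t => Real.exp (ϑ * t) * k t :=
  (H.integrable_exp_mul_stripKernel hϑ).congr ((EventuallyEq.refl _ _).mul hk.symm)

theorem mul_fourier_of_ae_eq (H : IsExpansion A Θ κ σ d) (hk : k =ᵐ[volume] stripKernel d σ n)
    {ξ ϑ : ℝ} (hϑ : InStrip σ n ϑ) (hξ : ξ ≠ 0 ∨ ϑ = 0) :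
    (Θ (ξ + ϑ * Complex.I) - κ) *
      ∫ t : ℝ, Complex.exp (-(Complex.I * ((ξ : ℂ) + ϑ * Complex.I) * t)) * (k t : ℂ) = 1 := by
  set z : ℂ := ξ + ϑ * Complex.I with hz
  have hre : z.re = ξ := by
    rw [hz, Complex.add_re, Complex.ofReal_re, Complex.re_ofReal_mul, Complex.I_re, mul_zero,
      add_zero]
  have him : z.im = ϑ := by
    rw [hz, Complex.add_im, Complex.ofReal_im, Complex.im_ofReal_mul, Complex.I_im, mul_one,
      zero_add]
  have hsq : ∀ {r : ℝ}, 0 < r → z ^ 2 ≠ -(r : ℂ) := sq_ne_neg_of_pos (by rwa [hre, him])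
  have hpole : ∀ j, z ^ 2 ≠ -((σ j ^ 2 : ℝ) : ℂ) := fun j => hsq (pow_pos (H.pos j) 2)
  have hfourier : ∫ t : ℝ, Complex.exp (-(Complex.I * z * t)) * (k t : ℂ) =
      resolventSum σ d z := by
    rw [H.resolventSum_eq hpole, ← (H.fourier_stripKernel (n := n) (by rwa [him])).2]
    exact integral_congr_ae (hk.mono fun t ht => by simp only [ht])
  rw [hfourier]
  exact H.identity z (fun k => hsq (node_pos H.base_pos k)) hpole

end lines

theorem contDiffOn_green (H : IsExpansion A Θ κ σ d) {r : WithTop ℕ∞} :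
    ContDiffOn ℝ r (green 0 σ d 0) {0}ᶜ :=
  H.contDiffOn_stripKernel.congr fun _ => H.green_eq_stripKernel

theorem contDiffOn_shiftedGreen (H : IsExpansion A Θ κ σ d) (J : ℕ) {r : WithTop ℕ∞} :
    ContDiffOn ℝ r (shiftedGreen 0 σ d 0 J) {0}ᶜ :=
  H.contDiffOn_stripKernel.congr fun _ => H.shiftedGreen_eq_stripKernel J

theorem integrable_green (H : IsExpansion A Θ κ σ d) : Integrable (green 0 σ d 0) := by
  simpa only [zero_mul, Real.exp_zero, one_mul] using
    H.integrable_exp_mul_of_ae_eq H.green_ae_eq H.inStrip_zero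

theorem fourier_green (H : IsExpansion A Θ κ σ d) (ξ : ℝ) :
    ∫ t : ℝ, Complex.exp (-(Complex.I * ξ * t)) * (green 0 σ d 0 t : ℂ) = 1 / (Θ ξ - κ) := by
  have hmul := H.mul_fourier_of_ae_eq H.green_ae_eq (ξ := ξ) H.inStrip_zero (.inr rfl)
  simp only [Complex.ofReal_zero, zero_mul, add_zero] at hmul
  exact eq_one_div_of_mul_eq_one_right hmul

theorem fourier_shiftedGreen (H : IsExpansion A Θ κ σ d) {J : ℕ} {ϑ : ℝ}
    (hϑ : InStrip σ (J + 1) ϑ) :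
    ∀ᵐ ξ : ℝ, ∫ t : ℝ, Complex.exp (-(Complex.I * ((ξ : ℂ) + ϑ * Complex.I) * t)) *
      (shiftedGreen 0 σ d 0 J t : ℂ) = 1 / (Θ (ξ + ϑ * Complex.I) - κ) :=
  ((Set.countable_singleton 0).ae_notMem volume).mono fun _ hξ =>
    eq_one_div_of_mul_eq_one_right
      (H.mul_fourier_of_ae_eq (H.shiftedGreen_ae_eq J) hϑ (.inl hξ))

section solution

variable {h k : ℝ → ℝ} {δ δ₀ ϑ : ℝ} {n : ℕ}

theorem ae_integrable_convolve (H : IsExpansion A Θ κ σ d)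
    (hk : k =ᵐ[volume] stripKernel d σ n) (hh : HasExpBounds h δ δ₀) (hϑ : InStrip σ n ϑ)
    (hϑ₀ : -δ₀ ≤ ϑ) (hϑδ : ϑ ≤ δ) : ∀ᵐ t : ℝ, Integrable fun s => h s * k (t - s) :=
  HardyCylinder.ae_integrable_convolve (hh.isSumL1Linf_exp_mul hϑ₀ hϑδ)
    (H.integrable_exp_mul_of_ae_eq hk hϑ)

theorem isSolution_convolve {N m : ℕ} {γ : ℝ} (H : IsExpansion A (symbol N γ m) κ σ d)
    (hk : k =ᵐ[volume] stripKernel d σ n) (hh : HasExpBounds h δ δ₀) (hϑ : InStrip σ n ϑ)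
    (hϑ₀ : -δ₀ ≤ ϑ) (hϑδ : ϑ ≤ δ) : IsSolution N γ m κ ϑ (convolve h k) h :=
  HardyCylinder.isSolution_convolve (hh.isSumL1Linf_exp_mul hϑ₀ hϑδ)
    (H.integrable_exp_mul_of_ae_eq hk hϑ)
    (((Set.countable_singleton 0).ae_notMem volume).mono fun _ hξ =>
      H.mul_fourier_of_ae_eq hk hϑ (.inl hξ))

end solution

section asymptotics

variable {h : ℝ → ℝ} {δ δ₀ : ℝ} {J : ℕ}

theorem convolve_shiftedGreen_isBigO (H : IsExpansion A Θ κ σ d) (hh : HasExpBounds h δ δ₀)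
    (hδδ₀ : 0 ≤ δ + δ₀) (hδ : InStrip σ (J + 1) δ) :
    convolve h (shiftedGreen 0 σ d 0 J) =O[atTop] fun t => Real.exp (-(δ * t)) := by
  rw [convolve_congr_ae h (H.shiftedGreen_ae_eq J)]
  exact (H.convolve_stripKernel_isBigO hh hδδ₀ hδ).2.mono atTop_le_cocompact

theorem convolve_shiftedGreen_sub_multipoles_isBigO (H : IsExpansion A Θ κ σ d)
    (hh : HasExpBounds h δ δ₀) (hδδ₀ : 0 ≤ δ + δ₀) (hδ : InStrip σ (J + 1) δ) :
    (fun t => convolve h (shiftedGreen 0 σ d 0 J) t -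
      ∑ j ∈ Finset.range (J + 1), multipole 0 σ d 0 h j t * Real.exp (-(σ j * t))) =O[atBot]
      fun t => if δ₀ < σ 0 then Real.exp (δ₀ * t)
        else if δ₀ = σ 0 then |t| * Real.exp (σ 0 * t)
        else Real.exp (σ 0 * t) := by
  rw [convolve_congr_ae h (H.shiftedGreen_ae_eq J)]
  refine (H.convolve_decayKernel_isBigO (n := J + 1) hh hδδ₀ hδ.neg_lt hδ.lt_upper).congr' ?_ .rfl
  filter_upwards [(H.convolve_stripKernel_isBigO hh hδδ₀ hδ).1.filter_mono atBot_le_cocompact]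
    with t ht
  rw [← convolve_stripKernel_add
    (fun j hj => hh.integrableOn_Ioi_exp_mul (hδ.lower_lt j hj) t) ht]
  simp only [multipole_zero, neg_mul, Finset.sum_neg_distrib, sub_neg_eq_add]

end asymptotics

end IsExpansion

end HardyCylinder

end

open HardyCylinder

theorem theorem5p2 (N : ℕ) (hN : 2 ≤ N) (γ : ℝ) (hγ0 : 0 < γ) (hγ1 : γ < 1) (m : ℕ)
    (κ : ℝ) (hκ0 : 0 ≤ κ) (hκ : κ < HardyCylinder.hardyConst N γ) :
    ∃ τ σ d d' : ℕ → ℝ,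
      -- (i) the poles
      (Meromorphic (HardyCylinder.resolventSymbol N γ m κ) ∧
        {z : ℂ | meromorphicOrderAt (HardyCylinder.resolventSymbol N γ m κ) z < 0} =
          {z : ℂ | ∃ j : ℕ,
            z = (τ j : ℂ) + σ j * Complex.I ∨ z = (τ j : ℂ) - σ j * Complex.I ∨
            z = -(τ j : ℂ) + σ j * Complex.I ∨ z = -(τ j : ℂ) - σ j * Complex.I} ∧
        Function.Injective (fun j => (τ j, σ j)) ∧ Monotone σ ∧
        0 < σ 0 ∧ (∀ j, 1 ≤ j → σ 0 < σ j) ∧ (∀ j, 0 ≤ τ j) ∧ τ 0 = 0 ∧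
        (∃ j₀ : ℕ, (∀ j, j₀ ≤ j → τ j = 0) ∧ StrictMonoOn σ (Set.Ici j₀)) ∧
        Tendsto σ atTop atTop) ∧
      -- the constants, through the residues at the poles of the upper half-plane
      (∀ j, ∃ ρ : ℂ,
        HardyCylinder.HasResidue (HardyCylinder.resolventSymbol N γ m κ)
          ((τ j : ℂ) + σ j * Complex.I) ρ ∧
        (d j : ℂ) - d' j * Complex.I = (if τ j = 0 then 1 else 2) * Complex.I * ρ) ∧
      -- (ii) the Green's function and the solution that it gives
      ((∀ t : ℝ, t ≠ 0 → Summable (fun j : ℕ => HardyCylinder.mode τ σ d d' (j + 1) |t|)) ∧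
        (∀ t : ℝ, HardyCylinder.green τ σ d d' (-t) = HardyCylinder.green τ σ d d' t) ∧
        ContDiffOn ℝ ((⊤ : ℕ∞) : WithTop ℕ∞) (HardyCylinder.green τ σ d d') {0}ᶜ ∧
        Integrable (HardyCylinder.green τ σ d d') ∧
        (∀ ξ : ℝ,
          ∫ t : ℝ, Complex.exp (-(Complex.I * ξ * t)) * (HardyCylinder.green τ σ d d' t : ℂ) =
            HardyCylinder.resolventSymbol N γ m κ ξ) ∧
        ∀ (h : ℝ → ℝ) (δ δ₀ : ℝ), LocallyIntegrable h →
          h =O[atTop] (fun t => Real.exp (-(δ * t))) →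
          h =O[atBot] (fun t => Real.exp (δ₀ * t)) →
          0 < δ → 0 ≤ δ₀ →
          (∀ᵐ t : ℝ, Integrable (fun s => h s * HardyCylinder.green τ σ d d' (t - s))) ∧
          HardyCylinder.IsSolution N γ m κ 0
            (HardyCylinder.convolve h (HardyCylinder.green τ σ d d')) h) ∧
      -- (iii) the shifted Green's functions and the multipole expansion
      (∀ J : ℕ,
        (∀ t : ℝ, 0 < t → HasSum (fun j : ℕ => HardyCylinder.mode τ σ d d' (J + 1 + j) t)
          (HardyCylinder.shiftedGreen τ σ d d' J t)) ∧
        ContDiffOn ℝ ((⊤ : ℕ∞) : WithTop ℕ∞) (HardyCylinder.shiftedGreen τ σ d d' J) {0}ᶜ ∧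
        (∀ ϑ : ℝ, σ J < ϑ → ϑ < σ (J + 1) →
          Integrable (fun t => Real.exp (ϑ * t) * HardyCylinder.shiftedGreen τ σ d d' J t) ∧
          ∀ᵐ ξ : ℝ,
            ∫ t : ℝ, Complex.exp (-(Complex.I * ((ξ : ℂ) + ϑ * Complex.I) * t)) *
                (HardyCylinder.shiftedGreen τ σ d d' J t : ℂ) =
              HardyCylinder.resolventSymbol N γ m κ ((ξ : ℂ) + ϑ * Complex.I)) ∧
        ∀ (h : ℝ → ℝ) (δ δ₀ : ℝ), LocallyIntegrable h →
          h =O[atTop] (fun t => Real.exp (-(δ * t))) →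
          h =O[atBot] (fun t => Real.exp (δ₀ * t)) →
          0 ≤ δ + δ₀ → σ J < δ → δ < σ (J + 1) →
          (∀ᵐ t : ℝ,
            Integrable (fun s => h s * HardyCylinder.shiftedGreen τ σ d d' J (t - s))) ∧
          (∀ ϑ : ℝ, σ J < ϑ → ϑ < σ (J + 1) → -δ₀ ≤ ϑ → ϑ ≤ δ →
            HardyCylinder.IsSolution N γ m κ ϑ
              (HardyCylinder.convolve h (HardyCylinder.shiftedGreen τ σ d d' J)) h) ∧
          HardyCylinder.convolve h (HardyCylinder.shiftedGreen τ σ d d' J)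
            =O[atTop] (fun t => Real.exp (-(δ * t))) ∧
          (∀ j, j ≤ J → ∀ t : ℝ, IntegrableOn (fun s => Real.exp (σ j * s) * h s) (Set.Ioi t)) ∧
          (fun t => HardyCylinder.convolve h (HardyCylinder.shiftedGreen τ σ d d' J) t -
              ∑ j ∈ Finset.range (J + 1),
                HardyCylinder.multipole τ σ d d' h j t * Real.exp (-(σ j * t)))
            =O[atBot] (fun t =>
              if δ₀ < σ 0 then Real.exp (δ₀ * t)
              else if δ₀ = σ 0 then |t| * Real.exp (σ 0 * t)
              else Real.exp (σ 0 * t)) ∧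
          (∀ j, j ≤ J → 0 < σ j + δ₀ → Integrable (fun s => Real.exp (σ j * s) * h s)) ∧
          (∀ j, j ≤ J → τ j = 0 → Integrable (fun s => Real.exp (σ j * s) * h s) →
            Tendsto (HardyCylinder.multipole τ σ d d' h j) atBot
              (𝓝 (-(d j * ∫ s : ℝ, Real.exp (σ j * s) * h s))))) := by
  obtain ⟨A, σ, d, H⟩ := exists_isExpansion_symbol hN hγ0 hγ1 m hκ0 hκ
  refine ⟨0, σ, d, 0, ⟨H.meromorphic, H.setOf_orderAt_neg,
      fun i j hij => H.strictMono.injective (congrArg Prod.snd hij), H.strictMono.monotone, H.pos 0,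
      fun _ hj => H.strictMono hj,
      fun _ => le_rfl, rfl, ⟨0, fun _ _ => rfl, H.strictMono.strictMonoOn _⟩, H.tendsto⟩,
    H.exists_residue,
    ⟨fun t ht => ?_, fun t => by simp only [green, abs_neg], H.contDiffOn_green,
      H.integrable_green, H.fourier_green, fun h δ δ₀ hloc htop hbot hδ hδ₀ => ?_⟩,
    fun J => ⟨fun t ht => H.hasSum_shiftedGreen J ht, H.contDiffOn_shiftedGreen J,
      fun ϑ hJ hϑ => ⟨H.integrable_exp_mul_of_ae_eq (H.shiftedGreen_ae_eq J) (H.inStrip_succ hJ hϑ),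
        H.fourier_shiftedGreen (H.inStrip_succ hJ hϑ)⟩,
      fun h δ δ₀ hloc htop hbot hδδ₀ hJ hδ => ?_⟩⟩
  · simpa only [add_comm 1] using H.summable_mode 1 (abs_pos.2 ht)
  · have hh : HasExpBounds h δ δ₀ := ⟨hloc, htop, hbot⟩
    exact ⟨H.ae_integrable_convolve H.green_ae_eq hh H.inStrip_zero (neg_nonpos.2 hδ₀) hδ.le,
      H.isSolution_convolve H.green_ae_eq hh H.inStrip_zero (neg_nonpos.2 hδ₀) hδ.le⟩
  · have hh : HasExpBounds h δ δ₀ := ⟨hloc, htop, hbot⟩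
    have hstrip := H.inStrip_succ hJ hδ
    have hlt {j : ℕ} (hj : j ≤ J) : σ j < δ := hstrip.lower_lt j (Nat.lt_succ_of_le hj)
    have hk := H.shiftedGreen_ae_eq J
    exact ⟨H.ae_integrable_convolve hk hh hstrip (by linarith) le_rfl,
      fun ϑ hϑJ hϑ => H.isSolution_convolve hk hh (H.inStrip_succ hϑJ hϑ),
      H.convolve_shiftedGreen_isBigO hh hδδ₀ hstrip,
      fun j hj => hh.integrableOn_Ioi_exp_mul (hlt hj),
      H.convolve_shiftedGreen_sub_multipoles_isBigO hh hδδ₀ hstrip,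
      fun j hj hj₀ => hh.integrable_exp_mul hj₀ (hlt hj),
      fun j _ _ => tendsto_multipole_zero⟩
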